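/- **Conventions.** Fix a universe $\mathcal U$. A $\mathcal U$-category is a category with $\mathcal U$-small hom-sets that is equivalent to a category all of whose objects and arrows are elements of $\mathcal U$. A $\mathcal U$-topos is a category equivalent to the category of $\mathcal U$-valued sheaves on a $\mathcal U$-small site. A sink $\langle X,S\rangle$ is a set $S$ of arrows with common target $X$; it is epi if arrows $g,h\colon X\to Z$ with $gs=hs$ for all $s\in S$ are equal. A colimit is universal if it is preserved by pullback along every arrow into the colimit object. A *clopos structure* on a category $\mathcal C$ is a set $\mathcal O$ of arrows that (G1) contains all isomorphisms, consists of arrows whose pullbacks along arbitrary arrows exist, and is stable under composition and pullback. $\mathcal O/X$ is the full subcategory of $\mathcal C/X$ on the arrows of $\mathcal O$. A parallel pair $u,v\colon R\rightrightarrows X$ is *$\mathcal O$-coequalizable* if $qu=qv$ for some $q\in\mathcal O$ with source $X$, and *locally $\mathcal O$-coequalizable* if there is an epi sink of arrows $f\colon X'\to X$ of $\mathcal O$ such that each inverse image pair $X'\times_XR\times_XX'\rightrightarrows X'$ is $\mathcal O$-coequalizable. $(\mathcal C,\mathcal O)$ is a *$\mathcal U$-glutos* if $\mathcal C$ is a $\mathcal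 U$-category, $\mathcal O$ is a clopos structure and: (G2) $fg\in\mathcal O$ and $f\in\mathcal O$ imply $g\in\mathcal O$; (G3) every $\mathcal O/X$ is a $\mathcal U$-topos and every $f^*\colon\mathcal O/Y\to\mathcal O/X$ ($f\colon X\to Y$ in $\mathcal C$) is an inverse image of a geometric morphism; (G4$_{\mathcal U}$) $\mathcal C$ has disjoint universal $\mathcal U$-small coproducts with injections in $\mathcal O$, and for every $\mathcal U$-small family $U_i\to X$ in $\mathcal O$ the arrow $\coprod U_i\to X$ is in $\mathcal O$; (G5) every epi in $\mathcal O$ is effective; if $fp,p\in\mathcal O$ and $p$ is epi then $f\in\mathcal O$; every locally $\mathcal O$-coequalizable equivalence relation $u,v$ with $u,v\in\mathcal O$ is effective and has a universal coequalizer, which lies in $\mathcal O$; (G5P) if $r\colon X\to R$ is an epi in $\mathcal O$, and $g\colon R\to S$, $f\colon Y\to S$ are such that the pullback of $f$ along $gr$ exists, then the pullback of $f$ along $g$ exists. A *presite* $(\mathcal C,\tau)$ is a category with a pretopology: a class $\tau$ of sinks (coverings) whose members can be pulled back along arbitrary arrows, containing the isomorphisms, stable under pullback and composition, and such that a sink of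 clopen arrows having a refinement in $\tau$ is in $\tau$. Here the set $\mathcal O_\tau$ of *clopen* arrows consists of the arrows belonging to some covering, and $T$ refines $S$ if each member of $T$ factors through a member of $S$. It is an *$\mathcal M$-presite* if all coverings consist of monos; $\mathcal M\tau$ is the set of coverings of $\tau$ consisting of monos, and $\mathcal M(\mathcal C,\tau)=(\mathcal C,\mathcal M\tau)$. It is a *$\mathcal U$-presite* if $\mathcal C$ is a $\mathcal U$-category and each object $X$ has a $\mathcal U$-small set $G_X$ of objects such that for each clopen $U\to X$ the object $U$ has a covering by arrows with sources in $G_X$. A functor between presites is *continuous* if it preserves coverings, clopen arrows, and pullbacks of clopen arrows along arbitrary arrows; $[\mathcal C,\mathcal D]$ is the category of continuous functors and natural transformations. Two presites are naturally equivalent if there is an equivalence of categories which is continuous in both directions. A $\mathcal U$-glutos $(\mathcal D,\mathcal O)$ is regarded as a presite whose coverings are all epi sinks of arrows of $\mathcal O$. A *universal $\mathcal U$-glutos* of a $\mathcal U$-presite $\mathcal B$ is a $\mathcal U$-glutos $\widetilde{\mathcal B}$ with a continuous functor $Y\colon\mathcal B\to\widetilde{\mathcal B}$ such that for each $\mathcal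 U$-glutos $\mathcal E$ the functor $[Y,\mathcal E]\colon[\widetilde{\mathcal B},\mathcal E]\to[\mathcal B,\mathcal E]$, $\sigma\mapsto\sigma Y$, is an equivalence having a right inverse. A *nearly $\mathcal U$-glutos* is a $\mathcal U$-presite naturally equivalent to $\mathcal M\widetilde{\mathcal B}$ for some $\mathcal U$-presite $\mathcal B$ and some universal $\mathcal U$-glutos $\widetilde{\mathcal B}$ of $\mathcal B$. A *gluon* indexed by a set $I$ consists of objects $U_i$, $U_{ij}$ and arrows $d_0^{ij}\colon U_{ij}\to U_i$, $d_1^{ij}\colon U_{ij}\to U_j$ ($i,j\in I$) such that: each pair $(d_0^{ij},d_1^{ij})$ is jointly monic; there are $\tau_{ij}\colon U_{ij}\to U_{ji}$ with $d_0^{ji}\tau_{ij}=d_1^{ij}$, $d_1^{ji}\tau_{ij}=d_0^{ij}$; there are common sections $s_i\colon U_i\to U_{ii}$ of $d_0^{ii}$ and $d_1^{ii}$; and for all $i,j,k$ there are an object $U_{ijk}$ and arrows $p_0,p,p_1$ from it to $U_{ij},U_{ik},U_{jk}$ such that the three squares $d_0^{ij}p_0=d_0^{ik}p$, $d_1^{ij}p_0=d_0^{jk}p_1$,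 $d_1^{ik}p=d_1^{jk}p_1$ are pullbacks. It is clopen if all $d_\varepsilon^{ij}$ are, and locally $\mathcal O$-coequalizable if all pairs $(d_0^{ii},d_1^{ii})$ are. **Proposition.** Let $(\mathcal C,\tau)$ be an $\mathcal M$-presite such that $\mathcal C$ is a $\mathcal U$-category and $\tau$ is subcanonical. Then $(\mathcal C,\tau)$ is a nearly $\mathcal U$-glutos if and only if the following hold, with $\mathcal O=\mathcal O_\tau$: (G4$_{\mathcal U}$+5) every $\mathcal U$-small clopen locally $\mathcal O$-coequalizable gluon has a universal colimit $U_\bullet$ whose colimit cone $U_i\to U_\bullet$ consists of clopen arrows, and which is effective, i.e. $U_{ij}\cong U_i\times_{U_\bullet}U_j$ for all $i,j$; (NG1) for every object $X$ the set of clopen subobjects of $X$ is $\mathcal U$-small; (NG2) every family $\{U_i\to X\}_{i\in I}$ of clopen arrows factors as a covering $\{U_i\to U_\bullet\}_{i\in I}$ followed by a clopen arrow $U_\bullet\to X$; (NG3) every epi sink consisting of clopen arrows is a covering. Moreover, if (NG2) holds, then any set of clopen subobjects of an object $X$ has a least upper bound in the ordered set of all subobjects of $X$, and it is clopen; if (NG3)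 holds, then every epi sink of clopen arrows is universal effective epi. -/

import Mathlib

open CategoryTheory CategoryTheory.Limits

universe u v w v' w' v'' w''

namespace Glutos

/-! ### Size conditions -/

/-- A `𝒰`-category, for the universe `𝒰` of `u`-small sets: a category naturally equivalent to one
whose objects are elements of `𝒰` and whose hom-sets are `u`-small. `ZFSet.{u}` is the class of all
`u`-small sets. -/
def IsUCategory (C : Type v) [Category.{w} C] : Prop :=
  ∃ (S : Set ZFSet.{u}) (_ : Category.{u} S), Nonempty (C ≌ S)

/-- A `𝒰`-topos: a category equivalent to the category of `𝒰`-valued sheaves on a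
`u`-small site. -/
def IsUTopos (E : Type v) [Category.{w} E] : Prop :=
  ∃ (S : Type u) (_ : SmallCategory S) (J : GrothendieckTopology S), Nonempty (E ≌ Sheaf J (Type u))

section Sinks

variable {C : Type v} [Category.{w} C]

/-! ### Sinks -/

/-- A sink `⟨X, S⟩` is epi if two arrows out of `X` agreeing on all members of `S` are equal. -/
def IsEpiSink {X : C} (S : Presieve X) : Prop :=
  ∀ ⦃Z : C⦄ (g h : X ⟶ Z), (∀ ⦃Y : C⦄ (f : Y ⟶ X), S f → f ≫ g = f ≫ h) → g = h

/-- All members of the sink belong to the set of arrows `O`. -/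
def SinkIn (O : MorphismProperty C) {X : C} (S : Presieve X) : Prop :=
  ∀ ⦃Y : C⦄ (f : Y ⟶ X), S f → O f

/-- Universal effective epi sinks: all pullbacks of the sieve generated by the sink are
effective epi. -/
def IsUniversalEffectiveEpiSink {X : C} (S : Presieve X) : Prop :=
  ∀ ⦃Y : C⦄ (f : Y ⟶ X), ((Sieve.generate S).pullback f).EffectiveEpimorphic

/-- `T` is a refinement of `S`: every member of `T` factors through some member of `S`. -/
def IsRefinement {X : C} (T S : Presieve X) : Prop :=
  ∀ ⦃Y : C⦄ (t : Y ⟶ X), T t → ∃ (Z : C) (s : Z ⟶ X) (a : Y ⟶ Z), S s ∧ a ≫ s = t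

/-! ### Equivalence relations and gluing data -/

/-- `O` is a clopos structure. -/
structure IsClopos (O : MorphismProperty C) : Prop where
  of_isIso : ∀ ⦃X Y : C⦄ (f : X ⟶ Y), IsIso f → O f
  hasPullbacks : O.HasPullbacks
  isStableUnderComposition : O.IsStableUnderComposition
  isStableUnderBaseChange : O.IsStableUnderBaseChange

/-- The pair `u, v` is coequalized by some arrow belonging to `O`. -/
def OCoequalizable (O : MorphismProperty C) {R X : C} (u v : R ⟶ X) : Prop :=
  ∃ (Q : C) (q : X ⟶ Q), O q ∧ u ≫ q = v ≫ q

/-- `u', v'` is (a choice of) the inverse image of the pair `u, v` along `f`, formed through three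
pullbacks `R₀ = X' ×_X R` (along `u`), `R₁ = R ×_X X'` (along `v`) and `R' = R₀ ×_R R₁`. -/
def IsInducedRelation {X X' R R' : C} (f : X' ⟶ X) (u v : R ⟶ X) (u' v' : R' ⟶ X') : Prop :=
  ∃ (R₀ R₁ : C) (a₀ : R₀ ⟶ X') (b₀ : R₀ ⟶ R) (b₁ : R₁ ⟶ R) (a₁ : R₁ ⟶ X')
    (c₀ : R' ⟶ R₀) (c₁ : R' ⟶ R₁),
    IsPullback a₀ b₀ f u ∧ IsPullback b₁ a₁ v f ∧ IsPullback c₀ c₁ b₀ b₁ ∧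
      c₀ ≫ a₀ = u' ∧ c₁ ≫ a₁ = v'

/-- There is an epi sink of arrows of `O` along whose members the pair `u, v` induces
`O`-coequalizable relations. -/
def LocallyOCoequalizable (O : MorphismProperty C) {R X : C} (u v : R ⟶ X) : Prop :=
  ∃ S : Presieve X, SinkIn O S ∧ IsEpiSink S ∧ ∀ ⦃X' : C⦄ (f : X' ⟶ X), S f →
    ∃ (R' : C) (u' v' : R' ⟶ X'), IsInducedRelation f u v u' v' ∧ OCoequalizable O u' v'

/-- Glueing data (a gluon). A diagram `U` of shape `ΓI` is given by objects `U_i = d.right i`,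
`U_ij = d.left (i, j)` and arrows `d.fst (i, j) : U_ij ⟶ U_i`, `d.snd (i, j) : U_ij ⟶ U_j`. -/
structure IsGluon {I : Type u} (d : MultispanIndex (MultispanShape.prod I) C) : Prop where
  jointlyMono : ∀ i j : I, JointlyMono₂ (d.fst (i, j)) (d.snd (i, j))
  symm : ∀ i j : I, ∃ t : d.left (i, j) ⟶ d.left (j, i),
    t ≫ d.fst (j, i) = d.snd (i, j) ∧ t ≫ d.snd (j, i) = d.fst (i, j)
  refl : ∀ i : I, ∃ s : d.right i ⟶ d.left (i, i),
    s ≫ d.fst (i, i) = 𝟙 (d.right i) ∧ s ≫ d.snd (i, i) = 𝟙 (d.right i)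
  cocycle : ∀ i j k : I, ∃ (T : C) (p₀ : T ⟶ d.left (i, j)) (p : T ⟶ d.left (i, k))
    (p₁ : T ⟶ d.left (j, k)),
    IsPullback p₀ p (d.fst (i, j)) (d.fst (i, k)) ∧
    IsPullback p₀ p₁ (d.snd (i, j)) (d.fst (j, k)) ∧
    IsPullback p p₁ (d.snd (i, k)) (d.snd (j, k))

/-- The condition (G4_𝒰+5): every `u`-small, clopen, locally `O`-coequalizable gluon has a universal
and effective colimit, whose colimit cone consists of clopen arrows. -/
def GluingCondition (O : MorphismProperty C) : Prop :=
  ∀ (I : Type u) (d : MultispanIndex (MultispanShape.prod I) C), IsGluon d →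
    (∀ a, O (d.fst a) ∧ O (d.snd a)) →
    (∀ i : I, LocallyOCoequalizable O (d.fst (i, i)) (d.snd (i, i))) →
    ∃ c : Multicofork d, IsUniversalColimit c ∧
      (∀ i j : I, IsPullback (d.fst (i, j)) (d.snd (i, j)) (c.π i) (c.π j)) ∧
      ∀ i : I, O (c.π i)

/-! ### `𝒰`-glutoses -/

variable (C) in
/-- `(C, O)` is a `𝒰`-glutos. The category `O/X` is `O.Over ⊤ X`, the full subcategory of `C/X`
on the arrows of `O`. -/
structure IsUGlutos (O : MorphismProperty C) : Prop extends IsClopos O where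
  isUCategory : IsUCategory.{u} C
  /-- (G2) -/
  of_postcomp : ∀ ⦃X Y Z : C⦄ (g : X ⟶ Y) (f : Y ⟶ Z), O (g ≫ f) → O f → O g
  /-- (G3) a) -/
  isUTopos : ∀ X : C, IsUTopos.{u} (O.Over ⊤ X)
  /-- (G3) b): the functor `f^*` is an inverse image of a geometric morphism. -/
  inverseImage : ∀ ⦃X Y : C⦄ (f : X ⟶ Y),
    haveI := hasPullbacks
    haveI := isStableUnderBaseChange
    PreservesFiniteLimits (MorphismProperty.Over.pullback O ⊤ f) ∧
      (MorphismProperty.Over.pullback O ⊤ f).IsLeftAdjoint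
  /-- (G4_𝒰) a): disjoint universal `u`-small coproducts with injections in `O`. -/
  coproducts : ∀ (I : Type u) (U : I → C), ∃ c : Cofan U, IsUniversalColimit c ∧
    (∀ i, O (c.inj i) ∧ Mono (c.inj i)) ∧
    ∀ i j, i ≠ j → ∀ (Z : C) (p : Z ⟶ U i) (q : Z ⟶ U j),
      IsPullback p q (c.inj i) (c.inj j) → Nonempty (IsInitial Z)
  /-- (G4_𝒰) b) -/
  coproductDesc : ∀ (I : Type u) (U : I → C) (X : C) (f : ∀ i, U i ⟶ X), (∀ i, O (f i)) →
    ∀ (c : Cofan U) (hc : IsColimit c), O (hc.desc (Cofan.mk X f))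
  /-- (G5) a) -/
  effectiveEpi : ∀ ⦃X Y : C⦄ (f : X ⟶ Y), O f → Epi f → EffectiveEpi f
  /-- (G5) b) -/
  of_precomp : ∀ ⦃X Y Z : C⦄ (p : X ⟶ Y) (f : Y ⟶ Z), O (p ≫ f) → O p → Epi p → O f
  /-- (G5) c), weak form: open, locally `O`-coequalizable equivalence relations are effective and
  have a universal coequalizer belonging to `O`. -/
  quotients : ∀ ⦃R X : C⦄ (u v : R ⟶ X), IsEquivalenceRelation u v → O u → O v →
    LocallyOCoequalizable O u v →
    ∃ (Q : C) (q : X ⟶ Q) (h : u ≫ q = v ≫ q), O q ∧ IsKernelPair q u v ∧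
      IsUniversalColimit (Cofork.ofπ q h)
  /-- (G5P) -/
  localPullbacks : ∀ ⦃X R S Y : C⦄ (r : X ⟶ R) (g : R ⟶ S) (f : Y ⟶ S), O r → Epi r →
    HasPullback (r ≫ g) f → HasPullback g f

/-- The pretopology of a `𝒰`-glutos: all epi sinks with members in `O`. -/
def epiPretopology (O : MorphismProperty C) : Precoverage C where
  coverings _ := {S | SinkIn O S ∧ IsEpiSink S}

/-! ### Presites -/

/-- The clopen arrows: those belonging to some covering. -/
def clopens (τ : Precoverage C) : MorphismProperty C :=
  fun _ Y f => ∃ S ∈ τ Y, S f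

/-- `τ` is a pretopology, i.e. `(C, τ)` is a presite. The field `complete` is (PT4). -/
structure IsPresite (τ : Precoverage C) : Prop where
  hasPullbacks : τ.HasPullbacks
  hasIsos : τ.HasIsos
  isStableUnderBaseChange : τ.IsStableUnderBaseChange
  isStableUnderComposition : τ.IsStableUnderComposition
  complete : ∀ ⦃X : C⦄ (S T : Presieve X), SinkIn (clopens τ) S → T ∈ τ X → IsRefinement T S →
    S ∈ τ X

/-- The operation `ℳ`: the coverings of `ℳτ` are the coverings of `τ` consisting of monos. -/
def monoPart (τ : Precoverage C) : Precoverage C where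
  coverings X := {S | S ∈ τ X ∧ ∀ ⦃Y : C⦄ (f : Y ⟶ X), S f → Mono f}

/-- An `ℳ`-presite: a presite all of whose coverings consist of monos. -/
structure IsMPresite (τ : Precoverage C) : Prop extends IsPresite τ where
  mono : ∀ ⦃X : C⦄ (S : Presieve X), S ∈ τ X → ∀ ⦃Y : C⦄ (f : Y ⟶ X), S f → Mono f

/-- A `𝒰`-presite: the underlying category is a `𝒰`-category and there exist `u`-small local sets
of topological generators (LTG_𝒰). -/
structure IsUPresite (τ : Precoverage C) : Prop extends IsPresite τ where
  isUCategory : IsUCategory.{u} C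
  localGenerators : ∀ X : C, ∃ G : Set C, Small.{u} G ∧ ∀ ⦃U : C⦄ (a : U ⟶ X), clopens τ a →
    ∃ S ∈ τ U, ∀ ⦃V : C⦄ (f : V ⟶ U), S f → V ∈ G

end Sinks

/-! ### Continuous functors and universal `𝒰`-glutoses -/

section Functors

variable {C : Type v} [Category.{w} C] {D : Type v'} [Category.{w'} D]
  {E : Type v''} [Category.{w''} E]

/-- Continuous functors (morphisms of presites): they respect coverings, clopen arrows and
pullbacks of clopen arrows along arbitrary arrows. -/
structure IsContinuous (τ : Precoverage C) (σ : Precoverage D) (F : C ⥤ D) : Prop where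
  map_covering : ∀ ⦃X : C⦄ (S : Presieve X), S ∈ τ X → S.map F ∈ σ (F.obj X)
  map_clopen : ∀ ⦃X Y : C⦄ (f : X ⟶ Y), clopens τ f → clopens σ (F.map f)
  map_isPullback : ∀ ⦃P X Y Z : C⦄ (p : P ⟶ X) (q : P ⟶ Y) (f : X ⟶ Z) (g : Y ⟶ Z),
    clopens τ f → IsPullback p q f g → IsPullback (F.map p) (F.map q) (F.map f) (F.map g)

theorem IsContinuous.comp {τ : Precoverage C} {σ : Precoverage D} {ρ : Precoverage E}
    {F : C ⥤ D} {G : D ⥤ E} (hF : IsContinuous τ σ F) (hG : IsContinuous σ ρ G) :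
    IsContinuous τ ρ (F ⋙ G) where
  map_covering X S hS := by
    have h : S.map (F ⋙ G) = (S.map F).map G := by
      apply le_antisymm
      · rintro Y _ ⟨hf⟩
        exact .of (.of hf)
      · rintro Y _ ⟨⟨hf⟩⟩
        exact Presieve.map.of (F := F ⋙ G) hf
    rw [h]
    exact hG.map_covering _ (hF.map_covering _ hS)
  map_clopen X Y f hf := hG.map_clopen _ (hF.map_clopen _ hf)
  map_isPullback P X Y Z p q f g hf h :=
    hG.map_isPullback _ _ _ _ (hF.map_clopen _ hf) (hF.map_isPullback _ _ _ _ hf h)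

/-- The category `[C, D]` of continuous functors and all natural transformations. -/
abbrev ContinuousFunctors (τ : Precoverage C) (σ : Precoverage D) :=
  ObjectProperty.FullSubcategory (fun F : C ⥤ D => IsContinuous τ σ F)

/-- The functor `[Y, E] : [D, E] ⥤ [C, E]` of precomposition with a continuous functor `Y`. -/
def precomp {τ : Precoverage C} {σ : Precoverage D} (ρ : Precoverage E) (Y : C ⥤ D)
    (hY : IsContinuous τ σ Y) : ContinuousFunctors σ ρ ⥤ ContinuousFunctors τ ρ :=
  ObjectProperty.lift _ (ObjectProperty.ι _ ⋙ (Functor.whiskeringLeft C D E).obj Y)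
    (fun F => hY.comp F.property)

/-- The continuous functor `Y` from the presite `(C, τ)` to the `𝒰`-glutos `(D, O)` is universal:
for every `𝒰`-glutos `E` the functor `[Y, E]` is a natural equivalence having a right inverse. -/
def IsUniversalArrow (τ : Precoverage C) (O : MorphismProperty D) (Y : C ⥤ D) : Prop :=
  ∃ hY : IsContinuous τ (epiPretopology O) Y,
    ∀ (E : Type (u + 1)) [Category.{u} E] (P : MorphismProperty E), IsUGlutos.{u} E P →
      (precomp (epiPretopology P) Y hY).IsEquivalence ∧
      ∃ K : ContinuousFunctors τ (epiPretopology P) ⥤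
          ContinuousFunctors (epiPretopology O) (epiPretopology P),
        K ⋙ precomp (epiPretopology P) Y hY = 𝟭 _

/-- Natural equivalence of presites. -/
def PresiteEquivalent (τ : Precoverage C) (σ : Precoverage D) : Prop :=
  ∃ e : C ≌ D, IsContinuous τ σ e.functor ∧ IsContinuous σ τ e.inverse

/-- A nearly `𝒰`-glutos: a `𝒰`-presite naturally equivalent to the presite `ℳ D`, for a universal
`𝒰`-glutos `D` of some `𝒰`-presite `B`. -/
def IsNearlyUGlutos (τ : Precoverage C) : Prop :=
  IsUPresite.{u} τ ∧
    ∃ (B : Type v) (_ : Category.{w} B) (ρ : Precoverage B)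
      (D : Type v) (_ : Category.{w} D) (O : MorphismProperty D) (Y : B ⥤ D),
      IsUPresite.{u} ρ ∧ IsUGlutos.{u} D O ∧ IsUniversalArrow.{u} ρ O Y ∧
        PresiteEquivalent τ (monoPart (epiPretopology O))

/-! ### The conditions characterizing nearly `𝒰`-glutoses -/

/-- (NG1) The clopen subobjects of any object form a `u`-small set. -/
def NG1 (τ : Precoverage C) : Prop :=
  ∀ X : C, Small.{u} {A : Subobject X // clopens τ A.arrow}

/-- (NG2) Any family of clopen arrows `U_i ⟶ X` factors as a covering followed by a
clopen arrow. -/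
def NG2 (τ : Precoverage C) : Prop :=
  ∀ (X : C) (I : Type (max v w)) (U : I → C) (a : ∀ i, U i ⟶ X), (∀ i, clopens τ (a i)) →
    ∃ (Z : C) (z : Z ⟶ X) (a' : ∀ i, U i ⟶ Z),
      Presieve.ofArrows U a' ∈ τ Z ∧ clopens τ z ∧ ∀ i, a' i ≫ z = a i

/-- (NG3) Any epi sink of clopen arrows is a covering. -/
def NG3 (τ : Precoverage C) : Prop :=
  ∀ (X : C) (S : Presieve X), SinkIn (clopens τ) S → IsEpiSink S → S ∈ τ X

end Functors

end Glutos

/-! Think of clopen arrows as inclusions of open subsets and of étale arrows (`etale`: clopen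
locally on the source) as local homeomorphisms. If the four conditions hold, the category itself
with its étale arrows is a glutos, and the identity functor is the universal arrow into it. A monic
étale arrow is clopen, being the union of its clopen pieces (`clopens_of_etale_of_mono`), so the
mono part of this glutos is the given presite.

Most constructions come from one gluing principle (`IsMPresite.exists_glue`): objects are glued
along a relation between generalized elements that is represented by clopen subobjects. It yields
pullbacks of étale arrows, coproducts, quotients by locally coequalizable equivalence relations, and
étalé spaces. The last identify étale arrows over `X` with sheaves on the small preorder of clopen
subobjects of `X` (`ClopenBasis.exists_etale`), which gives the topos axiom. Applied to sections
over inverse images, they give the right adjoint of base change (`exists_pushforward`). Universality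
holds because, in a glutos, membership in the class of arrows, joint epimorphy and pullback squares
are all local: a functor continuous for clopen arrows is, unchanged, continuous for étale ones
(`isContinuous_etale`).

Conversely, in a glutos a gluon of monos is glued as the quotient of the coproduct of the `U i` by
the coproduct of the `V i j` (`IsUGlutos.exists_glue`). This, and the fact that epi sinks there are
coverings, is carried across the equivalence of presites. Unions arise by gluing a small family of
clopen subobjects along intersections, and smallness is a count of arrows from topological
generators. -/

namespace Glutos

/-! ### Descent of arrows in subcanonical topologies -/

section Sites

variable {C : Type v} [Category.{w} C] {J : GrothendieckTopology C}

theorem transitive_generate {X : C} {S : Presieve X} (hS : Sieve.generate S ∈ J X) (R : Sieve X)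
    (h : ∀ ⦃Y : C⦄ (f : Y ⟶ X), S f → R.pullback f ∈ J Y) : R ∈ J X := by
  refine J.transitive hS R ?_
  rintro Y _ ⟨Z, g, f, hf, rfl⟩
  rw [Sieve.pullback_comp]
  exact J.pullback_stable g (h f hf)

theorem hom_ext_of_mem [J.Subcanonical] {X : C} {S : Sieve X} (hS : S ∈ J X) {T : C} {f g : X ⟶ T}
    (h : ∀ ⦃Y : C⦄ (a : Y ⟶ X), S a → a ≫ f = a ≫ g) : f = g :=
  ((GrothendieckTopology.Subcanonical.isSheaf_of_isRepresentable (J := J)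
    (yoneda.obj T)) S hS).isSeparatedFor.ext fun _ a ha => h a ha

theorem hom_ext_of_family [J.Subcanonical] {X : C} {I : Type*} {U : I → C} {a : ∀ i, U i ⟶ X}
    (hS : Sieve.ofArrows U a ∈ J X) {T : C} {f g : X ⟶ T}
    (h : ∀ i, a i ≫ f = a i ≫ g) : f = g := by
  refine hom_ext_of_mem hS ?_
  rintro Y _ ⟨_, b, _, ⟨i⟩, rfl⟩
  simp [h]

theorem exists_desc_of_family [J.Subcanonical] {X : C} {I : Type*} {U : I → C}
    {a : ∀ i, U i ⟶ X} (hS : Sieve.ofArrows U a ∈ J X) {T : C} (e : ∀ i, U i ⟶ T)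
    (he : ∀ (i j : I) (W : C) (p : W ⟶ U i) (q : W ⟶ U j), p ≫ a i = q ≫ a j →
      p ≫ e i = q ≫ e j) : ∃ f : X ⟶ T, ∀ i, a i ≫ f = e i := by
  have h := (GrothendieckTopology.Subcanonical.isSheaf_of_isRepresentable (J := J)
    (yoneda.obj T)) _ hS
  rw [Sieve.ofArrows, ← Presieve.isSheafFor_iff_generate, Presieve.isSheafFor_arrows_iff] at h
  obtain ⟨f, hf, -⟩ := h e fun i j W p q hpq => he i j W p q hpq
  exact ⟨f, hf⟩

/-- The unindexed form of `exists_desc_of_family`: the sink is indexed by its own members. -/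
theorem exists_desc_of_presieve [J.Subcanonical] {X : C} {S : Presieve X}
    (hS : Sieve.generate S ∈ J X) {T : C} (e : ∀ ⦃Y : C⦄ (a : Y ⟶ X), S a → (Y ⟶ T))
    (he : ∀ ⦃Y Z W : C⦄ (a : Y ⟶ X) (ha : S a) (b : Z ⟶ X) (hb : S b) (p : W ⟶ Y) (q : W ⟶ Z),
      p ≫ a = q ≫ b → p ≫ e a ha = q ≫ e b hb) :
    ∃ f : X ⟶ T, ∀ ⦃Y : C⦄ (a : Y ⟶ X) (ha : S a), a ≫ f = e a ha := by
  have hS' : Sieve.ofArrows (fun i : Σ Y : C, {a : Y ⟶ X // S a} => i.1) (fun i => i.2.1) ∈ J X := by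
    refine J.superset_covering ?_ hS
    rw [Sieve.generate_le_iff]
    intro Y f hf
    exact Sieve.ofArrows_mk (fun i : Σ Y : C, {a : Y ⟶ X // S a} => i.1) (fun i => i.2.1)
      ⟨Y, f, hf⟩
  obtain ⟨f, hf⟩ := exists_desc_of_family hS' (fun i => e i.2.1 i.2.2)
    fun i j W p q h => he _ i.2.2 _ j.2.2 p q h
  exact ⟨f, fun Y a ha => hf ⟨Y, a, ha⟩⟩

/-- A map into the target of a monomorphism lifts as soon as it does so locally. -/
theorem exists_lift_of_mem [J.Subcanonical] {A Y T : C} (m : A ⟶ Y) [Mono m] (g : T ⟶ Y)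
    {R : Sieve T} (hR : R ∈ J T)
    (h : ∀ ⦃W : C⦄ (k : W ⟶ T), R k → ∃ l : W ⟶ A, l ≫ m = k ≫ g) :
    ∃ l : T ⟶ A, l ≫ m = g := by
  choose l hl using h
  have hR' : Sieve.generate (R : Presieve T) ∈ J T := by simpa using hR
  obtain ⟨f, hf⟩ := exists_desc_of_presieve hR' l fun Y Z W a ha b hb p q hpq => by
    rw [← cancel_mono m, Category.assoc, Category.assoc, hl, hl, reassoc_of% hpq]
  exact ⟨f, hom_ext_of_mem hR fun Y a ha => by rw [← hl a ha, ← hf a ha, Category.assoc]⟩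

theorem ofArrows_mem_of_isPullback {X Y : C} {I : Type*} {U P : I → C} {a : ∀ i, U i ⟶ X}
    (h : Sieve.ofArrows U a ∈ J X) (g : Y ⟶ X) (p : ∀ i, P i ⟶ Y) (q : ∀ i, P i ⟶ U i)
    (hp : ∀ i, IsPullback (p i) (q i) g (a i)) : Sieve.ofArrows P p ∈ J Y := by
  refine J.superset_covering ?_ (J.pullback_stable g h)
  rintro T k ⟨_, b, _, ⟨i⟩, hb⟩
  exact (Sieve.mem_ofArrows_iff _ _ _).2 ⟨i, (hp i).lift k b hb.symm, by simp⟩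

theorem isEpiSink_of_mem [J.Subcanonical] {X : C} {S : Presieve X}
    (hS : Sieve.generate S ∈ J X) : IsEpiSink S := fun Z g h H => hom_ext_of_mem hS (by
  rintro Y _ ⟨_, b, a, ha, rfl⟩
  simp [H a ha])

end Sites

/-! ### Calculus of clopen arrows -/

section Presites

variable {C : Type v} [Category.{w} C] {τ : Precoverage C}

theorem clopens_of_mem {X : C} {S : Presieve X} (hS : S ∈ τ X) : SinkIn (clopens τ) S :=
  fun _ _ hf => ⟨S, hS, hf⟩

/-- Stability of a precoverage under composition and base change is used for indexed families, so a
clopen arrow has to be exhibited as a member of such a family. -/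
theorem clopens_iff_family {X Y : C} (f : X ⟶ Y) : clopens τ f ↔
    ∃ (I : Type (max v w)) (U : I → C) (a : ∀ i, U i ⟶ Y) (i₀ : I) (e : U i₀ = X),
      Presieve.ofArrows U a ∈ τ Y ∧ a i₀ = eqToHom e ≫ f := by
  constructor
  · rintro ⟨S, hS, hf⟩
    obtain ⟨I, U, a, rfl⟩ := S.exists_eq_ofArrows
    exact ⟨I, U, a, hf.idx, hf.obj_idx, hS, hf.hom_idx⟩
  · rintro ⟨I, U, a, i₀, rfl, hS, e⟩
    refine ⟨_, hS, ?_⟩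
    obtain rfl : a i₀ = f := by simpa using e
    exact .mk i₀

namespace IsPresite

variable (h : IsPresite τ)

include h

theorem clopens_of_isIso {X Y : C} (f : X ⟶ Y) [IsIso f] : clopens τ f :=
  ⟨_, h.hasIsos.mem_coverings_of_isIso f, ⟨⟩⟩

theorem hasPullback {X Y Z : C} {f : X ⟶ Z} (hf : clopens τ f) (g : Y ⟶ Z) : HasPullback f g := by
  obtain ⟨S, hS, hf⟩ := hf
  exact (h.hasPullbacks.hasPullbacks_of_mem g hS).hasPullback hf

theorem clopens_comp {X Y Z : C} {g : X ⟶ Y} {f : Y ⟶ Z} (hg : clopens τ g) (hf : clopens τ f) :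
    clopens τ (g ≫ f) := by
  classical
  have := h.isStableUnderComposition
  have := h.hasIsos
  obtain ⟨I, U, a, i₀, rfl, hS, e⟩ := (clopens_iff_family f).1 hf
  obtain rfl : a i₀ = f := by simpa using e
  -- Cover `U i₀` by a covering containing `g` and every other `U i` by its identity; the composite
  -- covering then contains `g ≫ f`.
  have key : ∀ i, ∃ T ∈ τ (U i), ∀ e : i = i₀, T (g ≫ eqToHom (by rw [e])) := by
    intro i
    by_cases hi : i = i₀
    · subst hi
      obtain ⟨T, hT, hg⟩ := hg
      exact ⟨T, hT, fun _ => by simpa using hg⟩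
    · exact ⟨_, Precoverage.mem_coverings_of_isIso (𝟙 _), fun e => (hi e).elim⟩
  choose T hT hT' using key
  choose K V b hb using fun i => (T i).exists_eq_ofArrows
  refine ⟨_, Precoverage.comp_mem_coverings a hS (fun i j => b i j)
    (fun i => by rw [← hb]; exact hT i), ?_⟩
  have := hT' i₀ rfl
  rw [hb] at this
  simp only [eqToHom_refl, Category.comp_id] at this
  obtain ⟨j, e, hj⟩ := Presieve.ofArrows_surj _ _ this
  subst e
  obtain rfl : g = b i₀ j := by simpa using hj
  exact Presieve.ofArrows.mk (f := fun p : Σ i, K i => b p.1 p.2 ≫ a p.1) ⟨i₀, j⟩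

theorem clopens_of_isPullback {P X Y Z : C} {p : P ⟶ X} {q : P ⟶ Y} {f : X ⟶ Z} {g : Y ⟶ Z}
    (H : IsPullback p q f g) (hf : clopens τ f) : clopens τ q := by
  have := h.isStableUnderBaseChange
  obtain ⟨I, U, a, i₀, rfl, hS, e⟩ := (clopens_iff_family f).1 hf
  obtain rfl : a i₀ = f := by simpa using e
  have : ∀ i, HasPullback (a i) g := fun i => h.hasPullback ⟨_, hS, .mk i⟩ g
  have h₁ : clopens τ (pullback.snd (a i₀) g) :=
    ⟨_, Precoverage.mem_coverings_of_isPullback a hS g (fun i => pullback.snd (a i) g)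
      (fun i => pullback.fst (a i) g) fun i => (IsPullback.of_hasPullback _ _).flip, .mk i₀⟩
  have e := H.isoIsPullback _ _ (IsPullback.of_hasPullback (a i₀) g)
  have : q = (H.isoIsPullback _ _ (IsPullback.of_hasPullback (a i₀) g)).hom ≫
      pullback.snd (a i₀) g := by simp
  rw [this]
  exact h.clopens_comp (h.clopens_of_isIso _) h₁

theorem clopens_of_isPullback' {P X Y Z : C} {p : P ⟶ X} {q : P ⟶ Y} {f : X ⟶ Z} {g : Y ⟶ Z}
    (H : IsPullback p q f g) (hg : clopens τ g) : clopens τ p :=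
  h.clopens_of_isPullback H.flip hg

/-- When `f` is monic, `g` is the base change of `g ≫ f` along `f`. -/
theorem clopens_of_comp_mono {X Y Z : C} {g : X ⟶ Y} {f : Y ⟶ Z} [Mono f]
    (hgf : clopens τ (g ≫ f)) : clopens τ g :=
  h.clopens_of_isPullback (p := 𝟙 X) (q := g) (f := g ≫ f) (g := f)
    ⟨⟨by simp⟩, ⟨PullbackCone.IsLimit.mk _ (fun s => s.fst) (by simp)
      (fun s => by rw [← cancel_mono f, Category.assoc, s.condition])
      (fun s m hm _ => by simpa using hm)⟩⟩ hgf

/-- The completeness axiom recovers the pretopology from its Grothendieck topology, so that covering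
questions about clopen sinks can be settled with sieves. -/
theorem mem_iff_generate_mem {X : C} {S : Presieve X} (hS : SinkIn (clopens τ) S) :
    S ∈ τ X ↔ Sieve.generate S ∈ τ.toGrothendieck X := by
  have := h.isStableUnderBaseChange
  have := h.isStableUnderComposition
  have := h.hasPullbacks
  have := h.hasIsos
  refine ⟨fun hS => Precoverage.generate_mem_toGrothendieck hS, fun H => ?_⟩
  obtain ⟨R, hR, hle⟩ := Precoverage.mem_toGrothendieck_iff_of_isStableUnderComposition.1 H
  refine h.complete S R hS hR fun Y t ht => ?_
  obtain ⟨Z, a, s, hs, e⟩ := hle _ _ ht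
  exact ⟨Z, s, a, hs, e⟩

theorem ofArrows_mem_iff {X : C} {I : Type*} {U : I → C} {a : ∀ i, U i ⟶ X}
    (ha : ∀ i, clopens τ (a i)) :
    Presieve.ofArrows U a ∈ τ X ↔ Sieve.ofArrows U a ∈ τ.toGrothendieck X :=
  h.mem_iff_generate_mem fun _ _ ⟨i⟩ => ha i

end IsPresite

theorem IsMPresite.mono_of_clopens (h : IsMPresite τ) {X Y : C} {f : X ⟶ Y} (hf : clopens τ f) :
    Mono f := by
  obtain ⟨S, hS, hf⟩ := hf
  exact h.mono S hS f hf

theorem isUniversalEffectiveEpiSink_of_mem {X : C} {S : Presieve X} (hS : S ∈ τ X)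
    (hsub : τ.toGrothendieck.Subcanonical) : IsUniversalEffectiveEpiSink S := fun Y f => by
  rw [Sieve.EffectiveEpimorphic.iff_forall_isSheafFor_yoneda]
  exact fun T => (GrothendieckTopology.Subcanonical.isSheaf_of_isRepresentable
    (J := τ.toGrothendieck) (yoneda.obj T)) _
      (τ.toGrothendieck.pullback_stable f (Precoverage.generate_mem_toGrothendieck hS))

/-- The factorization in `NG2` is the union: its clopen part is monic, and it factors through any
upper bound since it does so on the covering part. -/
theorem exists_isLUB_of_ng2 (hM : IsMPresite τ) (hsub : τ.toGrothendieck.Subcanonical)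
    (h2 : NG2 τ) (X : C) (A : Set (Subobject X)) (hA : ∀ a ∈ A, clopens τ a.arrow) :
    ∃ b : Subobject X, IsLUB A b ∧ clopens τ b.arrow := by
  obtain ⟨Z, z, a', hc, hz, e⟩ := h2 X A (fun a => (a.1 : C)) (fun a => a.1.arrow)
    fun a => hA _ a.2
  have := hM.mono_of_clopens hz
  refine ⟨Subobject.mk z, ⟨fun a ha => ?_, fun c hc' => ?_⟩, ?_⟩
  · exact Subobject.le_mk_of_comm (a' ⟨a, ha⟩) (e ⟨a, ha⟩)
  · obtain ⟨l, hl⟩ := exists_lift_of_mem c.arrow z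
      (Precoverage.generate_mem_toGrothendieck hc) (by
        rintro W _ ⟨_, b, _, ⟨i⟩, rfl⟩
        exact ⟨b ≫ Subobject.ofLE _ _ (hc' i.2), by simp [e]⟩)
    exact Subobject.mk_le_of_comm l hl
  · rw [← Subobject.underlyingIso_hom_comp_eq_mk]
    exact hM.clopens_comp (hM.clopens_of_isIso _) hz

end Presites

end Glutos

namespace Glutos

/-! ### The gluing principle, unions and empty objects -/

section Gluing

variable {C : Type v} [Category.{w} C]

/-- Subcanonical `ℳ`-presites satisfying the conditions that characterize nearly `𝒰`-glutoses. -/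
structure IsGluingPresite (τ : Precoverage C) : Prop extends IsMPresite τ where
  isUCategory : IsUCategory.{u} C
  subcanonical : τ.toGrothendieck.Subcanonical
  gluing : GluingCondition.{u} (clopens τ)
  ng1 : NG1.{u} τ
  ng2 : NG2 τ
  ng3 : NG3 τ

variable {τ : Precoverage C}

/-- The identity is an epi sink, and the inverse image of a pair along it is the pair itself. -/
theorem locallyOCoequalizable_of_eq {O : MorphismProperty C} (hO : ∀ X : C, O (𝟙 X)) {R X : C}
    {u v : R ⟶ X} {Q : C} (q : X ⟶ Q) (hq : O q) (h : u ≫ q = v ≫ q) : LocallyOCoequalizable O u v :=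
  ⟨.singleton (𝟙 X), fun _ _ ⟨⟩ => hO X, fun _ _ _ h => by simpa using h (𝟙 X) ⟨⟩, by
    rintro _ _ ⟨⟩
    refine ⟨R, u, v, ⟨R, R, u, 𝟙 R, 𝟙 R, v, 𝟙 R, 𝟙 R, ?_, ?_, ?_, by simp, by simp⟩, Q, q, hq, h⟩
    · exact IsPullback.of_vert_isIso ⟨by simp⟩
    · exact IsPullback.of_horiz_isIso ⟨by simp⟩
    · exact IsPullback.of_vert_isIso ⟨by simp⟩⟩

namespace IsMPresite

variable (h : IsMPresite τ)

include h

theorem ofArrows_mem_of_epi (h3 : NG3 τ) {X : C} {I : Type*} {U : I → C} {a : ∀ i, U i ⟶ X}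
    (ha : ∀ i, clopens τ (a i))
    (hS : ∀ ⦃Z : C⦄ (f g : X ⟶ Z), (∀ i, a i ≫ f = a i ≫ g) → f = g) :
    Sieve.ofArrows U a ∈ τ.toGrothendieck X :=
  (h.ofArrows_mem_iff ha).1 (h3 X _ (fun _ _ ⟨i⟩ => ha i)
    fun _ f g H => hS f g fun i => H _ (.mk i))

/-- Objects `U i` can be glued along relations `ρ` between their generalized elements, provided
that these are represented by clopen subobjects. -/
theorem exists_glue (hg : GluingCondition.{u} (clopens τ)) (h3 : NG3 τ) {I : Type u} (U : I → C)
    (ρ : ∀ (i j : I) (T : C), (T ⟶ U i) → (T ⟶ U j) → Prop)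
    (ρ_refl : ∀ i T (a : T ⟶ U i), ρ i i T a a)
    (ρ_symm : ∀ i j T (a : T ⟶ U i) (b : T ⟶ U j), ρ i j T a b → ρ j i T b a)
    (ρ_trans : ∀ i j k T (a : T ⟶ U i) (b : T ⟶ U j) (c : T ⟶ U k), ρ i j T a b → ρ j k T b c →
      ρ i k T a c)
    (ρ_comp : ∀ i j T (a : T ⟶ U i) (b : T ⟶ U j) (T' : C) (t : T' ⟶ T), ρ i j T a b →
      ρ i j T' (t ≫ a) (t ≫ b))
    (rep : ∀ i j, ∃ (V : C) (p : V ⟶ U i) (q : V ⟶ U j), clopens τ p ∧ ρ i j V p q ∧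
      ∀ T a b, ρ i j T a b → ∃ t : T ⟶ V, t ≫ p = a ∧ t ≫ q = b) :
    ∃ (Q : C) (π : ∀ i, U i ⟶ Q), (∀ i, clopens τ (π i)) ∧
      Sieve.ofArrows U π ∈ τ.toGrothendieck Q ∧
      ∀ i j T (a : T ⟶ U i) (b : T ⟶ U j), a ≫ π i = b ≫ π j ↔ ρ i j T a b := by
  choose V p q hp hpq lift lift_p lift_q using rep
  have mp : ∀ i j, Mono (p i j) := fun i j => h.mono_of_clopens (hp i j)
  -- Symmetry of `ρ` makes `V i j` and `V j i` isomorphic over the swap, which turns `q i j` into `p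
  -- j i`.
  have hq : ∀ i j, clopens τ (q i j) := by
    intro i j
    let t := lift j i _ _ _ (ρ_symm _ _ _ _ _ (hpq i j))
    let s := lift i j _ _ _ (ρ_symm _ _ _ _ _ (hpq j i))
    have e₁ : t ≫ p j i = q i j := lift_p ..
    have e₂ : t ≫ q j i = p i j := lift_q ..
    have e₃ : s ≫ p i j = q j i := lift_p ..
    have e₄ : s ≫ q i j = p j i := lift_q ..
    have : IsIso t := ⟨s, by rw [← cancel_mono (p i j)]; simp [e₃, e₂],
      by rw [← cancel_mono (p j i)]; simp [e₁, e₄]⟩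
    rw [← e₁]
    exact h.clopens_comp (h.clopens_of_isIso t) (hp j i)
  have mq : ∀ i j, Mono (q i j) := fun i j => h.mono_of_clopens (hq i j)
  let d : MultispanIndex (MultispanShape.prod I) C :=
    { left := fun x => V x.1 x.2
      right := U
      fst := fun x => p x.1 x.2
      snd := fun x => q x.1 x.2 }
  have hd : IsGluon d := by
    refine ⟨fun i j => ⟨fun T f g h₁ _ => ?_⟩, fun i j => ?_, fun i => ?_, fun i j k => ?_⟩
    · exact (cancel_mono (p i j)).1 h₁
    · exact ⟨lift j i _ _ _ (ρ_symm _ _ _ _ _ (hpq i j)), lift_p .., lift_q ..⟩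
    · exact ⟨lift i i _ (𝟙 (U i)) (𝟙 (U i)) (ρ_refl ..), lift_p .., lift_q ..⟩
    · have hPB : HasPullback (p i j) (p i k) := h.hasPullback (hp i j) _
      let x := pullback.fst (p i j) (p i k)
      let y := pullback.snd (p i j) (p i k)
      have hxy : x ≫ p i j = y ≫ p i k := pullback.condition
      -- The triple overlap is the intersection of `V i j` and `V i k` in `U i`; transitivity of `ρ`
      -- supplies its map to `V j k`.
      have r : ρ j k _ (x ≫ q i j) (y ≫ q i k) := by
        refine ρ_trans _ _ _ _ _ _ _ (ρ_symm _ _ _ _ _ (ρ_comp _ _ _ _ _ _ x (hpq i j))) ?_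
        rw [hxy]
        exact ρ_comp _ _ _ _ _ _ y (hpq i k)
      let z := lift j k _ _ _ r
      have z₁ : z ≫ p j k = x ≫ q i j := lift_p ..
      have z₂ : z ≫ q j k = y ≫ q i k := lift_q ..
      have hxy' : IsPullback x y (p i j) (p i k) := IsPullback.of_hasPullback _ _
      refine ⟨pullback (p i j) (p i k), x, y, z, hxy', ?_, ?_⟩
      · refine ⟨⟨z₁.symm⟩, ⟨PullbackCone.IsLimit.mk _ (fun s => pullback.lift s.fst
          (lift i k _ (s.fst ≫ p i j) (s.snd ≫ q j k) ?_) (lift_p ..).symm) ?_ ?_ ?_⟩⟩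
        · refine ρ_trans _ _ _ _ _ _ _ (ρ_comp _ _ _ _ _ _ s.fst (hpq i j)) ?_
          have := ρ_comp _ _ _ _ _ _ s.snd (hpq j k)
          rwa [← show s.fst ≫ q i j = s.snd ≫ p j k from s.condition] at this
        · intro s
          exact pullback.lift_fst ..
        · intro s
          rw [← cancel_mono (p j k), Category.assoc, z₁]
          simp only [x, pullback.lift_fst_assoc]
          exact s.condition
        · intro s m hm _
          rw [← cancel_mono x]
          exact hm.trans (pullback.lift_fst ..).symm
      · refine ⟨⟨z₂.symm⟩, ⟨PullbackCone.IsLimit.mk _ (fun s => pullback.lift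
          (lift i j _ (s.fst ≫ p i k) (s.snd ≫ p j k) ?_) s.fst (lift_p ..)) ?_ ?_ ?_⟩⟩
        · refine ρ_trans _ _ _ _ _ _ _ (ρ_comp _ _ _ _ _ _ s.fst (hpq i k)) ?_
          have := ρ_symm _ _ _ _ _ (ρ_comp _ _ _ _ _ _ s.snd (hpq j k))
          rwa [← show s.fst ≫ q i k = s.snd ≫ q j k from s.condition] at this
        · intro s
          exact pullback.lift_snd ..
        · intro s
          rw [← cancel_mono (q j k), Category.assoc, z₂]
          simp only [y, pullback.lift_snd_assoc]
          exact s.condition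
        · intro s m hm _
          rw [← cancel_mono y]
          exact hm.trans (pullback.lift_snd ..).symm
  -- On the diagonal, `p i i` is a mono with a section, so an isomorphism; the common section then
  -- forces `p i i = q i i`, and the identity coequalizes the pair.
  obtain ⟨c, hc, hpb, hπ⟩ := hg I d hd (fun a => ⟨hp _ _, hq _ _⟩) fun i => by
    refine locallyOCoequalizable_of_eq (fun X => h.clopens_of_isIso _) (𝟙 _)
      (h.clopens_of_isIso _) ?_
    let s := lift i i _ (𝟙 (U i)) (𝟙 (U i)) (ρ_refl ..)
    have s₁ : s ≫ p i i = 𝟙 _ := lift_p ..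
    have s₂ : s ≫ q i i = 𝟙 _ := lift_q ..
    have e : p i i ≫ s = 𝟙 _ := by rw [← cancel_mono (p i i), Category.assoc, s₁]; simp
    have : p i i = q i i := by
      rw [← Category.comp_id (p i i), ← s₂, reassoc_of% e]
    change p i i ≫ 𝟙 _ = q i i ≫ 𝟙 _
    rw [this]
  refine ⟨c.pt, c.π, hπ, h.ofArrows_mem_of_epi h3 hπ fun Z f g H =>
    Multicofork.IsColimit.hom_ext hc.isColimit H, fun i j T a b => ⟨fun e => ?_, fun r => ?_⟩⟩
  · have := ρ_comp _ _ _ _ _ _ ((hpb i j).lift a b e) (hpq i j)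
    rwa [show (hpb i j).lift a b e ≫ p i j = a from (hpb i j).lift_fst ..,
      show (hpb i j).lift a b e ≫ q i j = b from (hpb i j).lift_snd ..] at this
  · have e : lift i j T a b r ≫ p i j ≫ c.π i = lift i j T a b r ≫ q i j ≫ c.π j :=
      congrArg _ (hpb i j).w
    rwa [← Category.assoc, ← Category.assoc, lift_p, lift_q] at e

/-- Gluing admits only `u`-small index sets. A clopen arrow generates the same sieve as any other
representing the same subobject, so one member per subobject is enough. -/
theorem exists_small_family (h1 : NG1.{u} τ) {X : C} (S : Presieve X) (hS : SinkIn (clopens τ) S) :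
    ∃ (I : Type u) (U : I → C) (a : ∀ i, U i ⟶ X), (∀ i, S (a i)) ∧
      Sieve.generate S = Sieve.ofArrows U a := by
  have := h1 X
  let A : Set {A : Subobject X // clopens τ A.arrow} :=
    {A | ∃ (Y : C) (f : Y ⟶ X) (_ : Mono f), S f ∧ Subobject.mk f = A.1}
  choose Y f hf hfS e using fun x : A => x.2
  refine ⟨Shrink.{u} A, fun i => Y ((equivShrink A).symm i), fun i => f ((equivShrink A).symm i),
    fun i => hfS _, le_antisymm ?_ ?_⟩
  · rw [Sieve.generate_le_iff]
    intro Z g hg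
    have := h.mono_of_clopens (hS g hg)
    have hA : clopens τ (Subobject.mk g).arrow := by
      rw [← Subobject.underlyingIso_hom_comp_eq_mk]
      exact h.clopens_comp (h.clopens_of_isIso _) (hS g hg)
    let x : A := ⟨⟨Subobject.mk g, hA⟩, Z, g, this, hg, rfl⟩
    refine (Sieve.mem_ofArrows_iff _ _ _).2 ⟨equivShrink A x, ?_⟩
    rw [Equiv.symm_apply_apply]
    have hx : Subobject.mk g ≤ Subobject.mk (f x) := (e x).ge
    exact ⟨Subobject.ofMkLEMk _ _ hx, by simp⟩
  · rw [Sieve.generate_le_iff]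
    rintro _ _ ⟨i⟩
    exact Sieve.le_generate _ _ _ (hfS _)

end IsMPresite

namespace IsGluingPresite

variable (h : IsGluingPresite.{u} τ)

include h

theorem exists_glue {I : Type u} (U : I → C)
    (ρ : ∀ (i j : I) (T : C), (T ⟶ U i) → (T ⟶ U j) → Prop)
    (ρ_refl : ∀ i T (a : T ⟶ U i), ρ i i T a a)
    (ρ_symm : ∀ i j T (a : T ⟶ U i) (b : T ⟶ U j), ρ i j T a b → ρ j i T b a)
    (ρ_trans : ∀ i j k T (a : T ⟶ U i) (b : T ⟶ U j) (c : T ⟶ U k), ρ i j T a b → ρ j k T b c →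
      ρ i k T a c)
    (ρ_comp : ∀ i j T (a : T ⟶ U i) (b : T ⟶ U j) (T' : C) (t : T' ⟶ T), ρ i j T a b →
      ρ i j T' (t ≫ a) (t ≫ b))
    (rep : ∀ i j, ∃ (V : C) (p : V ⟶ U i) (q : V ⟶ U j), clopens τ p ∧ ρ i j V p q ∧
      ∀ T a b, ρ i j T a b → ∃ t : T ⟶ V, t ≫ p = a ∧ t ≫ q = b) :
    ∃ (Q : C) (π : ∀ i, U i ⟶ Q), (∀ i, clopens τ (π i)) ∧
      Sieve.ofArrows U π ∈ τ.toGrothendieck Q ∧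
      ∀ i j T (a : T ⟶ U i) (b : T ⟶ U j), a ≫ π i = b ≫ π j ↔ ρ i j T a b :=
  h.toIsMPresite.exists_glue h.gluing h.ng3 U ρ ρ_refl ρ_symm ρ_trans ρ_comp rep

theorem exists_small_family {X : C} (S : Presieve X) (hS : SinkIn (clopens τ) S) :
    ∃ (I : Type u) (U : I → C) (a : ∀ i, U i ⟶ X), (∀ i, S (a i)) ∧
      Sieve.generate S = Sieve.ofArrows U a :=
  h.toIsMPresite.exists_small_family h.ng1 S hS

theorem exists_union {X : C} (S : Presieve X) (hS : SinkIn (clopens τ) S) :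
    ∃ (Z : C) (z : Z ⟶ X), clopens τ z ∧ (Sieve.generate S).pullback z ∈ τ.toGrothendieck Z ∧
      ∀ ⦃Y : C⦄ (f : Y ⟶ X), S f → ∃ l : Y ⟶ Z, l ≫ z = f := by
  obtain ⟨I, U, a, rfl⟩ := S.exists_eq_ofArrows
  obtain ⟨Z, z, a', hc, hz, e⟩ := h.ng2 X I U a fun i => hS _ (.mk i)
  refine ⟨Z, z, hz, ?_, ?_⟩
  · refine τ.toGrothendieck.superset_covering ?_ (Precoverage.generate_mem_toGrothendieck hc)
    rw [Sieve.generate_le_iff]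
    rintro _ _ ⟨i⟩
    exact (Sieve.mem_ofArrows_iff _ _ _).2 ⟨i, 𝟙 _, by simp [e]⟩
  · rintro _ _ ⟨i⟩
    exact ⟨a' i, e i⟩

/-- The union of no subobjects. It will serve as the overlap of distinct summands in a coproduct. -/
theorem exists_bot_mem (X : C) : ∃ (Z : C) (z : Z ⟶ X), clopens τ z ∧
    ⊥ ∈ τ.toGrothendieck Z := by
  obtain ⟨Z, z, hz, hc, -⟩ := h.exists_union (⊥ : Presieve X) (fun _ _ hf => hf.elim)
  refine ⟨Z, z, hz, ?_⟩
  refine τ.toGrothendieck.superset_covering ?_ hc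
  rintro Y f ⟨_, _, _, hf, _⟩
  exact hf.elim

end IsGluingPresite

/-- The sheaf condition of a representable presheaf for the empty covering says that there is
exactly one arrow to each object. -/
theorem nonempty_isInitial_of_bot_mem {J : GrothendieckTopology C} [J.Subcanonical] {Z : C}
    (hZ : ⊥ ∈ J Z) : Nonempty (IsInitial Z) := by
  have hZ' : Sieve.ofArrows (PEmpty.elim : PEmpty.{1} → C) (fun i => (i.elim : _ ⟶ Z)) ∈ J Z :=
    J.superset_covering bot_le hZ
  choose f hf using fun T => exists_desc_of_family hZ' (T := T) (fun i => i.elim)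
    (fun i => i.elim)
  exact ⟨IsInitial.ofUniqueHom f fun T m => hom_ext_of_mem hZ fun _ _ h => h.elim⟩

theorem bot_mem_of_hom {J : GrothendieckTopology C} {Y Z : C}
    (hZ : ⊥ ∈ J Z) (f : Y ⟶ Z) : ⊥ ∈ J Y := by
  simpa using J.pullback_stable f hZ

end Gluing

end Glutos

namespace Glutos

/-! ### Étale arrows and their stability properties -/

section Etale

variable {C : Type v} [Category.{w} C]

/-- The clopen arrows into the source of `f` whose composite with `f` is clopen. -/
def etaleSink (τ : Precoverage C) {X Y : C} (f : X ⟶ Y) : Presieve X :=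
  fun _ a => clopens τ a ∧ clopens τ (a ≫ f)

/-- The arrows that are locally on the source clopen. -/
def etale (τ : Precoverage C) : MorphismProperty C :=
  fun X _ f => Sieve.generate (etaleSink τ f) ∈ τ.toGrothendieck X

variable {τ : Precoverage C}

theorem IsPresite.etale_of_clopens (h : IsPresite τ) {X Y : C} {f : X ⟶ Y} (hf : clopens τ f) :
    etale τ f := by
  refine τ.toGrothendieck.superset_covering ?_ (τ.toGrothendieck.top_mem X)
  intro Z g _
  exact ⟨X, g, 𝟙 X, ⟨h.clopens_of_isIso _, by simpa using hf⟩, by simp⟩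

theorem IsPresite.etale_of_cover (h : IsPresite τ) {X Y : C} {f : X ⟶ Y} {S : Presieve X}
    (hS : SinkIn (clopens τ) S) (hc : Sieve.generate S ∈ τ.toGrothendieck X)
    (H : ∀ ⦃Z : C⦄ (a : Z ⟶ X), S a → etale τ (a ≫ f)) : etale τ f := by
  refine transitive_generate hc _ fun Z a ha => ?_
  refine τ.toGrothendieck.superset_covering ?_ (H a ha)
  rw [Sieve.generate_le_iff]
  rintro W b ⟨hb, hb'⟩
  exact Sieve.le_generate _ _ _ ⟨h.clopens_comp hb (hS a ha), by simpa using hb'⟩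

theorem IsPresite.etale_comp (h : IsPresite τ) {X Y Z : C} {f : X ⟶ Y} {g : Y ⟶ Z}
    (hf : etale τ f) (hg : etale τ g) : etale τ (f ≫ g) := by
  refine transitive_generate hf _ fun W a ha => ?_
  refine τ.toGrothendieck.superset_covering ?_ (τ.toGrothendieck.pullback_stable (a ≫ f) hg)
  rintro T k ⟨V, t, b, hb, e⟩
  have := h.hasPullback hb.1 (a ≫ f)
  have H := IsPullback.of_hasPullback b (a ≫ f)
  refine ⟨_, pullback.lift t k e, pullback.snd b (a ≫ f) ≫ a, ⟨?_, ?_⟩, pullback.lift_snd_assoc ..⟩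
  · exact h.clopens_comp (h.clopens_of_isPullback H hb.1) ha.1
  · have e' : (pullback.snd b (a ≫ f) ≫ a) ≫ f ≫ g = pullback.fst b (a ≫ f) ≫ b ≫ g := by
      have := pullback.condition (f := b) (g := a ≫ f)
      simp only [Category.assoc] at this ⊢
      rw [reassoc_of% this]
    rw [e']
    exact h.clopens_comp (h.clopens_of_isPullback' H ha.2) hb.2

theorem IsPresite.etale_of_isPullback (h : IsPresite τ) {P X Y Z : C} {p : P ⟶ X} {q : P ⟶ Y}
    {f : X ⟶ Z} {g : Y ⟶ Z} (H : IsPullback p q f g) (hf : etale τ f) : etale τ q := by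
  refine τ.toGrothendieck.superset_covering ?_ (τ.toGrothendieck.pullback_stable p hf)
  rintro T k ⟨V, t, a, ha, e⟩
  have := h.hasPullback ha.1 p
  have H' := IsPullback.of_hasPullback a p
  refine ⟨_, pullback.lift t k e, pullback.snd a p, ⟨h.clopens_of_isPullback H' ha.1, ?_⟩,
    pullback.lift_snd ..⟩
  exact h.clopens_of_isPullback (H'.paste_vert H) ha.2

/-- Intersect a piece on which `g ≫ f` is clopen with the preimage of a piece `b` on which `f` is
clopen. There `g` factors through `b`, and its factor is clopen because it becomes so after the mono
`b ≫ f`. -/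
theorem IsMPresite.etale_of_postcomp (h : IsMPresite τ) {X Y Z : C} {g : X ⟶ Y} {f : Y ⟶ Z}
    (hgf : etale τ (g ≫ f)) (hf : etale τ f) : etale τ g := by
  refine transitive_generate hgf _ fun W a ha => ?_
  refine τ.toGrothendieck.superset_covering ?_ (τ.toGrothendieck.pullback_stable (a ≫ g) hf)
  rintro T k ⟨V, t, b, hb, e⟩
  have := h.hasPullback hb.1 (a ≫ g)
  have H := IsPullback.of_hasPullback b (a ≫ g)
  have hs := h.clopens_of_isPullback H hb.1
  refine ⟨_, pullback.lift t k e, pullback.snd b (a ≫ g) ≫ a, ⟨?_, ?_⟩, pullback.lift_snd_assoc ..⟩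
  · exact h.clopens_comp hs ha.1
  · have := h.mono_of_clopens hb.2
    have e' : (pullback.snd b (a ≫ g) ≫ a) ≫ g = pullback.fst b (a ≫ g) ≫ b := by
      rw [pullback.condition]
      simp
    rw [e']
    refine h.clopens_comp (h.clopens_of_comp_mono (f := b ≫ f) ?_) hb.1
    have e'' : pullback.fst b (a ≫ g) ≫ b ≫ f = pullback.snd b (a ≫ g) ≫ a ≫ g ≫ f := by
      rw [pullback.condition_assoc]
      simp
    rw [e'']
    exact h.clopens_comp hs ha.2

namespace IsGluingPresite

variable (h : IsGluingPresite.{u} τ)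

include h

/-- The clopen pieces of `X` are clopen in `Y`; their union `z` and the mono `f` factor through each
other, because each does so locally. -/
theorem clopens_of_etale_of_mono {X Y : C} {f : X ⟶ Y} (hf : etale τ f) [Mono f] :
    clopens τ f := by
  have := h.subcanonical
  let S : Presieve Y := fun W b => ∃ a : W ⟶ X, etaleSink τ f a ∧ a ≫ f = b
  obtain ⟨Z, z, hz, hc, hl⟩ := h.exists_union S (by rintro W _ ⟨a, ha, rfl⟩; exact ha.2)
  have := h.mono_of_clopens hz
  obtain ⟨s, hs⟩ := exists_lift_of_mem z f hf (by
    rintro W _ ⟨_, b, a, ha, rfl⟩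
    obtain ⟨l, hl⟩ := hl (a ≫ f) ⟨a, ha, rfl⟩
    exact ⟨b ≫ l, by simp [hl]⟩)
  obtain ⟨t, ht⟩ := exists_lift_of_mem f z hc (by
    rintro W k ⟨_, b, _, ⟨a, ha, rfl⟩, e⟩
    exact ⟨b ≫ a, by simp [e]⟩)
  have : IsIso s := ⟨t, by rw [← cancel_mono f]; simp [ht, hs],
    by rw [← cancel_mono z]; simp [ht, hs]⟩
  rw [← hs]
  exact h.clopens_comp (h.clopens_of_isIso _) hz

/-- Pullbacks can be constructed locally. -/
theorem hasPullback_of_cover {X Y Y' : C} {f : X ⟶ Y} (g : Y' ⟶ Y) {S : Presieve X}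
    (hS : SinkIn (clopens τ) S) (hc : Sieve.generate S ∈ τ.toGrothendieck X)
    (H : ∀ ⦃W : C⦄ (a : W ⟶ X), S a → HasPullback (a ≫ f) g) : HasPullback f g := by
  have := h.subcanonical
  obtain ⟨I, U, a, haS, e⟩ := h.exists_small_family S hS
  rw [e] at hc
  have hPB : ∀ i, HasPullback (a i ≫ f) g := fun i => H _ (haS i)
  have ha : ∀ i, clopens τ (a i) := fun i => hS _ (haS i)
  have hPa : ∀ {T : C} (x : T ⟶ X) i, HasPullback (a i) x := fun x i => h.hasPullback (ha i) x
  let P : I → C := fun i => pullback (a i ≫ f) g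
  let r : ∀ i, P i ⟶ U i := fun i => pullback.fst (a i ≫ f) g
  let q : ∀ i, P i ⟶ Y' := fun i => pullback.snd (a i ≫ f) g
  have hrq : ∀ i, r i ≫ a i ≫ f = q i ≫ g := fun i => pullback.condition
  have hext : ∀ i {T : C} {s t : T ⟶ P i}, s ≫ r i = t ≫ r i → s ≫ q i = t ≫ q i → s = t :=
    fun i _ _ _ h₁ h₂ => pullback.hom_ext h₁ h₂
  -- Glue the local pullbacks, identifying points with the same image in `X` and in `Y'`. The
  -- overlap of `P i` and `P j` is the part of `P i` lying over `U j`.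
  obtain ⟨Q, π, hπ, hQ, hρ⟩ := h.exists_glue P
    (fun i j T s t => s ≫ r i ≫ a i = t ≫ r j ≫ a j ∧ s ≫ q i = t ≫ q j)
    (fun i T s => ⟨rfl, rfl⟩) (fun i j T s t H => ⟨H.1.symm, H.2.symm⟩)
    (fun i j k T s t t' H H' => ⟨H.1.trans H'.1, H.2.trans H'.2⟩)
    (fun i j T s t T' x H => by simp [H.1, H.2])
    (fun i j => by
      have H' : IsPullback _ _ (a j) (r i ≫ a i) := IsPullback.of_hasPullback _ _
      have hw : pullback.fst (a j) (r i ≫ a i) ≫ a j ≫ f =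
          (pullback.snd (a j) (r i ≫ a i) ≫ q i) ≫ g := by
        rw [pullback.condition_assoc, Category.assoc, Category.assoc, hrq]
      have h₁ : pullback.lift _ _ hw ≫ r j = _ := pullback.lift_fst ..
      have h₂ : pullback.lift _ _ hw ≫ q j = _ := pullback.lift_snd ..
      refine ⟨pullback (a j) (r i ≫ a i), pullback.snd _ _, pullback.lift _ _ hw,
        h.clopens_of_isPullback H' (ha j), ⟨?_, h₂.symm⟩, fun T s t H => ?_⟩
      · rw [reassoc_of% h₁, pullback.condition]
      · have hw' : (t ≫ r j) ≫ a j = s ≫ r i ≫ a i := by simp [H.1]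
        refine ⟨pullback.lift _ _ hw', pullback.lift_snd .., hext j ?_ ?_⟩
        · rw [Category.assoc, h₁, pullback.lift_fst]
        · rw [Category.assoc, h₂, pullback.lift_snd_assoc, H.2])
  obtain ⟨x, hx⟩ := exists_desc_of_family hQ (fun i => r i ≫ a i)
    fun i j W s t e => ((hρ _ _ _ _ _).1 e).1
  obtain ⟨y, hy⟩ := exists_desc_of_family hQ q fun i j W s t e => ((hρ _ _ _ _ _).1 e).2
  have hxy : x ≫ f = y ≫ g := hom_ext_of_family hQ fun i => by
    rw [reassoc_of% hx, reassoc_of% hy]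
    simpa using hrq i
  -- On a common covering `s` and `t` land in pieces `P i` and `P j`, where equality in `Q` is by
  -- construction equality of both coordinates.
  have hjm : ∀ {T : C} {s t : T ⟶ Q}, s ≫ x = t ≫ x → s ≫ y = t ≫ y → s = t := by
    intro T s t hsx hsy
    refine hom_ext_of_mem (τ.toGrothendieck.intersection_covering
      (τ.toGrothendieck.pullback_stable s hQ) (τ.toGrothendieck.pullback_stable t hQ)) ?_
    rintro W k ⟨⟨_, l, _, ⟨i⟩, el⟩, ⟨_, m, _, ⟨j⟩, em⟩⟩
    rw [← el, ← em, hρ, ← hx, ← hx, ← hy, ← hy, reassoc_of% el, reassoc_of% em,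
      reassoc_of% el, reassoc_of% em, hsx, hsy]
    exact ⟨rfl, rfl⟩
  refine IsPullback.hasPullback (fst := x) (snd := y) ⟨⟨hxy⟩, ⟨PullbackCone.IsLimit.mk _
    (fun s => Classical.choose (?_ : ∃ l : s.pt ⟶ Q, l ≫ x = s.fst ∧ l ≫ y = s.snd))
    (fun s => (Classical.choose_spec (_ : ∃ l : s.pt ⟶ Q, l ≫ x = s.fst ∧ l ≫ y = s.snd)).1)
    (fun s => (Classical.choose_spec (_ : ∃ l : s.pt ⟶ Q, l ≫ x = s.fst ∧ l ≫ y = s.snd)).2)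
    (fun s m h₁ h₂ => hjm ?_ ?_)⟩⟩
  -- A cone is lifted over the preimages of the `U i`, where the local pullbacks apply; the lifts
  -- agree on overlaps by joint monicity.
  · have hT := ofArrows_mem_of_isPullback hc s.fst (fun i => pullback.snd (a i) s.fst)
      (fun i => pullback.fst (a i) s.fst) fun i => (IsPullback.of_hasPullback _ _).flip
    have hw : ∀ i, pullback.fst (a i) s.fst ≫ a i ≫ f = (pullback.snd (a i) s.fst ≫ s.snd) ≫ g := by
      intro i
      rw [pullback.condition_assoc, Category.assoc, s.condition]
    have h₁ : ∀ i, pullback.lift _ _ (hw i) ≫ r i = _ := fun i => pullback.lift_fst ..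
    have h₂ : ∀ i, pullback.lift _ _ (hw i) ≫ q i = _ := fun i => pullback.lift_snd ..
    have k₁ : ∀ i, pullback.lift _ _ (hw i) ≫ π i ≫ x = pullback.snd (a i) s.fst ≫ s.fst := by
      intro i
      rw [hx, reassoc_of% h₁, pullback.condition]
    have k₂ : ∀ i, pullback.lift _ _ (hw i) ≫ π i ≫ y = pullback.snd (a i) s.fst ≫ s.snd := by
      intro i
      rw [hy, h₂]
    obtain ⟨l, hl⟩ := exists_desc_of_family hT (fun i => pullback.lift _ _ (hw i) ≫ π i)
      fun i j W p p' e => hjm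
        (by simp only [Category.assoc]; rw [k₁, k₁, reassoc_of% e])
        (by simp only [Category.assoc]; rw [k₂, k₂, reassoc_of% e])
    refine ⟨l, hom_ext_of_family hT fun i => ?_, hom_ext_of_family hT fun i => ?_⟩
    · rw [reassoc_of% hl, k₁]
    · rw [reassoc_of% hl, k₂]
  · rw [h₁, (Classical.choose_spec (_ : ∃ l : s.pt ⟶ Q, l ≫ x = s.fst ∧ l ≫ y = s.snd)).1]
  · rw [h₂, (Classical.choose_spec (_ : ∃ l : s.pt ⟶ Q, l ≫ x = s.fst ∧ l ≫ y = s.snd)).2]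

theorem etale_hasPullback {X Y Y' : C} {f : X ⟶ Y} (hf : etale τ f) (g : Y' ⟶ Y) :
    HasPullback f g :=
  h.hasPullback_of_cover g (fun _ _ ha => ha.1) hf fun _ _ ha => h.hasPullback ha.2 g

theorem isClopos_etale : IsClopos (etale τ) where
  of_isIso _ _ f _ := h.etale_of_clopens (h.clopens_of_isIso f)
  hasPullbacks := ⟨fun g hf => h.etale_hasPullback hf g⟩
  isStableUnderComposition := ⟨fun _ _ hf hg => h.etale_comp hf hg⟩
  isStableUnderBaseChange := ⟨fun sq hg => h.etale_of_isPullback sq hg⟩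

end IsGluingPresite

end Etale

end Glutos

namespace Glutos

/-! ### Recognizing universal colimits; coproducts, epis and quotients -/

section Colimits

variable {C : Type v} [Category.{w} C]

theorem exists_jointLift_of_mem {J : GrothendieckTopology C} [J.Subcanonical] {R X Y T : C}
    (p : R ⟶ X) (q : R ⟶ Y) (hpq : JointlyMono₂ p q) (s : T ⟶ X) (t : T ⟶ Y) {A : Sieve T}
    (hA : A ∈ J T) (h : ∀ ⦃W : C⦄ (k : W ⟶ T), A k → ∃ l : W ⟶ R, l ≫ p = k ≫ s ∧ l ≫ q = k ≫ t) :
    ∃ l : T ⟶ R, l ≫ p = s ∧ l ≫ q = t := by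
  choose l hp hq using h
  have hA' : Sieve.generate (A : Presieve T) ∈ J T := by simpa using hA
  obtain ⟨f, hf⟩ := exists_desc_of_presieve hA' l fun Y Z W a ha b hb x y e =>
    hpq.right_cancellation _ _ (by simp [hp, reassoc_of% e]) (by simp [hq, reassoc_of% e])
  exact ⟨f, hom_ext_of_mem hA fun Y a ha => by rw [← hp a ha, ← hf a ha, Category.assoc],
    hom_ext_of_mem hA fun Y a ha => by rw [← hq a ha, ← hf a ha, Category.assoc]⟩

theorem exists_of_isEquivalenceRelation {R X : C} {u v : R ⟶ X} (h : IsEquivalenceRelation u v) :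
    JointlyMono₂ u v ∧ (∃ r : X ⟶ R, r ≫ u = 𝟙 X ∧ r ≫ v = 𝟙 X) ∧
      (∃ s : R ⟶ R, s ≫ u = v ∧ s ≫ v = u) ∧
      ∀ (T : C) (r r' : T ⟶ R), r ≫ v = r' ≫ u → ∃ t : T ⟶ R, t ≫ u = r ≫ u ∧ t ≫ v = r' ≫ v := by
  obtain ⟨⟨E⟩⟩ := h
  refine ⟨E.toJointlyMono₂, ⟨E.r, E.reflexivity₁, E.reflexivity₂⟩,
    ⟨E.s, E.symmetry₁, E.symmetry₂⟩, fun T r r' e => ?_⟩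
  obtain ⟨l, l₁, l₂⟩ := PullbackCone.IsLimit.lift' E.isLimit r r' e
  exact ⟨l ≫ E.t, by rw [Category.assoc, E.transitivity₁, reassoc_of% l₁],
    by rw [Category.assoc, E.transitivity₂, reassoc_of% l₂]⟩

/-- A cocone is a universal colimit if it is covering and generalized elements of the objects of
the diagram having the same image are identified by the diagram. -/
theorem isUniversalColimit_of_cover {J : GrothendieckTopology C} [J.Subcanonical] {K : Type*}
    [Category* K] {F : K ⥤ C} (c : Cocone F) {I : Type*} (k : I → K)
    (hc : Sieve.ofArrows (fun i => F.obj (k i)) (fun i => c.ι.app (k i)) ∈ J c.pt)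
    (H : ∀ (i j : I) (T : C) (a : T ⟶ F.obj (k i)) (b : T ⟶ F.obj (k j)),
      a ≫ c.ι.app (k i) = b ≫ c.ι.app (k j) → ⊥ ∈ J T ∨
        ∃ (l : K) (m : l ⟶ k i) (n : l ⟶ k j) (t : T ⟶ F.obj l), t ≫ F.map m = a ∧ t ≫ F.map n = b)
    (hK : ∀ l : K, ∃ i, Nonempty (l ⟶ k i)) : IsUniversalColimit c := by
  intro F' c' α f hw _ hp
  have hw' : ∀ l, α.app l ≫ c.ι.app l = c'.ι.app l ≫ f := fun l => congr_app hw l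
  have hcov := ofArrows_mem_of_isPullback hc f (fun i => c'.ι.app (k i)) (fun i => α.app (k i))
    fun i => hp (k i)
  have hd : ∀ s : Cocone F', ∃ d : c'.pt ⟶ s.pt, ∀ i, c'.ι.app (k i) ≫ d = s.ι.app (k i) := by
    intro s
    refine exists_desc_of_family hcov _ fun i j W p q e => ?_
    -- Over an object with empty covering all parallel arrows agree. Otherwise the identification in
    -- `F` lifts to `F'`, because the cocone squares are cartesian.
    obtain hW | ⟨l, m, n, t, ht, ht'⟩ := H i j W (p ≫ α.app _) (q ≫ α.app _) (by
      rw [Category.assoc, Category.assoc, hw', hw', reassoc_of% e])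
    · exact hom_ext_of_mem hW fun _ _ h => h.elim
    · have e₁ : (p ≫ c'.ι.app (k i)) ≫ f = t ≫ c.ι.app l := by
        rw [Category.assoc, ← hw', ← Category.assoc, ← ht, Category.assoc, c.w]
      have x₁ := (hp l).lift_fst _ _ e₁
      have x₂ := (hp l).lift_snd _ _ e₁
      generalize (hp l).lift _ _ e₁ = x at x₁ x₂
      obtain rfl : x ≫ F'.map m = p := (hp (k i)).hom_ext (by simp [x₁])
        (by rw [Category.assoc, α.naturality, reassoc_of% x₂, ht])
      obtain rfl : x ≫ F'.map n = q := (hp (k j)).hom_ext (by rw [← e, Category.assoc, c'.w, x₁])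
        (by rw [Category.assoc, α.naturality, reassoc_of% x₂, ht'])
      simp
  choose d hd using hd
  refine ⟨⟨d, fun s l => ?_, fun s m hm => ?_⟩⟩
  · obtain ⟨i, ⟨m⟩⟩ := hK l
    rw [← c'.w m, Category.assoc, hd, s.w]
  · exact hom_ext_of_family hcov fun i => by rw [hm, hd]

variable {τ : Precoverage C}

namespace IsGluingPresite

variable (h : IsGluingPresite.{u} τ)

include h

theorem exists_coproduct {I : Type u} (U : I → C) :
    ∃ (Q : C) (π : ∀ i, U i ⟶ Q), (∀ i, clopens τ (π i)) ∧
      Sieve.ofArrows U π ∈ τ.toGrothendieck Q ∧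
      ∀ i j T (a : T ⟶ U i) (b : T ⟶ U j), i ≠ j → a ≫ π i = b ≫ π j →
        ⊥ ∈ τ.toGrothendieck T := by
  classical
  have := h.subcanonical
  have hbot : ∀ {T Z : C} (_ : ⊥ ∈ τ.toGrothendieck T) (f g : T ⟶ Z), f = g :=
    fun hT f g => hom_ext_of_mem hT fun _ _ h => h.elim
  -- Distinct summands share only sources with empty covering. This alternative is what lets the
  -- empty clopen subobject represent the relation for `i ≠ j`.
  obtain ⟨Q, π, hπ, hQ, hρ⟩ := h.exists_glue U
    (fun i j T a b => (∃ e : i = j, a ≫ eqToHom (congrArg U e) = b) ∨ ⊥ ∈ τ.toGrothendieck T)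
    (fun i T a => .inl ⟨rfl, by simp⟩)
    (by
      rintro i j T a b (⟨rfl, rfl⟩ | hT)
      · exact .inl ⟨rfl, by simp⟩
      · exact .inr hT)
    (by
      rintro i j k T a b c (⟨rfl, rfl⟩ | hT) (⟨rfl, rfl⟩ | hT')
      · exact .inl ⟨rfl, by simp⟩
      · exact .inr hT'
      · exact .inr hT
      · exact .inr hT)
    (by
      rintro i j T a b T' t (⟨rfl, rfl⟩ | hT)
      · exact .inl ⟨rfl, by simp⟩
      · exact .inr (bot_mem_of_hom hT t))
    (by
      intro i j
      by_cases hij : i = j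
      · subst hij
        refine ⟨U i, 𝟙 _, 𝟙 _, h.clopens_of_isIso _, .inl ⟨rfl, by simp⟩, ?_⟩
        rintro T a b (⟨_, rfl⟩ | hT)
        · exact ⟨a, by simp, by simp⟩
        · exact ⟨a, by simp, hbot hT _ _⟩
      · obtain ⟨V, p, hp, hV⟩ := h.exists_bot_mem (U i)
        refine ⟨V, p, (nonempty_isInitial_of_bot_mem hV).some.to _, hp, .inr hV, ?_⟩
        rintro T a b (⟨e, -⟩ | hT)
        · exact (hij e).elim
        · exact ⟨(nonempty_isInitial_of_bot_mem hT).some.to _, hbot hT _ _, hbot hT _ _⟩)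
  refine ⟨Q, π, hπ, hQ, fun i j T a b hij e => ?_⟩
  obtain ⟨e, -⟩ | hT := (hρ _ _ _ _ _).1 e
  · exact (hij e).elim
  · exact hT

theorem isUniversalColimit_cofan {I : Type u} {U : I → C} {Q : C} {π : ∀ i, U i ⟶ Q}
    (hπ : ∀ i, clopens τ (π i)) (hQ : Sieve.ofArrows U π ∈ τ.toGrothendieck Q)
    (hd : ∀ i j T (a : T ⟶ U i) (b : T ⟶ U j), i ≠ j → a ≫ π i = b ≫ π j →
        ⊥ ∈ τ.toGrothendieck T) : IsUniversalColimit (Cofan.mk Q π) := by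
  have := h.subcanonical
  refine isUniversalColimit_of_cover (J := τ.toGrothendieck) (Cofan.mk Q π)
    (fun i : I => (⟨i⟩ : Discrete I)) hQ (fun i j T a b e => ?_) fun l => ⟨l.as, ⟨𝟙 _⟩⟩
  by_cases hij : i = j
  · subst hij
    have := h.mono_of_clopens (hπ i)
    have e' : a = b := (cancel_mono (π i)).1 e
    exact .inr ⟨⟨i⟩, 𝟙 _, 𝟙 _, a, by simp, by simp [e']⟩
  · exact .inl (hd i j T a b hij e)

/-- Restricting each étale member to its clopen pieces gives a sink of clopen arrows, still epi
because the pieces cover. `NG3` applies to this refinement. -/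
theorem generate_mem_of_isEpiSink {X : C} {S : Presieve X} (hS : SinkIn (etale τ) S)
    (he : IsEpiSink S) : Sieve.generate S ∈ τ.toGrothendieck X := by
  have := h.subcanonical
  let S' : Presieve X := fun W a => ∃ (Y : C) (f : Y ⟶ X) (b : W ⟶ Y),
    S f ∧ etaleSink τ f b ∧ b ≫ f = a
  have hS' : SinkIn (clopens τ) S' := by
    rintro W _ ⟨Y, f, b, hf, hb, rfl⟩
    exact hb.2
  refine τ.toGrothendieck.superset_covering ?_ ((h.mem_iff_generate_mem hS').1
    (h.ng3 X S' hS' fun Z x y hxy => he x y fun Y f hf => hom_ext_of_mem (hS f hf) ?_))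
  · rw [Sieve.generate_le_iff]
    rintro W _ ⟨Y, f, b, hf, hb, rfl⟩
    exact ⟨Y, b, f, hf, rfl⟩
  · rintro W _ ⟨V, c, b, hb, rfl⟩
    have := hxy (b ≫ f) ⟨Y, f, b, hf, hb, rfl⟩
    simp only [Category.assoc] at this ⊢
    rw [this]

theorem generate_singleton_mem {X Y : C} {f : X ⟶ Y} (hf : etale τ f) [Epi f] :
    Sieve.generate (Presieve.singleton f) ∈ τ.toGrothendieck Y :=
  h.generate_mem_of_isEpiSink (fun _ _ ⟨⟩ => hf) fun _ _ _ H => (cancel_epi f).1 (H f ⟨⟩)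

theorem effectiveEpi_of_etale {X Y : C} {f : X ⟶ Y} (hf : etale τ f) [Epi f] : EffectiveEpi f := by
  have := h.subcanonical
  rw [← Sieve.effectiveEpimorphic_singleton,
    Presieve.EffectiveEpimorphic.iff_forall_isSheafFor_yoneda]
  intro T
  rw [Presieve.isSheafFor_iff_generate]
  exact GrothendieckTopology.Subcanonical.isSheaf_of_isRepresentable (J := τ.toGrothendieck)
    (yoneda.obj T) _ (h.generate_singleton_mem hf)

/-- The clopen local sections of an étale epimorphism. -/
theorem generate_sections_mem {X Y : C} {p : X ⟶ Y} (hp : etale τ p) [Epi p] :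
    Sieve.generate (fun W b => ∃ a : W ⟶ X, etaleSink τ p a ∧ a ≫ p = b : Presieve Y) ∈
      τ.toGrothendieck Y := by
  refine transitive_generate (h.generate_singleton_mem hp) _ ?_
  rintro _ _ ⟨⟩
  refine τ.toGrothendieck.superset_covering ?_ hp
  rw [Sieve.generate_le_iff]
  intro W a ha
  exact ⟨W, 𝟙 _, a ≫ p, ⟨a, ha, rfl⟩, by simp⟩

/-- An étale epi has local sections over a clopen covering of `Y`, and on each piece `f` is the
restriction of `p ≫ f` along such a section. -/
theorem etale_of_precomp {X Y Z : C} {p : X ⟶ Y} {f : Y ⟶ Z} (hpf : etale τ (p ≫ f))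
    (hp : etale τ p) [Epi p] : etale τ f := by
  refine h.etale_of_cover ?_ (h.generate_sections_mem hp) ?_
  · rintro W _ ⟨a, ha, rfl⟩
    exact ha.2
  · rintro W _ ⟨a, ha, rfl⟩
    rw [Category.assoc]
    exact h.etale_comp (h.etale_of_clopens ha.1) hpf

theorem hasPullback_of_epi {X R S Y : C} {r : X ⟶ R} {g : R ⟶ S} {f : Y ⟶ S} (hr : etale τ r)
    [Epi r] [HasPullback (r ≫ g) f] : HasPullback g f := by
  refine h.hasPullback_of_cover f ?_ (h.generate_sections_mem hr) ?_
  · rintro W _ ⟨a, ha, rfl⟩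
    exact ha.2
  · rintro W _ ⟨a, ha, rfl⟩
    have := h.hasPullback ha.1 (pullback.fst (r ≫ g) f)
    have := ((IsPullback.of_hasPullback a (pullback.fst (r ≫ g) f)).flip.paste_horiz
      (IsPullback.of_hasPullback (r ≫ g) f).flip).flip
    rw [Category.assoc]
    exact this.hasPullback

/-- The quotient is glued from clopen subobjects of `X` so small that distinct points of them are
never related; these embed into the quotient. -/
theorem exists_quotient {R X : C} {u v : R ⟶ X} (hE : IsEquivalenceRelation u v) (hu : etale τ u)
    (hl : LocallyOCoequalizable (etale τ) u v) :
    ∃ (Q : C) (q : X ⟶ Q) (hq : u ≫ q = v ≫ q), etale τ q ∧ IsKernelPair q u v ∧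
      IsUniversalColimit (Cofork.ofπ q hq) := by
  have := h.subcanonical
  obtain ⟨hj, ⟨er, er₁, er₂⟩, ⟨es, es₁, es₂⟩, et⟩ := exists_of_isEquivalenceRelation hE
  obtain ⟨S, hS, hSe, hSl⟩ := hl
  -- The clopen subobjects on which `R` induces at most the diagonal.
  let A : Presieve X := fun V a => clopens τ a ∧ ∀ T (r : T ⟶ R) (s t : T ⟶ V),
    r ≫ u = s ≫ a → r ≫ v = t ≫ a → s = t
  have hA : Sieve.generate A ∈ τ.toGrothendieck X := by
    refine transitive_generate (h.generate_mem_of_isEpiSink hS hSe) _ fun X' f hf => ?_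
    obtain ⟨R', u', v', ⟨R₀, R₁, a₀, b₀, b₁, a₁, c₀, c₁, H₀, H₁, H₂, rfl, rfl⟩, Q', q', hq', e⟩ :=
      hSl f hf
    refine τ.toGrothendieck.superset_covering ?_
      (τ.toGrothendieck.intersection_covering (hS f hf) hq')
    rintro V k ⟨⟨V₁, k₁, g₁, hg₁, e₁⟩, ⟨V₂, k₂, g₂, hg₂, e₂⟩⟩
    -- On the intersection of a piece where `f` is clopen with one where the coequalizing arrow `q'`
    -- is clopen, `q'` is monic, so related points coincide.
    have := h.hasPullback hg₁.1 g₂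
    have H := IsPullback.of_hasPullback g₁ g₂
    have hm : clopens τ (pullback.snd g₁ g₂) := h.clopens_of_isPullback H hg₁.1
    have hm' : clopens τ (pullback.fst g₁ g₂) := h.clopens_of_isPullback' H hg₂.1
    refine ⟨_, pullback.lift k₁ k₂ (e₁.trans e₂.symm), pullback.snd g₁ g₂ ≫ g₂ ≫ f, ⟨?_, ?_⟩, ?_⟩
    · rw [← pullback.condition_assoc]
      exact h.clopens_comp hm' hg₁.2
    · intro T r s t hs ht
      have hr₀ : (s ≫ pullback.snd g₁ g₂ ≫ g₂) ≫ f = r ≫ u := by simp [hs]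
      have hr₁ : r ≫ v = (t ≫ pullback.snd g₁ g₂ ≫ g₂) ≫ f := by simp [ht]
      have hr₂ : H₀.lift _ _ hr₀ ≫ b₀ = H₁.lift _ _ hr₁ ≫ b₁ := by simp
      have : Mono (g₂ ≫ q') := h.mono_of_clopens hg₂.2
      have := h.mono_of_clopens hm
      rw [← cancel_mono (pullback.snd g₁ g₂), ← cancel_mono (g₂ ≫ q')]
      have e₃ := congrArg (H₂.lift _ _ hr₂ ≫ ·) e
      simpa using e₃
    · rw [pullback.lift_snd_assoc, reassoc_of% e₂]
  obtain ⟨I, V, a, haA, eA⟩ := h.exists_small_family A fun _ _ ha => ha.1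
  rw [eA] at hA
  have ha : ∀ i, clopens τ (a i) := fun i => (haA i).1
  obtain ⟨Q, π, hπ, hQ, hρ⟩ := h.exists_glue V
    (fun i j T x y => ∃ r : T ⟶ R, r ≫ u = x ≫ a i ∧ r ≫ v = y ≫ a j)
    (fun i T x => ⟨x ≫ a i ≫ er, by simp [er₁], by simp [er₂]⟩)
    (by
      rintro i j T x y ⟨r, h₁, h₂⟩
      exact ⟨r ≫ es, by simp [es₁, h₂], by simp [es₂, h₁]⟩)
    (by
      rintro i j k T x y z ⟨r, h₁, h₂⟩ ⟨r', h₁', h₂'⟩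
      obtain ⟨l, l₁, l₂⟩ := et _ r r' (h₂.trans h₁'.symm)
      exact ⟨l, l₁.trans h₁, l₂.trans h₂'⟩)
    (by
      rintro i j T x y T' t ⟨r, h₁, h₂⟩
      exact ⟨t ≫ r, by simp [h₁], by simp [h₂]⟩)
    (by
      intro i j
      have := h.hasPullback (ha i) u
      have := h.hasPullback (ha j) (pullback.snd (a i) u ≫ v)
      let x := pullback.fst (a i) u
      let r := pullback.snd (a i) u
      let y := pullback.fst (a j) (r ≫ v)
      let z := pullback.snd (a j) (r ≫ v)
      have H₁ : IsPullback x r (a i) u := IsPullback.of_hasPullback (a i) u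
      have H₂ : IsPullback y z (a j) (r ≫ v) := IsPullback.of_hasPullback (a j) (r ≫ v)
      have hxr := H₁.w
      have hyz := H₂.w
      have : Mono (a i) := h.mono_of_clopens (ha i)
      have : Mono (a j) := h.mono_of_clopens (ha j)
      have hext : ∀ {T : C} (s t : T ⟶ pullback (a j) (r ≫ v)), s ≫ z ≫ r = t ≫ z ≫ r → s = t := by
        intro T s t e
        refine H₂.hom_ext ?_ (H₁.hom_ext ?_ ?_)
        · rw [← cancel_mono (a j), Category.assoc, Category.assoc, hyz, reassoc_of% e]
        · rw [← cancel_mono (a i)]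
          simp only [Category.assoc]
          rw [hxr, reassoc_of% e]
        · simpa using e
      -- The part of `R` with ends in `V i` and `V j` is étale over `V i`. Two of its elements with
      -- the same first end have related second ends, equal by the choice of `V j`; hence the
      -- projection is a monic étale arrow, that is, clopen.
      have : Mono (z ≫ x) := by
        refine ⟨fun {T} s t e => hext s t (hj.right_cancellation _ _ ?_ ?_)⟩
        · simp only [Category.assoc]
          rw [← hxr, reassoc_of% e]
        · have e' : s ≫ z ≫ r ≫ u = t ≫ z ≫ r ≫ u := by
            rw [← hxr, reassoc_of% e]
          obtain ⟨l, l₁, l₂⟩ := et T (s ≫ z ≫ r ≫ es) (t ≫ z ≫ r) (by simpa [es₂] using e')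
          have := (haA j).2 T l (s ≫ y) (t ≫ y) (by simp [l₁, es₁, hyz]) (by simp [l₂, hyz])
          simp only [Category.assoc]
          rw [← hyz, reassoc_of% this]
      refine ⟨_, z ≫ x, y, ?_, ⟨z ≫ r, by simp [hxr], by simp [hyz]⟩, ?_⟩
      · refine h.clopens_of_etale_of_mono (h.etale_comp (h.etale_of_clopens
          (h.clopens_of_isPullback H₂ (ha j))) (h.etale_of_isPullback H₁.flip hu))
      · rintro T s t ⟨k, k₁, k₂⟩
        refine ⟨H₂.lift t (H₁.lift s k k₁.symm) (by simp [k₂]), ?_, ?_⟩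
        · simp
        · simp)
  obtain ⟨q, hq⟩ := exists_desc_of_family hA π fun i j W x y e =>
    (hρ _ _ _ _ _).2 ⟨x ≫ a i ≫ er, by simp [er₁], by simpa [er₂] using e⟩
  have hqe : etale τ q := by
    refine h.etale_of_cover (S := Presieve.ofArrows V a) ?_ hA ?_
    · rintro _ _ ⟨i⟩
      exact ha i
    · rintro _ _ ⟨i⟩
      rw [hq]
      exact h.etale_of_clopens (hπ i)
  have hloc : ∀ {T : C} (s t : T ⟶ X), (Sieve.ofArrows V a).pullback s ⊓
      (Sieve.ofArrows V a).pullback t ∈ τ.toGrothendieck T := fun s t =>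
    τ.toGrothendieck.intersection_covering (τ.toGrothendieck.pullback_stable s hA)
      (τ.toGrothendieck.pullback_stable t hA)
  have huv : u ≫ q = v ≫ q := by
    refine hom_ext_of_mem (hloc u v) ?_
    rintro T k ⟨⟨_, x, _, ⟨i⟩, ex⟩, ⟨_, y, _, ⟨j⟩, ey⟩⟩
    rw [← reassoc_of% ex, ← reassoc_of% ey, hq, hq]
    exact (hρ _ _ _ _ _).2 ⟨k, ex.symm, ey.symm⟩
  -- Effectivity: locally both points lie in pieces, where equality in `Q` means being related; the
  -- witnesses glue since `u, v` are jointly monic.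
  have hlift : ∀ {T : C} (s t : T ⟶ X), s ≫ q = t ≫ q → ∃ r : T ⟶ R, r ≫ u = s ∧ r ≫ v = t := by
    intro T s t e
    refine exists_jointLift_of_mem u v hj s t (hloc s t) ?_
    rintro W k ⟨⟨_, x, _, ⟨i⟩, ex⟩, ⟨_, y, _, ⟨j⟩, ey⟩⟩
    obtain ⟨r, h₁, h₂⟩ := (hρ i j W x y).1 (by
      rw [← hq, ← hq, reassoc_of% ex, reassoc_of% ey, e])
    exact ⟨r, h₁.trans ex, h₂.trans ey⟩
  refine ⟨Q, q, huv, hqe, ?_, ?_⟩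
  · choose l l₁ l₂ using @hlift
    exact ⟨⟨huv⟩, ⟨PullbackCone.IsLimit.mk _ (fun s => l s.fst s.snd s.condition)
      (fun s => l₁ _ _ _) (fun s => l₂ _ _ _)
      (fun s m h₁ h₂ => hj.right_cancellation _ _ (by rw [h₁, l₁]) (by rw [h₂, l₂]))⟩⟩
  · refine isUniversalColimit_of_cover (J := τ.toGrothendieck) _
      (fun _ : Unit => WalkingParallelPair.one) ?_ (fun _ _ T s t e => ?_) ?_
    · refine τ.toGrothendieck.superset_covering ?_ hQ
      rw [Sieve.generate_le_iff]
      rintro _ _ ⟨i⟩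
      exact (Sieve.mem_ofArrows_iff _ _ _).2 ⟨(), a i, (hq i).symm⟩
    · obtain ⟨r, h₁, h₂⟩ := hlift s t e
      exact .inr ⟨.zero, .left, .right, r, h₁, h₂⟩
    · rintro (_ | _)
      · exact ⟨(), ⟨.left⟩⟩
      · exact ⟨(), ⟨𝟙 _⟩⟩

end IsGluingPresite

end Colimits

end Glutos

namespace Glutos

/-! ### The small site of clopen subobjects, and base change of its members -/

section Basis

variable {C : Type v} [Category.{w} C]

/-- A `u`-small family of clopen subobjects of `X` containing, up to isomorphism, all of them. -/
structure ClopenBasis (τ : Precoverage C) (X : C) where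
  S : Type u
  obj : S → C
  hom : ∀ s, obj s ⟶ X
  clopen : ∀ s, clopens τ (hom s)
  exists_iso : ∀ ⦃V : C⦄ (a : V ⟶ X), clopens τ a → ∃ (s : S) (e : V ≅ obj s), e.hom ≫ hom s = a

variable {τ : Precoverage C} {X : C}

theorem IsGluingPresite.nonempty_clopenBasis (h : IsGluingPresite.{u} τ) (X : C) :
    Nonempty (ClopenBasis.{u} τ X) := by
  have := h.ng1 X
  refine ⟨⟨Shrink.{u} {A : Subobject X // clopens τ A.arrow},
    fun s => (((equivShrink _).symm s).1 : C), fun s => ((equivShrink _).symm s).1.arrow,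
    fun s => ((equivShrink _).symm s).2, fun V b hb => ?_⟩⟩
  have := h.mono_of_clopens hb
  have hA : clopens τ (Subobject.mk b).arrow := by
    rw [← Subobject.underlyingIso_hom_comp_eq_mk]
    exact h.clopens_comp (h.clopens_of_isIso _) hb
  refine ⟨equivShrink _ ⟨Subobject.mk b, hA⟩, ?_⟩
  suffices H : ∀ y : {A : Subobject X // clopens τ A.arrow}, y = ⟨Subobject.mk b, hA⟩ →
      ∃ e : V ≅ (y.1 : C), e.hom ≫ y.1.arrow = b from H _ (Equiv.symm_apply_apply _ _)
  rintro _ rfl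
  exact ⟨(Subobject.underlyingIso b).symm, by simp⟩

namespace ClopenBasis

instance (B : ClopenBasis.{u} τ X) : Preorder B.S where
  le s t := ∃ m : B.obj s ⟶ B.obj t, m ≫ B.hom t = B.hom s
  le_refl s := ⟨𝟙 _, by simp⟩
  le_trans s t r := by
    rintro ⟨m, hm⟩ ⟨n, hn⟩
    exact ⟨m ≫ n, by rw [Category.assoc, hn, hm]⟩

variable (B : ClopenBasis.{u} τ X)

/-- The inclusion of a clopen subobject into a larger one. -/
noncomputable def res {s t : B.S} (hst : s ≤ t) : B.obj s ⟶ B.obj t :=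
  hst.choose

theorem res_hom {s t : B.S} (hst : s ≤ t) : B.res hst ≫ B.hom t = B.hom s :=
  hst.choose_spec

variable (h : IsGluingPresite.{u} τ)

include h

theorem mono_hom (s : B.S) : Mono (B.hom s) :=
  h.mono_of_clopens (B.clopen s)

theorem res_unique {s t : B.S} (hst : s ≤ t) (m : B.obj s ⟶ B.obj t)
    (hm : m ≫ B.hom t = B.hom s) : m = B.res hst := by
  have := B.mono_hom h t
  rw [← cancel_mono (B.hom t), hm, res_hom]

theorem res_self (s : B.S) (hs : s ≤ s) : B.res hs = 𝟙 _ :=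
  (B.res_unique h hs (𝟙 _) (by simp)).symm

theorem res_comp {r s t : B.S} (hrs : r ≤ s) (hst : s ≤ t) :
    B.res hrs ≫ B.res hst = B.res (hrs.trans hst) :=
  B.res_unique h _ _ (by simp [res_hom])

theorem clopen_res {s t : B.S} (hst : s ≤ t) : clopens τ (B.res hst) := by
  have := B.mono_hom h t
  refine h.clopens_of_comp_mono (f := B.hom t) ?_
  rw [res_hom]
  exact B.clopen s

theorem exists_iso_res {V : C} {s : B.S} (a : V ⟶ B.obj s) (ha : clopens τ a) :
    ∃ (r : B.S) (hr : r ≤ s) (e : V ≅ B.obj r), e.hom ≫ B.res hr = a := by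
  obtain ⟨r, e, he⟩ := B.exists_iso (a ≫ B.hom s) (h.clopens_comp ha (B.clopen s))
  have hr : e.inv ≫ a ≫ B.hom s = B.hom r := by rw [← he]; simp
  refine ⟨r, ⟨e.inv ≫ a, by simpa using hr⟩, e, ?_⟩
  rw [← B.res_unique h _ (e.inv ≫ a) (by simpa using hr)]
  simp

/-- The member `r` represents the intersection. It is what makes the coverings of the site stable
under pullback. -/
theorem exists_inter (s t : B.S) : ∃ (r : B.S) (_ : r ≤ s) (_ : r ≤ t),
    ∀ (W : C) (p : W ⟶ B.obj s) (q : W ⟶ B.obj t), p ≫ B.hom s = q ≫ B.hom t →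
      ∃ m : W ⟶ B.obj r, m ≫ B.hom r = p ≫ B.hom s := by
  have := h.hasPullback (B.clopen s) (B.hom t)
  have H := IsPullback.of_hasPullback (B.hom s) (B.hom t)
  obtain ⟨r, hr, e, he⟩ := B.exists_iso_res h (pullback.fst (B.hom s) (B.hom t))
    (h.clopens_of_isPullback' H (B.clopen t))
  refine ⟨r, hr, ⟨e.inv ≫ pullback.snd _ _, ?_⟩, fun W p q hpq => ⟨H.lift p q hpq ≫ e.hom, ?_⟩⟩
  · rw [Category.assoc, ← pullback.condition, ← he]
    simp [res_hom]
  · rw [← B.res_hom hr, Category.assoc, reassoc_of% he]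
    simp

/-- The sections of an étale arrow over clopen subobjects are clopen. -/
theorem clopen_section {W : C} {p : W ⟶ X} (hp : etale τ p) {s : B.S} (a : B.obj s ⟶ W)
    (ha : a ≫ p = B.hom s) : clopens τ a := by
  have := B.mono_hom h s
  rw [← ha] at this
  have := mono_of_mono a p
  refine h.clopens_of_etale_of_mono (h.etale_of_postcomp (f := p) ?_ hp)
  rw [ha]
  exact h.etale_of_clopens (B.clopen s)

omit h in
-- A piece of `W` that is clopen over `X` is isomorphic to a member of the basis, so its inclusion
-- amounts to a section of `p` over that member.
theorem sections_mem {W : C} {p : W ⟶ X} (hp : etale τ p) :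
    Sieve.ofArrows (fun x : Σ s : B.S, {a : B.obj s ⟶ W // a ≫ p = B.hom s} => B.obj x.1)
      (fun x => x.2.1) ∈ τ.toGrothendieck W := by
  refine τ.toGrothendieck.superset_covering ?_ hp
  rw [Sieve.generate_le_iff]
  rintro V a ha
  obtain ⟨s, e, he⟩ := B.exists_iso (a ≫ p) ha.2
  exact (Sieve.mem_ofArrows_iff _ _ _).2 ⟨⟨s, e.inv ≫ a, by simp [← he]⟩, e.hom, by simp⟩

omit h in
/-- The sink in `C` defined by a sieve on an element of the basis. -/
def sink {s : B.S} (R : Sieve s) : Presieve (B.obj s) :=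
  Presieve.ofArrows (fun x : {r : B.S // ∃ f : r ⟶ s, R f} => B.obj x.1)
    (fun x => B.res x.2.choose.le)

omit h in
theorem sink_res {s r : B.S} {R : Sieve s} (hr : r ≤ s) (hR : R (homOfLE hr)) :
    B.sink R (B.res hr) :=
  Presieve.ofArrows.mk (f := fun x : {r : B.S // ∃ f : r ⟶ s, R f} => B.res x.2.choose.le)
    ⟨r, homOfLE hr, hR⟩

omit h in
theorem generate_sink_iff {s : B.S} {R : Sieve s} {W : C} (k : W ⟶ B.obj s) :
    Sieve.generate (B.sink R) k ↔ ∃ (r : B.S) (hr : r ≤ s) (m : W ⟶ B.obj r),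
      R (homOfLE hr) ∧ m ≫ B.res hr = k := by
  constructor
  · rintro ⟨_, m, _, ⟨⟨r, f, hf⟩⟩, rfl⟩
    exact ⟨r, _, m, hf, rfl⟩
  · rintro ⟨r, hr, m, hR, rfl⟩
    exact ⟨_, m, _, B.sink_res hr hR, rfl⟩

/-- The topology of the site of clopen subobjects of `X`. -/
def topology : GrothendieckTopology B.S where
  sieves s := {R | Sieve.generate (B.sink R) ∈ τ.toGrothendieck (B.obj s)}
  top_mem' s := by
    refine τ.toGrothendieck.superset_covering ?_ (τ.toGrothendieck.top_mem _)
    intro W k _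
    exact (B.generate_sink_iff k).2 ⟨s, le_rfl, k, trivial, by simp [B.res_self h]⟩
  pullback_stable' s t R f hR := by
    refine τ.toGrothendieck.superset_covering ?_
      (τ.toGrothendieck.pullback_stable (B.res f.le) hR)
    intro W k hk
    obtain ⟨r, hr, m, hR, e⟩ := (B.generate_sink_iff _).1 hk
    obtain ⟨r', h₁, h₂, H⟩ := B.exists_inter h r t
    have e' : m ≫ B.hom r = k ≫ B.hom t := by
      rw [← B.res_hom hr, reassoc_of% e, B.res_hom]
    obtain ⟨l, hl⟩ := H W m k e'
    refine (B.generate_sink_iff _).2 ⟨r', h₂, l, R.downward_closed hR (homOfLE h₁), ?_⟩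
    have := B.mono_hom h t
    rw [← cancel_mono (B.hom t), Category.assoc, B.res_hom, hl, e']
  transitive' s R hR R' H := by
    refine transitive_generate hR _ ?_
    rintro _ _ ⟨⟨r, f, hf⟩⟩
    refine τ.toGrothendieck.superset_covering ?_ (H hf)
    intro W k hk
    obtain ⟨r', hr', m, hm, rfl⟩ := (B.generate_sink_iff _).1 hk
    refine (B.generate_sink_iff _).2 ⟨r', hr'.trans f.le, m, hm, ?_⟩
    rw [Category.assoc, B.res_comp h]

theorem mem_topology_iff {s : B.S} (R : Sieve s) :
    R ∈ B.topology h s ↔ Sieve.generate (B.sink R) ∈ τ.toGrothendieck (B.obj s) := Iff.rfl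

end ClopenBasis

/-- A choice of inverse images of the members of the basis `B` along `f`. -/
structure BaseChange (B : ClopenBasis.{u} τ X) {X' : C} (f : X' ⟶ X) where
  P : B.S → C
  q : ∀ s, P s ⟶ B.obj s
  π : ∀ s, P s ⟶ X'
  isPullback : ∀ s, IsPullback (q s) (π s) (B.hom s) f

/-- The inverse image along the identity. -/
def BaseChange.id (B : ClopenBasis.{u} τ X) : BaseChange B (𝟙 X) where
  P := B.obj
  q _ := 𝟙 _
  π := B.hom
  isPullback _ := IsPullback.of_horiz_isIso ⟨by simp⟩

theorem IsPresite.nonempty_baseChange (h : IsPresite τ) (B : ClopenBasis.{u} τ X) {X' : C}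
    (f : X' ⟶ X) : Nonempty (BaseChange B f) := by
  have := fun s => h.hasPullback (B.clopen s) f
  exact ⟨⟨fun s => pullback (B.hom s) f, _, _, fun s => IsPullback.of_hasPullback _ _⟩⟩

namespace BaseChange

variable {B : ClopenBasis.{u} τ X} {X' : C} {f : X' ⟶ X} (D : BaseChange B f)

/-- The inverse image of an inclusion. -/
noncomputable def res {s t : B.S} (hst : s ≤ t) : D.P s ⟶ D.P t :=
  (D.isPullback t).lift (D.q s ≫ B.res hst) (D.π s) (by
    rw [Category.assoc, B.res_hom, (D.isPullback s).w])

@[simp]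
theorem res_q {s t : B.S} (hst : s ≤ t) : D.res hst ≫ D.q t = D.q s ≫ B.res hst :=
  (D.isPullback t).lift_fst _ _ _

@[simp]
theorem res_q_assoc {s t : B.S} (hst : s ≤ t) {T : C} (k : B.obj t ⟶ T) :
    D.res hst ≫ D.q t ≫ k = D.q s ≫ B.res hst ≫ k := by
  rw [← Category.assoc, res_q, Category.assoc]

@[simp]
theorem res_π {s t : B.S} (hst : s ≤ t) : D.res hst ≫ D.π t = D.π s :=
  (D.isPullback t).lift_snd _ _ _

theorem id_res {s t : B.S} (hst : s ≤ t) : (id B).res hst = B.res hst := by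
  exact (Category.comp_id _).symm.trans (((id B).res_q hst).trans (Category.id_comp _))

/-- The inverse image of a section. -/
noncomputable def lift {W W' : C} {p : W ⟶ X} {q' : W' ⟶ W} {p' : W' ⟶ X'}
    (H : IsPullback q' p' p f) {s : B.S} (a : B.obj s ⟶ W) (ha : a ≫ p = B.hom s) : D.P s ⟶ W' :=
  H.lift (D.q s ≫ a) (D.π s) (by rw [Category.assoc, ha, (D.isPullback s).w])

section

variable {W W' : C} {p : W ⟶ X} {q' : W' ⟶ W} {p' : W' ⟶ X'} (H : IsPullback q' p' p f)

@[simp]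
theorem lift_q {s : B.S} (a : B.obj s ⟶ W) (ha : a ≫ p = B.hom s) :
    D.lift H a ha ≫ q' = D.q s ≫ a :=
  H.lift_fst _ _ _

@[simp]
theorem lift_q_assoc {s : B.S} (a : B.obj s ⟶ W) (ha : a ≫ p = B.hom s) {T : C} (k : W ⟶ T) :
    D.lift H a ha ≫ q' ≫ k = D.q s ≫ a ≫ k := by
  rw [← Category.assoc, lift_q, Category.assoc]

@[simp]
theorem lift_π {s : B.S} (a : B.obj s ⟶ W) (ha : a ≫ p = B.hom s) :
    D.lift H a ha ≫ p' = D.π s :=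
  H.lift_snd _ _ _

theorem res_lift {s t : B.S} (hst : s ≤ t) (a : B.obj t ⟶ W) (ha : a ≫ p = B.hom t) :
    D.res hst ≫ D.lift H a ha = D.lift H (B.res hst ≫ a) (by rw [Category.assoc, ha, B.res_hom]) :=
  H.hom_ext (by simp) (by simp)

/-- By cancellation from the cartesian squares over `f`. Hence a covering of `W` by sections pulls
back to a covering of `W'` by their inverse images. -/
theorem isPullback_lift {s : B.S} (a : B.obj s ⟶ W) (ha : a ≫ p = B.hom s) :
    IsPullback (D.lift H a ha) (D.q s) q' a := by
  refine (IsPullback.of_right (h₁₁ := D.lift H a ha) (h₁₂ := p') (v₁₁ := D.q s) (v₁₂ := q')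
    (h₂₁ := a) (h₂₂ := p) (v₁₃ := f) ?_ (by simp) H.flip)
  simpa [ha] using (D.isPullback s).flip

end

variable (h : IsGluingPresite.{u} τ)

include h

theorem res_self (s : B.S) (hs : s ≤ s) : D.res hs = 𝟙 _ :=
  (D.isPullback s).hom_ext (by simp [B.res_self h]) (by simp)

theorem res_comp {r s t : B.S} (hrs : r ≤ s) (hst : s ≤ t) :
    D.res hrs ≫ D.res hst = D.res (hrs.trans hst) :=
  (D.isPullback t).hom_ext (by simp [B.res_comp h]) (by simp)

variable {W W' : C} {p : W ⟶ X} {q' : W' ⟶ W} {p' : W' ⟶ X'} (H : IsPullback q' p' p f)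

omit h in
theorem lift_mem {I : Type*} (s : I → B.S) (a : ∀ i, B.obj (s i) ⟶ W)
    (ha : ∀ i, a i ≫ p = B.hom (s i))
    (hc : Sieve.ofArrows (fun i => B.obj (s i)) a ∈ τ.toGrothendieck W) :
    Sieve.ofArrows (fun i => D.P (s i)) (fun i => D.lift H (a i) (ha i)) ∈
      τ.toGrothendieck W' :=
  ofArrows_mem_of_isPullback hc q' _ (fun i => D.q (s i)) fun _ => D.isPullback_lift H _ _

/-- Arrows out of the inverse image of `W` can be glued from their restrictions to the inverse
images of sections of `W`. -/
theorem exists_desc (hp : etale τ p) {I : Type*} (s : I → B.S) (a : ∀ i, B.obj (s i) ⟶ W)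
    (ha : ∀ i, a i ≫ p = B.hom (s i))
    (hc : Sieve.ofArrows (fun i => B.obj (s i)) a ∈ τ.toGrothendieck W) {T : C}
    (e : ∀ i, D.P (s i) ⟶ T)
    (he : ∀ (i j : I) (r : B.S) (hi : r ≤ s i) (hj : r ≤ s j),
      B.res hi ≫ a i = B.res hj ≫ a j → D.res hi ≫ e i = D.res hj ≫ e j) :
    ∃ d : W' ⟶ T, ∀ i, D.lift H (a i) (ha i) ≫ d = e i := by
  have := h.subcanonical
  refine exists_desc_of_family (D.lift_mem H s a ha hc) e fun i j T x y exy => ?_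
  have hcl : ∀ i, clopens τ (a i) := fun i => B.clopen_section h hp (a i) (ha i)
  have := h.hasPullback (hcl i) (a j)
  have HV := IsPullback.of_hasPullback (a i) (a j)
  -- The overlap of two sections is clopen, hence a member `r` of the basis below both; any point
  -- common to their inverse images factors through the inverse image of `r`.
  obtain ⟨r, hr, ε, hε⟩ := B.exists_iso_res h (pullback.fst (a i) (a j))
    (h.clopens_of_isPullback' HV (hcl j))
  have h₁ : (ε.inv ≫ pullback.snd (a i) (a j)) ≫ a j = B.res hr ≫ a i := by
    rw [Category.assoc, ← pullback.condition, ← hε]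
    simp
  have h₂ : (ε.inv ≫ pullback.snd (a i) (a j)) ≫ B.hom (s j) = B.hom r := by
    rw [← ha, ← Category.assoc, h₁, Category.assoc, ha, B.res_hom]
  have hr' : r ≤ s j := ⟨_, h₂⟩
  have h₃ := B.res_unique h hr' _ h₂
  have hxy : (x ≫ D.q (s i)) ≫ a i = (y ≫ D.q (s j)) ≫ a j := by
    have := congrArg (· ≫ q') exy
    simpa using this
  have hπ : x ≫ D.π (s i) = y ≫ D.π (s j) := by
    have := congrArg (· ≫ p') exy
    simpa using this
  have l₁ : (HV.lift _ _ hxy ≫ ε.hom) ≫ B.res hr = x ≫ D.q (s i) := by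
    rw [Category.assoc, hε, HV.lift_fst]
  have l₂ : (HV.lift _ _ hxy ≫ ε.hom) ≫ B.res hr' = y ≫ D.q (s j) := by
    rw [← h₃]
    simp
  generalize HV.lift _ _ hxy ≫ ε.hom = l at l₁ l₂
  have hm : l ≫ B.hom r = (x ≫ D.π (s i)) ≫ f := by
    rw [← B.res_hom hr, reassoc_of% l₁, (D.isPullback _).w, Category.assoc]
  have e₁ : (D.isPullback r).lift _ _ hm ≫ D.res hr = x :=
    (D.isPullback _).hom_ext (by simp [l₁]) (by simp)
  have e₂ : (D.isPullback r).lift _ _ hm ≫ D.res hr' = y :=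
    (D.isPullback _).hom_ext (by simp [l₂]) (by simp [hπ])
  rw [← e₁, ← e₂, Category.assoc, Category.assoc, he i j r hr hr' (by rw [← h₁, ← h₃])]

theorem hom_ext_sections (hp : etale τ p) {T : C} {x y : W' ⟶ T}
    (hxy : ∀ (s : B.S) (a : B.obj s ⟶ W) (ha : a ≫ p = B.hom s),
      D.lift H a ha ≫ x = D.lift H a ha ≫ y) : x = y := by
  have := h.subcanonical
  exact hom_ext_of_family (D.lift_mem H _ _ (fun x => x.2.2) (B.sections_mem hp))
    fun x => hxy _ x.2.1 x.2.2

theorem exists_desc_sections (hp : etale τ p) {T : C}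
    (e : ∀ (s : B.S) (a : B.obj s ⟶ W), a ≫ p = B.hom s → (D.P s ⟶ T))
    (he : ∀ (r s : B.S) (hr : r ≤ s) (a : B.obj s ⟶ W) (ha : a ≫ p = B.hom s),
      D.res hr ≫ e s a ha = e r (B.res hr ≫ a) (by rw [Category.assoc, ha, B.res_hom])) :
    ∃ d : W' ⟶ T, ∀ (s : B.S) (a : B.obj s ⟶ W) (ha : a ≫ p = B.hom s),
      D.lift H a ha ≫ d = e s a ha := by
  obtain ⟨d, hd⟩ := D.exists_desc h H hp _ _ (fun x => x.2.2) (B.sections_mem hp)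
    (fun x => e x.1 x.2.1 x.2.2) fun i j r hi hj hij => by
      rw [he, he]
      congr 1
  exact ⟨d, fun s a ha => hd ⟨s, a, ha⟩⟩

end BaseChange

end Basis

end Glutos

namespace Glutos

/-! ### Sheaves of sections and étalé spaces -/

section Sections

open Opposite

variable {C : Type v} [Category.{w} C]

/-- Allows sections to be shrunk, so that they form presheaves valued in `Type u`. -/
theorem IsUCategory.locallySmall (h : IsUCategory.{u} C) : LocallySmall.{u} C := by
  obtain ⟨S, _, ⟨e⟩⟩ := h
  exact locallySmall_of_faithful e.functor

variable {τ : Precoverage C} {X : C}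

namespace BaseChange

variable {B : ClopenBasis.{u} τ X} {X' : C} {f : X' ⟶ X} (D : BaseChange B f)
  (h : IsGluingPresite.{u} τ) [LocallySmall.{u} C]

/-- The sections of `z` over the inverse images of the clopen subobjects of the basis. -/
noncomputable def sections {Z : C} (z : Z ⟶ X') : B.Sᵒᵖ ⥤ Type u where
  obj s := Shrink.{u} {e : D.P s.unop ⟶ Z // e ≫ z = D.π s.unop}
  map {s t} g := ↾fun x => equivShrink _ ⟨D.res g.unop.le ≫ ((equivShrink _).symm x).1, by
    rw [Category.assoc, ((equivShrink _).symm x).2, res_π]⟩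
  map_id s := by
    ext x
    simp [D.res_self h]
  map_comp g g' := by
    ext x
    simp [← D.res_comp h g'.unop.le g.unop.le]

variable {Z : C} (z : Z ⟶ X')

/-- The arrow defined by an element of the presheaf of sections. -/
noncomputable def sectionHom {s : B.S} (x : (D.sections h z).obj (op s)) : D.P s ⟶ Z :=
  ((equivShrink _).symm x).1

@[simp]
theorem sectionHom_comp {s : B.S} (x : (D.sections h z).obj (op s)) :
    D.sectionHom h z x ≫ z = D.π s :=
  ((equivShrink _).symm x).2

theorem sectionHom_injective {s : B.S} {x y : (D.sections h z).obj (op s)}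
    (hxy : D.sectionHom h z x = D.sectionHom h z y) : x = y :=
  (equivShrink _).symm.injective (Subtype.ext hxy)

/-- The element of the presheaf of sections defined by an arrow. -/
noncomputable def mkSection {s : B.S} (e : D.P s ⟶ Z) (he : e ≫ z = D.π s) :
    (D.sections h z).obj (op s) :=
  equivShrink _ ⟨e, he⟩

@[simp]
theorem sectionHom_mkSection {s : B.S} (e : D.P s ⟶ Z) (he : e ≫ z = D.π s) :
    D.sectionHom h z (D.mkSection h z e he) = e := by
  simp [sectionHom, mkSection]

@[simp]
theorem sectionHom_map {s t : B.S} (g : op t ⟶ op s) (x : (D.sections h z).obj (op t)) :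
    D.sectionHom h z ((D.sections h z).map g x) = D.res g.unop.le ≫ D.sectionHom h z x := by
  exact congrArg Subtype.val (Equiv.symm_apply_apply _ _)

/-- Inverse images of a covering of `B.obj s` cover `D.P s`, and arrows glue along coverings by
subcanonicity. -/
theorem isSheaf_sections : Presieve.IsSheaf (B.topology h) (D.sections h z) := by
  intro s R hR x hx
  rw [Presieve.compatible_iff_sieveCompatible] at hx
  have hres : ∀ {r : B.S} (hr : r ≤ s), D.lift (D.isPullback s) (B.res hr) (B.res_hom hr) =
      D.res hr := fun hr => (D.isPullback s).hom_ext (by simp) (by simp)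
  have := h.subcanonical
  obtain ⟨d, hd⟩ := D.exists_desc h (D.isPullback s) (h.etale_of_clopens (B.clopen s))
    (fun i : {r : B.S // ∃ f : r ⟶ s, R f} => i.1) (fun i => B.res i.2.choose.le)
    (fun i => B.res_hom _) hR (fun i => D.sectionHom h z (x _ i.2.choose_spec))
    (fun i j r hi hj _ => by
      have e₁ := hx i.2.choose (homOfLE hi) i.2.choose_spec
      have e₂ := hx j.2.choose (homOfLE hj) j.2.choose_spec
      have e₃ := congrArg (D.sectionHom h z) e₁
      have e₄ := congrArg (D.sectionHom h z) e₂
      rw [sectionHom_map] at e₃ e₄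
      exact e₃.symm.trans e₄)
  have hcov := D.lift_mem (D.isPullback s) (fun i : {r : B.S // ∃ f : r ⟶ s, R f} => i.1)
    (fun i => B.res i.2.choose.le) (fun i => B.res_hom _) hR
  simp only [hres] at hd hcov
  refine ⟨D.mkSection h z d (hom_ext_of_family hcov fun i => ?_), fun r g hg => ?_, fun y hy => ?_⟩
  · rw [reassoc_of% hd]
    simp
  · refine D.sectionHom_injective h z ?_
    rw [sectionHom_map, sectionHom_mkSection]
    refine (hd ⟨r, ⟨g, hg⟩⟩).trans (congrArg (D.sectionHom h z) ?_)
    congr 1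
    exact Subsingleton.elim _ _
  · refine D.sectionHom_injective h z (hom_ext_of_family hcov fun i => ?_)
    rw [sectionHom_mkSection, hd, ← hy _ i.2.choose_spec, sectionHom_map]

end BaseChange

/-- Sheaves on the site of clopen subobjects are sheaves of sections of étale arrows. -/
theorem ClopenBasis.exists_etale (B : ClopenBasis.{u} τ X) (h : IsGluingPresite.{u} τ)
    (F : B.Sᵒᵖ ⥤ Type u) (hF : Presieve.IsSheaf (B.topology h) F) :
    ∃ (V : C) (p : V ⟶ X) (σ : ∀ s, F.obj (op s) → (B.obj s ⟶ V)), etale τ p ∧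
      (∀ s x, σ s x ≫ p = B.hom s) ∧
      (∀ r s (hr : r ≤ s) x, B.res hr ≫ σ s x = σ r (F.map (homOfLE hr).op x)) ∧
      (∀ s, Function.Injective (σ s)) ∧
      ∀ s (a : B.obj s ⟶ V), a ≫ p = B.hom s → ∃ x, σ s x = a := by
  have := h.subcanonical
  have hmono := B.mono_hom h
  let rs : ∀ {r s : B.S}, r ≤ s → F.obj (op s) → F.obj (op r) :=
    fun hr x => F.map (homOfLE hr).op x
  have rs_rs : ∀ {r s t : B.S} (hr : r ≤ s) (hs : s ≤ t) (x), rs hr (rs hs x) = rs (hr.trans hs) x :=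
    fun hr hs x => (Functor.map_comp_apply F (homOfLE hs).op (homOfLE hr).op x).symm
  have rs_self : ∀ {s : B.S} (hs : s ≤ s) x, rs hs x = x := fun hs x => by
    simp [rs]
  -- The étalé space: one copy of `B.obj s` for each `x ∈ F s`, two copies being identified at a
  -- point with a neighbourhood `r` on which their elements have equal restrictions.
  obtain ⟨V, π, hπ, hV, hρ⟩ := h.exists_glue (fun i : Σ s : B.S, F.obj (op s) => B.obj i.1)
    (fun i j T a b => ∃ (r : B.S) (h₁ : r ≤ i.1) (h₂ : r ≤ j.1) (m : T ⟶ B.obj r),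
      m ≫ B.res h₁ = a ∧ m ≫ B.res h₂ = b ∧ rs h₁ i.2 = rs h₂ j.2)
    (fun i T a => ⟨i.1, le_rfl, le_rfl, a, by simp [B.res_self h], by simp [B.res_self h], rfl⟩)
    (by
      rintro i j T a b ⟨r, h₁, h₂, m, e₁, e₂, e⟩
      exact ⟨r, h₂, h₁, m, e₂, e₁, e.symm⟩)
    (by
      rintro i j k T a b c ⟨r, h₁, h₂, m, rfl, rfl, e⟩ ⟨r', h₁', h₂', m', em, rfl, e'⟩
      have emm : m ≫ B.hom r = m' ≫ B.hom r' := by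
        rw [← B.res_hom h₂, ← B.res_hom h₁', reassoc_of% em]
      obtain ⟨t, l₁, l₂, ht⟩ := B.exists_inter h r r'
      obtain ⟨n, hn⟩ := ht T m m' emm
      refine ⟨t, l₁.trans h₁, l₂.trans h₂', n, ?_, ?_, ?_⟩
      · rw [← cancel_mono (B.hom _)]
        simp [B.res_hom, hn]
      · rw [← cancel_mono (B.hom _)]
        simp [B.res_hom, hn, emm]
      · rw [← rs_rs l₁ h₁, e, rs_rs, ← rs_rs l₂ h₂', ← e', rs_rs])
    (by
      rintro i j T a b T' t ⟨r, h₁, h₂, m, rfl, rfl, e⟩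
      exact ⟨r, h₁, h₂, t ≫ m, by simp, by simp, e⟩)
    (by
      rintro ⟨s, x⟩ ⟨t, y⟩
      let S : Presieve X := Presieve.ofArrows
        (fun r : {r : B.S // ∃ (h₁ : r ≤ s) (h₂ : r ≤ t), rs h₁ x = rs h₂ y} => B.obj r.1)
        (fun r => B.hom r.1)
      -- The overlap is the union `z'` of all `r` on which `x` and `y` agree; they agree on `z'`
      -- itself because `F` is separated.
      obtain ⟨Z, z, hz, hc, hl⟩ := h.exists_union S (by rintro _ _ ⟨r⟩; exact B.clopen _)
      obtain ⟨z', e, he⟩ := B.exists_iso z hz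
      have hZ : ∀ t', (∀ r : B.S, (∃ (h₁ : r ≤ s) (h₂ : r ≤ t), rs h₁ x = rs h₂ y) → r ≤ t') →
          z' ≤ t' := by
        intro t' ht'
        obtain ⟨l, hl⟩ := exists_lift_of_mem (B.hom t') z hc (by
          rintro W k ⟨_, m, _, ⟨r⟩, hm⟩
          exact ⟨m ≫ B.res (ht' r.1 r.2), by rw [Category.assoc, B.res_hom, hm]⟩)
        exact ⟨e.inv ≫ l, by rw [Category.assoc, hl, ← he]; simp⟩
      have h₁ : z' ≤ s := hZ s fun r hr => hr.choose
      have h₂ : z' ≤ t := hZ t fun r hr => hr.choose_spec.choose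
      have hS : ∀ r : B.S, (∃ (h₁ : r ≤ s) (h₂ : r ≤ t), rs h₁ x = rs h₂ y) → r ≤ z' := by
        intro r hr
        obtain ⟨l, hl⟩ := hl (B.hom r) (Presieve.ofArrows.mk
          (f := fun r : {r : B.S // ∃ (h₁ : r ≤ s) (h₂ : r ≤ t), rs h₁ x = rs h₂ y} =>
            B.hom r.1) ⟨r, hr⟩)
        exact ⟨l ≫ e.hom, by rw [Category.assoc, he, hl]⟩
      let R : Sieve z' :=
        { arrows := fun r _ => ∃ (h₁ : r ≤ s) (h₂ : r ≤ t), rs h₁ x = rs h₂ y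
          downward_closed := by
            rintro r r' f ⟨h₁, h₂, e⟩ g
            exact ⟨g.le.trans h₁, g.le.trans h₂, by rw [← rs_rs g.le h₁, e, rs_rs]⟩ }
      have hR : R ∈ B.topology h z' := by
        rw [B.mem_topology_iff]
        refine τ.toGrothendieck.superset_covering ?_ (τ.toGrothendieck.pullback_stable e.inv hc)
        rintro W k ⟨_, m, _, ⟨r⟩, hm⟩
        refine (B.generate_sink_iff _).2 ⟨r.1, hS r.1 r.2, m, r.2, ?_⟩
        rw [← cancel_mono (B.hom z'), Category.assoc, B.res_hom, hm, ← he]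
        simp
      have hxy : rs h₁ x = rs h₂ y := by
        refine (hF R hR).isSeparatedFor.ext fun r g hg => ?_
        obtain ⟨k₁, k₂, hk⟩ := hg
        exact (rs_rs g.le h₁ x).trans (hk.trans (rs_rs g.le h₂ y).symm)
      refine ⟨B.obj z', B.res h₁, B.res h₂, B.clopen_res h h₁,
        ⟨z', h₁, h₂, 𝟙 _, by simp, by simp, hxy⟩, ?_⟩
      rintro T a b ⟨r, k₁, k₂, m, rfl, rfl, hr⟩
      exact ⟨m ≫ B.res (hS r ⟨k₁, k₂, hr⟩), by simp [B.res_comp h], by simp [B.res_comp h]⟩)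
  obtain ⟨p, hp⟩ := exists_desc_of_family hV (fun i => B.hom i.1) (by
    rintro i j T a b e
    obtain ⟨r, h₁, h₂, m, rfl, rfl, -⟩ := (hρ _ _ _ _ _).1 e
    simp [B.res_hom])
  have hnat : ∀ r s (hr : r ≤ s) x, B.res hr ≫ π ⟨s, x⟩ = π ⟨r, rs hr x⟩ := by
    intro r s hr x
    have := (hρ ⟨s, x⟩ ⟨r, rs hr x⟩ _ (B.res hr) (𝟙 _)).2
      ⟨r, hr, le_rfl, 𝟙 _, by simp, by simp [B.res_self h], (rs_self _ _).symm⟩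
    simpa using this
  have hinj : ∀ s, Function.Injective (α := F.obj (op s)) (β := B.obj s ⟶ V)
      fun x => π ⟨s, x⟩ := by
    intro s x y hxy
    obtain ⟨r, h₁, h₂, m, e₁, -, e⟩ := (hρ ⟨s, x⟩ ⟨s, y⟩ _ (𝟙 _) (𝟙 _)).1 (by simpa using hxy)
    have hsr : s ≤ r := ⟨m, by rw [← B.res_hom h₁, reassoc_of% e₁]⟩
    rw [← rs_self le_rfl x, ← rs_self le_rfl y, ← rs_rs hsr h₁ x, ← rs_rs hsr h₂ y, e]
  refine ⟨V, p, fun s x => π ⟨s, x⟩, ?_, fun s x => hp _, hnat, hinj, fun s a ha => ?_⟩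
  · refine h.etale_of_cover (S := Presieve.ofArrows _ π) ?_ hV ?_
    · rintro _ _ ⟨i⟩
      exact hπ i
    · rintro _ _ ⟨i⟩
      rw [hp]
      exact h.etale_of_clopens (B.clopen _)
  -- The members over which the section `a` comes from an element of `F` form a covering sieve,
  -- since the copies cover `V`. By injectivity of `σ` these elements are compatible, and they glue.
  · let R : Sieve s :=
      { arrows := fun r g => ∃ x, π ⟨r, x⟩ = B.res g.le ≫ a
        downward_closed := by
          rintro r r' g ⟨x, hx⟩ g'
          exact ⟨rs g'.le x, by rw [← hnat, hx, ← Category.assoc, B.res_comp h]⟩ }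
    have hR : R ∈ B.topology h s := by
      rw [B.mem_topology_iff]
      refine τ.toGrothendieck.superset_covering ?_ (τ.toGrothendieck.pullback_stable a hV)
      rintro W k ⟨_, m, _, ⟨t, x⟩, hm⟩
      have := h.hasPullback (hπ ⟨t, x⟩) a
      have H := IsPullback.of_hasPullback (π ⟨t, x⟩) a
      obtain ⟨r, hr, e, he⟩ := B.exists_iso_res h (pullback.snd (π ⟨t, x⟩) a)
        (h.clopens_of_isPullback H (hπ _))
      have e₁ : e.inv ≫ pullback.snd (π ⟨t, x⟩) a = B.res hr := by rw [← he]; simp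
      have e₂ : (e.inv ≫ pullback.fst (π ⟨t, x⟩) a) ≫ π ⟨t, x⟩ = B.res hr ≫ a := by
        rw [Category.assoc, pullback.condition, reassoc_of% e₁]
      have e₃ : (e.inv ≫ pullback.fst (π ⟨t, x⟩) a) ≫ B.hom t = B.hom r := by
        rw [← hp ⟨t, x⟩, ← Category.assoc, e₂, Category.assoc, ha, B.res_hom]
      have hrt : r ≤ t := ⟨_, e₃⟩
      refine (B.generate_sink_iff _).2 ⟨r, hr, H.lift m k hm ≫ e.hom, ⟨rs hrt x, ?_⟩, ?_⟩
      · rw [← hnat, ← B.res_unique h hrt _ e₃, e₂]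
      · rw [Category.assoc, he, H.lift_snd]
    choose y hy using fun (r : B.S) (g : r ⟶ s) (hg : R g) => hg
    let y' : Presieve.FamilyOfElements F R.arrows := fun r g hg => y r g hg
    obtain ⟨x, hx, -⟩ := hF R hR y' (by
      rw [Presieve.compatible_iff_sieveCompatible]
      intro r r' g g' hg
      refine hinj _ ?_
      change π ⟨r', y r' (g' ≫ g) _⟩ = π ⟨r', rs g'.le (y r g hg)⟩
      rw [hy, ← hnat, hy, ← Category.assoc, B.res_comp h])
    refine ⟨x, hom_ext_of_mem ((B.mem_topology_iff h R).1 hR) fun W k hk => ?_⟩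
    obtain ⟨r, hr, m, hm, rfl⟩ := (B.generate_sink_iff _).1 hk
    rw [Category.assoc, Category.assoc, hnat]
    have e : rs hr x = y r (homOfLE hr) hm := hx (homOfLE hr) hm
    rw [e, hy]

end Sections

end Glutos

namespace Glutos

/-! ### Étale arrows over an object as sheaves, and direct images -/

section Topos

open Opposite

variable {C : Type v} [Category.{w} C] {τ : Precoverage C} {X : C}

/-- Base change along the identity specializes the results on sections over inverse images to
ordinary sections. -/
theorem BaseChange.id_lift {B : ClopenBasis.{u} τ X} {W : C} {p : W ⟶ X}
    (H : IsPullback (𝟙 W) p p (𝟙 X)) {s : B.S} (a : B.obj s ⟶ W) (ha : a ≫ p = B.hom s) :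
    (BaseChange.id B).lift H a ha = a :=
  (Category.comp_id _).symm.trans (((id B).lift_q H a ha).trans (Category.id_comp _))

namespace ClopenBasis

variable (B : ClopenBasis.{u} τ X) (h : IsGluingPresite.{u} τ)

include h

theorem hom_ext_sections {W T : C} {p : W ⟶ X} (hp : etale τ p) {x y : W ⟶ T}
    (hxy : ∀ (s : B.S) (a : B.obj s ⟶ W), a ≫ p = B.hom s → a ≫ x = a ≫ y) : x = y := by
  have H : IsPullback (𝟙 W) p p (𝟙 X) := IsPullback.of_horiz_isIso ⟨by simp⟩
  refine (BaseChange.id B).hom_ext_sections h H hp fun s a ha => ?_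
  rw [BaseChange.id_lift]
  exact hxy s a ha

theorem exists_desc_sections {W T : C} {p : W ⟶ X} (hp : etale τ p)
    (e : ∀ (s : B.S) (a : B.obj s ⟶ W), a ≫ p = B.hom s → (B.obj s ⟶ T))
    (he : ∀ (r s : B.S) (hr : r ≤ s) (a : B.obj s ⟶ W) (ha : a ≫ p = B.hom s),
      B.res hr ≫ e s a ha = e r (B.res hr ≫ a) (by rw [Category.assoc, ha, B.res_hom])) :
    ∃ d : W ⟶ T, ∀ (s : B.S) (a : B.obj s ⟶ W) (ha : a ≫ p = B.hom s), a ≫ d = e s a ha := by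
  have H : IsPullback (𝟙 W) p p (𝟙 X) := IsPullback.of_horiz_isIso ⟨by simp⟩
  obtain ⟨d, hd⟩ := (BaseChange.id B).exists_desc_sections h H hp e fun r s hr a ha => by
    rw [BaseChange.id_res]
    exact he r s hr a ha
  refine ⟨d, fun s a ha => ?_⟩
  have := hd s a ha
  rwa [BaseChange.id_lift] at this

variable [LocallySmall.{u} C]

/-- The presheaf of sections of `z` over the clopen subobjects of the basis. -/
noncomputable def sections {Z : C} (z : Z ⟶ X) : B.Sᵒᵖ ⥤ Type u :=
  (BaseChange.id B).sections h z

theorem isSheaf_sections {Z : C} (z : Z ⟶ X) : Presieve.IsSheaf (B.topology h) (B.sections h z) :=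
  (BaseChange.id B).isSheaf_sections h z

variable {Z : C} (z : Z ⟶ X)

/-- The arrow defined by an element of the presheaf of sections. -/
noncomputable def sectionHom {s : B.Sᵒᵖ} (x : (B.sections h z).obj s) : B.obj s.unop ⟶ Z :=
  (BaseChange.id B).sectionHom h z x

@[simp]
theorem sectionHom_comp {s : B.Sᵒᵖ} (x : (B.sections h z).obj s) :
    B.sectionHom h z x ≫ z = B.hom s.unop :=
  (BaseChange.id B).sectionHom_comp h z x

theorem sectionHom_injective {s : B.Sᵒᵖ} {x y : (B.sections h z).obj s}
    (hxy : B.sectionHom h z x = B.sectionHom h z y) : x = y :=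
  (BaseChange.id B).sectionHom_injective h z hxy

/-- The element of the presheaf of sections defined by an arrow. -/
noncomputable def mkSection {s : B.Sᵒᵖ} (e : B.obj s.unop ⟶ Z) (he : e ≫ z = B.hom s.unop) :
    (B.sections h z).obj s :=
  (BaseChange.id B).mkSection h z e he

@[simp]
theorem sectionHom_mkSection {s : B.Sᵒᵖ} (e : B.obj s.unop ⟶ Z) (he : e ≫ z = B.hom s.unop) :
    B.sectionHom h z (B.mkSection h z e he) = e :=
  (BaseChange.id B).sectionHom_mkSection h z e he

theorem mkSection_sectionHom {s : B.Sᵒᵖ} (x : (B.sections h z).obj s) :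
    B.mkSection h z (B.sectionHom h z x) (B.sectionHom_comp h z x) = x :=
  B.sectionHom_injective h z (B.sectionHom_mkSection h z _ _)

@[simp]
theorem sectionHom_map {s t : B.Sᵒᵖ} (g : s ⟶ t) (x : (B.sections h z).obj s) :
    B.sectionHom h z ((B.sections h z).map g x) = B.res g.unop.le ≫ B.sectionHom h z x := by
  rw [← BaseChange.id_res]
  exact (BaseChange.id B).sectionHom_map h z g x

omit z in
/-- The effect of an arrow over `X` on sections. -/
noncomputable def sectionsMap {Z' : C} {z : Z ⟶ X} {z' : Z' ⟶ X} (φ : Z ⟶ Z') (hφ : φ ≫ z' = z) :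
    B.sections h z ⟶ B.sections h z' where
  app s := ↾fun x => B.mkSection h z' (B.sectionHom h z x ≫ φ) (by
    rw [Category.assoc, hφ, B.sectionHom_comp])
  naturality s t g := by
    refine ConcreteCategory.hom_ext _ _ fun x => B.sectionHom_injective h _ ?_
    change B.sectionHom h z' (B.mkSection h z' _ _) =
      B.sectionHom h z' ((B.sections h z').map g (B.mkSection h z' _ _))
    rw [B.sectionHom_mkSection, B.sectionHom_map, B.sectionHom_mkSection, ← Category.assoc]
    exact congrArg (· ≫ φ) (B.sectionHom_map h z g x)

omit z in
@[simp]
theorem sectionHom_sectionsMap {Z' : C} {z : Z ⟶ X} {z' : Z' ⟶ X} (φ : Z ⟶ Z')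
    (hφ : φ ≫ z' = z) {s : B.Sᵒᵖ} (x : (B.sections h z).obj s) :
    B.sectionHom h z' ((B.sectionsMap h φ hφ).app s x) = B.sectionHom h z x ≫ φ :=
  B.sectionHom_mkSection h _ _ _

/-- The sheaf of sections of an étale arrow. -/
noncomputable def sectionsFunctor :
    (etale τ).Over ⊤ X ⥤ Sheaf (B.topology h) (Type u) where
  obj W := ⟨B.sections h W.hom, (isSheaf_iff_isSheaf_of_type _ _).2 (B.isSheaf_sections h W.hom)⟩
  map {W W'} φ := ObjectProperty.homMk
    (B.sectionsMap h φ.left (MorphismProperty.Over.w φ))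
  map_id W := by
    refine ObjectProperty.hom_ext _ (NatTrans.ext (funext fun s => ConcreteCategory.hom_ext _ _
      fun x => B.sectionHom_injective h _ ?_))
    exact (B.sectionHom_sectionsMap h _ (MorphismProperty.Over.w (𝟙 W)) x).trans
      (Category.comp_id _)
  map_comp {W W' W''} φ ψ := by
    refine ObjectProperty.hom_ext _ (NatTrans.ext (funext fun s => ConcreteCategory.hom_ext _ _
      fun x => B.sectionHom_injective h _ ?_))
    refine (B.sectionHom_sectionsMap h _ (MorphismProperty.Over.w (φ ≫ ψ)) x).trans
      (Eq.trans ?_ (B.sectionHom_sectionsMap h _ (MorphismProperty.Over.w ψ) _).symm)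
    exact (Category.assoc _ _ _).symm.trans
      (congrArg (· ≫ ψ.left) (B.sectionHom_sectionsMap h _ (MorphismProperty.Over.w φ) x).symm)

/-- Sections cover the source of an étale arrow, so arrows are determined by, and can be glued from,
their effect on sections. Every sheaf arises from its étalé space. -/
theorem isEquivalence_sectionsFunctor : (B.sectionsFunctor h).IsEquivalence where
  faithful := ⟨fun {W W'} φ ψ e => by
    ext
    refine B.hom_ext_sections h W.prop fun s a ha => ?_
    have e' := congrArg (fun k => B.sectionHom h W'.hom
      (k.hom.app (op s) (B.mkSection h W.hom (s := op s) a ha))) e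
    refine Eq.trans ?_ (e'.trans ?_)
    · exact ((B.sectionHom_sectionsMap h _ (MorphismProperty.Over.w φ) _).trans
        (by rw [B.sectionHom_mkSection])).symm
    · exact (B.sectionHom_sectionsMap h _ (MorphismProperty.Over.w ψ) _).trans
        (by rw [B.sectionHom_mkSection])⟩
  full := ⟨fun {W W'} α => by
    let α' : B.sections h W.hom ⟶ B.sections h W'.hom := α.hom
    obtain ⟨d, hd⟩ := B.exists_desc_sections h W.prop
      (fun s a ha => B.sectionHom h W'.hom
        (α'.app (op s) (B.mkSection h W.hom (s := op s) a ha))) fun r s hr a ha => by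
      refine (B.sectionHom_map h W'.hom (homOfLE hr).op _).symm.trans (congrArg _ ?_)
      refine (NatTrans.naturality_apply α' (homOfLE hr).op _).symm.trans (congrArg _ ?_)
      exact B.sectionHom_injective h _ (by simp)
    have hd' : d ≫ W'.hom = W.hom := by
      refine B.hom_ext_sections h W.prop fun s a ha => ?_
      rw [← Category.assoc, hd _ _ ha, ha, B.sectionHom_comp]
    refine ⟨MorphismProperty.Over.homMk d hd', ?_⟩
    refine ObjectProperty.hom_ext _ (NatTrans.ext (funext fun s => ConcreteCategory.hom_ext _ _
      fun x => B.sectionHom_injective h _ ?_))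
    refine (B.sectionHom_sectionsMap h d hd' x).trans ?_
    refine (hd s.unop _ (B.sectionHom_comp h _ _)).trans ?_
    exact congrArg (fun y => B.sectionHom h W'.hom (α'.app s y)) (B.mkSection_sectionHom h _ x)⟩
  essSurj := ⟨fun F => by
    obtain ⟨V, p, σ, hp, hσ, hres, hinj, hsurj⟩ := B.exists_etale h F.obj
      ((isSheaf_iff_isSheaf_of_type _ _).1 F.property)
    let α : F.obj ⟶ B.sections h p :=
      { app := fun s => ↾fun x => B.mkSection h p (s := s) (σ s.unop x) (hσ _ _)
        naturality := fun s t g => by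
          refine ConcreteCategory.hom_ext _ _ fun x => B.sectionHom_injective h _ ?_
          change B.sectionHom h p (B.mkSection h p _ _) =
            B.sectionHom h p ((B.sections h p).map g (B.mkSection h p _ _))
          rw [B.sectionHom_map, B.sectionHom_mkSection, B.sectionHom_mkSection, hres]
          rfl }
    have hα : ∀ s x, B.sectionHom h p (α.app s x) = σ s.unop x := fun s x =>
      B.sectionHom_mkSection h _ _ _
    have : IsIso α := by
      refine (NatTrans.isIso_iff_isIso_app α).2 fun s => (isIso_iff_bijective _).2 ⟨?_, ?_⟩
      · intro x y hxy
        refine hinj _ ?_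
        rw [← hα s x, ← hα s y]
        exact congrArg _ hxy
      · intro y
        obtain ⟨x, hx⟩ := hsurj s.unop (B.sectionHom h p y) (B.sectionHom_comp h _ _)
        exact ⟨x, B.sectionHom_injective h _ ((hα s x).trans hx)⟩
    let e : F.obj ≅ B.sections h p := asIso α
    exact ⟨MorphismProperty.Over.mk ⊤ p hp, ⟨((fullyFaithfulSheafToPresheaf _ _).preimageIso
      (X := F) (Y := (B.sectionsFunctor h).obj (MorphismProperty.Over.mk ⊤ p hp)) e).symm⟩⟩⟩

end ClopenBasis

theorem IsGluingPresite.isUTopos (h : IsGluingPresite.{u} τ) (X : C) :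
    IsUTopos.{u} ((etale τ).Over ⊤ X) := by
  obtain ⟨B⟩ := h.nonempty_clopenBasis X
  have := h.isUCategory.locallySmall
  have := B.isEquivalence_sectionsFunctor h
  exact ⟨B.S, inferInstance, B.topology h, ⟨(B.sectionsFunctor h).asEquivalence⟩⟩

/-- The étale arrow over `X` which is the direct image along `f` of an arrow `z`. -/
theorem IsGluingPresite.exists_pushforward (h : IsGluingPresite.{u} τ) {X X' : C} (f : X' ⟶ X)
    {Z : C} (z : Z ⟶ X') :
    ∃ (V : C) (p : V ⟶ X), etale τ p ∧
      ∀ (V' : C) (q' : V' ⟶ V) (p' : V' ⟶ X'), IsPullback q' p' p f →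
        ∃ ε : V' ⟶ Z, ε ≫ z = p' ∧
          ∀ (W W' : C) (w : W ⟶ X) (r : W' ⟶ W) (t : W' ⟶ X'), etale τ w → IsPullback r t w f →
            (∀ (β β' : W ⟶ V) (b b' : W' ⟶ V'), β ≫ p = w → β' ≫ p = w → b ≫ q' = r ≫ β →
              b ≫ p' = t → b' ≫ q' = r ≫ β' → b' ≫ p' = t → b ≫ ε = b' ≫ ε → β = β') ∧
            ∀ γ : W' ⟶ Z, γ ≫ z = t → ∃ β : W ⟶ V, β ≫ p = w ∧
              ∀ b : W' ⟶ V', b ≫ q' = r ≫ β → b ≫ p' = t → b ≫ ε = γ := by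
  obtain ⟨B⟩ := h.nonempty_clopenBasis X
  have := h.isUCategory.locallySmall
  obtain ⟨D⟩ := h.nonempty_baseChange B f
  -- A section of `V` over `s` is a section of `z` over the inverse image of `s` under `f`.
  obtain ⟨V, p, σ, hp, hσ, hres, hinj, hsurj⟩ := B.exists_etale h (D.sections h z)
    (D.isSheaf_sections h z)
  refine ⟨V, p, hp, fun V' q' p' HV => ?_⟩
  choose ξ hξ using hsurj
  have hξσ : ∀ s x, ξ s (σ s x) (hσ s x) = x := fun s x => hinj s (hξ _ _ _)
  -- The counit: on the inverse image of a section `a` of `V` it is the section of `z` that `a`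
  -- encodes.
  obtain ⟨ε, hε⟩ := D.exists_desc_sections h HV hp
    (fun s a ha => D.sectionHom h z (ξ s a ha)) fun r s hr a ha => by
      refine (D.sectionHom_map h z (homOfLE hr).op _).symm.trans (congrArg _ (hinj _ ?_))
      rw [← hres, hξ, hξ]
  refine ⟨ε, D.hom_ext_sections h HV hp fun s a ha => ?_, fun W W' w r t hw HW => ⟨?_, ?_⟩⟩
  · rw [← Category.assoc, hε, D.sectionHom_comp, D.lift_π]
  · intro β β' b b' hβ hβ' hb hb' hc hc' hbc
    have key : ∀ (β : W ⟶ V) (b : W' ⟶ V') (hβ : β ≫ p = w), b ≫ q' = r ≫ β → b ≫ p' = t →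
        ∀ (s : B.S) (a : B.obj s ⟶ W) (ha : a ≫ w = B.hom s),
          D.lift HW a ha ≫ b ≫ ε =
            D.sectionHom h z (ξ s (a ≫ β) (by rw [Category.assoc, hβ, ha])) := by
      intro β b hβ hb hb' s a ha
      have : D.lift HW a ha ≫ b = D.lift HV (a ≫ β) (by rw [Category.assoc, hβ, ha]) :=
        HV.hom_ext (by simp [hb]) (by simp [hb'])
      rw [← Category.assoc, this, hε]
    refine B.hom_ext_sections h hw fun s a ha => ?_
    have e := key β b hβ hb hb' s a ha
    rw [hbc, key β' b' hβ' hc hc' s a ha] at e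
    have e' := congrArg (σ s) (D.sectionHom_injective h z e)
    rw [hξ, hξ] at e'
    exact e'.symm
  · intro γ hγ
    -- The transpose of `γ` sends a section of `W` to the section of `V` encoding `γ` on its inverse
    -- image.
    obtain ⟨β, hβ⟩ := B.exists_desc_sections h hw (fun s a ha => σ s (D.mkSection h z
      (D.lift HW a ha ≫ γ) (by rw [Category.assoc, hγ, D.lift_π]))) fun r s hr a ha => by
        rw [hres]
        refine congrArg _ (D.sectionHom_injective h z ?_)
        rw [D.sectionHom_map, D.sectionHom_mkSection, D.sectionHom_mkSection, ← Category.assoc,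
          ← D.res_lift]
    have hβp : β ≫ p = w := B.hom_ext_sections h hw fun s a ha => by
      rw [← Category.assoc, hβ s a ha, hσ, ha]
    refine ⟨β, hβp, fun b hb hb' => D.hom_ext_sections h HW hw fun s a ha => ?_⟩
    have : D.lift HW a ha ≫ b = D.lift HV (σ s (D.mkSection h z
      (D.lift HW a ha ≫ γ) (by rw [Category.assoc, hγ, D.lift_π]))) (hσ _ _) :=
        HV.hom_ext (by simp [hb, hβ s a ha]) (by simp [hb'])
    rw [← Category.assoc, this, hε, hξσ, D.sectionHom_mkSection]

end Topos

end Glutos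

namespace Glutos

/-! ### Base change as the inverse image of a geometric morphism -/

section Over

variable {C : Type v} [Category.{w} C] {O : MorphismProperty C} {X : C}

/-- Pullback squares in `O/X` can be recognized in the ambient category. -/
theorem isPullback_over {P A B D : O.Over ⊤ X} {p : P ⟶ A} {q : P ⟶ B} {f : A ⟶ D} {g : B ⟶ D}
    (H : IsPullback p.left q.left f.left g.left) : IsPullback p q f g where
  w := by
    ext
    exact H.w
  isLimit' := ⟨PullbackCone.IsLimit.mk _
    (fun s => MorphismProperty.Over.homMk
      (H.lift s.fst.left s.snd.left (congrArg (fun k => k.left) s.condition)) (by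
        rw [← MorphismProperty.Over.w p, ← Category.assoc]
        exact (congrArg (· ≫ A.hom) (H.lift_fst _ _ _)).trans (MorphismProperty.Over.w s.fst)))
    (fun s => by
      ext
      exact H.lift_fst _ _ _)
    (fun s => by
      ext
      exact H.lift_snd _ _ _)
    (fun s m h₁ h₂ => by
      ext
      refine H.hom_ext ?_ ?_
      · exact (congrArg (fun k => k.left) h₁).trans (H.lift_fst _ _ _).symm
      · exact (congrArg (fun k => k.left) h₂).trans (H.lift_snd _ _ _).symm)⟩

/-- Base change of a pullback square over `Y` along an arrow `f : X ⟶ Y`. -/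
theorem isPullback_baseChange {Y : C} {f : X ⟶ Y} {P A B D P' A' B' D' : C} {d : D ⟶ Y}
    {p : P ⟶ A} {q : P ⟶ B} {a : A ⟶ D} {b : B ⟶ D} (H : IsPullback p q a b)
    {rP : P' ⟶ P} {tP : P' ⟶ X} (HP : IsPullback rP tP (p ≫ a ≫ d) f)
    {rA : A' ⟶ A} {tA : A' ⟶ X} (HA : IsPullback rA tA (a ≫ d) f)
    {rB : B' ⟶ B} {tB : B' ⟶ X} (HB : IsPullback rB tB (b ≫ d) f)
    {rD : D' ⟶ D} {tD : D' ⟶ X} (HD : IsPullback rD tD d f)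
    {p' : P' ⟶ A'} {q' : P' ⟶ B'} {a' : A' ⟶ D'} {b' : B' ⟶ D'}
    (hp : p' ≫ rA = rP ≫ p) (hp' : p' ≫ tA = tP) (hq : q' ≫ rB = rP ≫ q) (hq' : q' ≫ tB = tP)
    (ha : a' ≫ rD = rA ≫ a) (ha' : a' ≫ tD = tA) (hb : b' ≫ rD = rB ≫ b) (hb' : b' ≫ tD = tB) :
    IsPullback p' q' a' b' where
  w := by
    refine HD.hom_ext ?_ ?_
    · rw [Category.assoc, Category.assoc, ha, hb, reassoc_of% hp, reassoc_of% hq, H.w]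
    · rw [Category.assoc, Category.assoc, ha', hb', hp', hq']
  isLimit' := ⟨by
    have key : ∀ s : PullbackCone a' b', (s.fst ≫ rA) ≫ a = (s.snd ≫ rB) ≫ b := fun s => by
      rw [Category.assoc, Category.assoc, ← ha, ← hb, ← Category.assoc, s.condition,
        Category.assoc]
    have key' : ∀ s : PullbackCone a' b',
        H.lift _ _ (key s) ≫ p ≫ a ≫ d = (s.fst ≫ tA) ≫ f := fun s => by
      rw [← Category.assoc, H.lift_fst, Category.assoc, HA.w, Category.assoc]
    have key'' : ∀ s : PullbackCone a' b', s.fst ≫ tA = s.snd ≫ tB := fun s => by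
      rw [← ha', ← hb', ← Category.assoc, s.condition, Category.assoc]
    refine PullbackCone.IsLimit.mk _ (fun s => HP.lift _ _ (key' s)) (fun s => ?_) (fun s => ?_)
      (fun s m h₁ h₂ => ?_)
    · refine HA.hom_ext ?_ ?_
      · rw [Category.assoc, hp, ← Category.assoc, HP.lift_fst, H.lift_fst]
      · rw [Category.assoc, hp', HP.lift_snd]
    · refine HB.hom_ext ?_ ?_
      · rw [Category.assoc, hq, ← Category.assoc, HP.lift_fst, H.lift_snd]
      · rw [Category.assoc, hq', HP.lift_snd, key'']
    · refine HP.hom_ext (H.hom_ext ?_ ?_) ?_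
      · rw [HP.lift_fst, H.lift_fst, Category.assoc, ← hp, reassoc_of% h₁]
      · rw [HP.lift_fst, H.lift_snd, Category.assoc, ← hq, reassoc_of% h₂]
      · rw [HP.lift_snd, ← hp', reassoc_of% h₁]⟩

/-- Left cancellation puts arrows of `O/Y` in `O`, so pullbacks in `O/Y` exist and are those of the
ambient category. Terminal objects and pullbacks then suffice. -/
theorem preservesFiniteLimits_overPullback (hO : IsClopos O)
    (hO' : ∀ ⦃X Y Z : C⦄ (g : X ⟶ Y) (f : Y ⟶ Z), O (g ≫ f) → O f → O g) {Y : C} (f : X ⟶ Y) :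
    haveI := hO.hasPullbacks
    haveI := hO.isStableUnderBaseChange
    PreservesFiniteLimits (MorphismProperty.Over.pullback O ⊤ f) := by
  have := hO.hasPullbacks
  have := hO.isStableUnderBaseChange
  have := hO.isStableUnderComposition
  have hid : ∀ Z : C, O (𝟙 Z) := fun Z => hO.of_isIso _ inferInstance
  let terminal : ∀ Z : C, IsTerminal (MorphismProperty.Over.mk ⊤ (𝟙 Z) (hid Z) : O.Over ⊤ Z) :=
    fun Z => IsTerminal.ofUniqueHom (fun W => MorphismProperty.Over.homMk W.hom (Category.comp_id _))
      fun W m => by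
        ext
        exact (Category.comp_id _).symm.trans (MorphismProperty.Over.w m)
  have : HasTerminal (O.Over ⊤ Y) := (terminal Y).hasTerminal
  have pb : ∀ {A B D : O.Over ⊤ Y} (a : A ⟶ D) (b : B ⟶ D),
      ∃ (P : O.Over ⊤ Y) (p : P ⟶ A) (q : P ⟶ B), IsPullback p.left q.left a.left b.left := by
    intro A B D a b
    have hb : O b.left := hO' _ D.hom (by rw [MorphismProperty.Over.w]; exact B.prop) D.prop
    have := MorphismProperty.HasPullbacks.hasPullback (P := O) a.left hb
    have H := IsPullback.of_hasPullback b.left a.left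
    exact ⟨MorphismProperty.Over.mk ⊤ (pullback.snd b.left a.left ≫ A.hom)
      (O.comp_mem _ _ (O.of_isPullback H hb) A.prop),
      MorphismProperty.Over.homMk (pullback.snd _ _) rfl,
      MorphismProperty.Over.homMk (pullback.fst _ _) (by
        change pullback.fst b.left a.left ≫ B.hom = pullback.snd _ _ ≫ A.hom
        rw [← MorphismProperty.Over.w b, ← MorphismProperty.Over.w a, ← Category.assoc, H.w,
          Category.assoc]), H.flip⟩
  have : ∀ {A B D : O.Over ⊤ Y} {a : A ⟶ D} {b : B ⟶ D}, HasLimit (cospan a b) := by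
    intro A B D a b
    obtain ⟨P, p, q, H⟩ := pb a b
    exact (isPullback_over H).hasPullback
  have : HasPullbacks (O.Over ⊤ Y) := hasPullbacks_of_hasLimit_cospan _
  let F := MorphismProperty.Over.pullback O ⊤ f
  have : PreservesLimit (Functor.empty.{0} (O.Over ⊤ Y)) F := by
    refine preservesLimit_of_preserves_limit_cone (terminal Y)
      ((isLimitMapConeEmptyConeEquiv F _).symm ((terminal X).ofIso ?_))
    have : HasPullback (𝟙 Y) f := MorphismProperty.HasPullbacks.hasPullback f (hid Y)
    have : IsIso (pullback.snd (𝟙 Y) f) := inferInstance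
    exact MorphismProperty.Over.isoMk (asIso (pullback.snd (𝟙 Y) f)).symm
      (IsIso.inv_hom_id (pullback.snd (𝟙 Y) f))
  have : PreservesLimitsOfShape (Discrete.{0} PEmpty) F :=
    preservesLimitsOfShape_pempty_of_preservesTerminal F
  have hF : ∀ {A B D : O.Over ⊤ Y} (a : A ⟶ D) (b : B ⟶ D), PreservesLimit (cospan a b) F := by
    intro A B D a b
    obtain ⟨P, p, q, H⟩ := pb a b
    have H' := isPullback_over H
    refine preservesLimit_of_preserves_limit_cone H'.isLimit
      ((isLimitMapConePullbackConeEquiv F H'.w).symm ?_)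
    refine IsPullback.isLimit (isPullback_over ?_)
    have hP : ∀ W : O.Over ⊤ Y, IsPullback (pullback.fst W.hom f) (pullback.snd W.hom f) W.hom f :=
      fun W => by
        have := MorphismProperty.HasPullbacks.hasPullback (P := O) f W.prop
        exact IsPullback.of_hasPullback _ _
    have hw : p.left ≫ a.left ≫ D.hom = P.hom := by
      rw [MorphismProperty.Over.w, MorphismProperty.Over.w]
    have hF : ∀ {V W : O.Over ⊤ Y} (k : V ⟶ W),
        (F.map k).left ≫ pullback.fst W.hom f = pullback.fst V.hom f ≫ k.left := fun k => by
      rw [MorphismProperty.Over.pullback_map_left]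
      exact pullback.lift_fst _ _ _
    have hF' : ∀ {V W : O.Over ⊤ Y} (k : V ⟶ W),
        (F.map k).left ≫ pullback.snd W.hom f = pullback.snd V.hom f := fun k => by
      rw [MorphismProperty.Over.pullback_map_left]
      exact pullback.lift_snd _ _ _
    exact isPullback_baseChange H (by rw [hw]; exact hP P)
      (by rw [MorphismProperty.Over.w]; exact hP A)
      (by rw [MorphismProperty.Over.w]; exact hP B) (hP D)
      (hF p) (hF' p) (hF q) (hF' q) (hF a) (hF' a) (hF b) (hF' b)
  have : PreservesLimitsOfShape WalkingCospan F := ⟨fun {K} => by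
    have := hF (K.map WalkingCospan.Hom.inl) (K.map WalkingCospan.Hom.inr)
    exact preservesLimit_of_iso_diagram F (diagramIsoCospan K).symm⟩
  exact preservesFiniteLimits_of_preservesTerminal_and_pullbacks F

variable {τ : Precoverage C}

/-- The direct images of `exists_pushforward` are couniversal arrows, one for each object over `X`,
and these assemble into a right adjoint. -/
theorem IsGluingPresite.isLeftAdjoint_overPullback (h : IsGluingPresite.{u} τ) {Y : C}
    (f : X ⟶ Y) :
    haveI := h.isClopos_etale.hasPullbacks
    haveI := h.isClopos_etale.isStableUnderBaseChange
    (MorphismProperty.Over.pullback (etale τ) ⊤ f).IsLeftAdjoint := by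
  have := h.isClopos_etale.hasPullbacks
  have := h.isClopos_etale.isStableUnderBaseChange
  let F := MorphismProperty.Over.pullback (etale τ) ⊤ f
  have hP : ∀ W : (etale τ).Over ⊤ Y,
      IsPullback (pullback.fst W.hom f) (pullback.snd W.hom f) W.hom f :=
    fun W => by
      have := MorphismProperty.HasPullbacks.hasPullback (P := etale τ) f W.prop
      exact IsPullback.of_hasPullback _ _
  have hF : ∀ {V W : (etale τ).Over ⊤ Y} (k : V ⟶ W),
      (F.map k).left ≫ pullback.fst W.hom f = pullback.fst V.hom f ≫ k.left := fun k => by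
    rw [MorphismProperty.Over.pullback_map_left]
    exact pullback.lift_fst _ _ _
  have hF' : ∀ {V W : (etale τ).Over ⊤ Y} (k : V ⟶ W),
      (F.map k).left ≫ pullback.snd W.hom f = pullback.snd V.hom f := fun k => by
    rw [MorphismProperty.Over.pullback_map_left]
    exact pullback.lift_snd _ _ _
  have key : ∀ Z : (etale τ).Over ⊤ X, ∃ (V : (etale τ).Over ⊤ Y) (ε : F.obj V ⟶ Z),
      ∀ W : (etale τ).Over ⊤ Y, Function.Bijective fun β : W ⟶ V => F.map β ≫ ε := by
    intro Z
    obtain ⟨V, p, hp, H⟩ := h.exists_pushforward f Z.hom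
    let V' : (etale τ).Over ⊤ Y := MorphismProperty.Over.mk ⊤ p hp
    obtain ⟨ε, hε, H⟩ := H _ _ _ (hP V')
    refine ⟨V', MorphismProperty.Over.homMk ε hε, fun W => ?_⟩
    obtain ⟨H₁, H₂⟩ := H _ _ _ _ _ W.prop (hP W)
    refine ⟨fun β β' e => ?_, fun γ => ?_⟩
    · ext
      exact H₁ β.left β'.left _ _ (MorphismProperty.Over.w β) (MorphismProperty.Over.w β')
        (hF β) (hF' β) (hF β') (hF' β') (congrArg (fun k => k.left) e)
    · obtain ⟨β, hβ, hβ'⟩ := H₂ γ.left (MorphismProperty.Over.w γ)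
      refine ⟨MorphismProperty.Over.homMk β hβ, ?_⟩
      ext
      exact hβ' _ (hF _) (hF' _)
  choose G ε hε using key
  let e : ∀ W Z, (F.obj W ⟶ Z) ≃ (W ⟶ G Z) := fun W Z => (Equiv.ofBijective _ (hε Z W)).symm
  have he : ∀ (W : (etale τ).Over ⊤ Y) Z (k : F.obj W ⟶ Z), F.map (e W Z k) ≫ ε Z = k :=
    fun W Z k => (Equiv.ofBijective _ (hε Z W)).apply_symm_apply k
  exact (Adjunction.adjunctionOfEquivRight e (fun W W' Z g k => by
    refine (hε Z _).1 ?_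
    simp only [he, Functor.map_comp, Category.assoc])).isLeftAdjoint

end Over

end Glutos

namespace Glutos

/-! ### The glutos of étale arrows -/

section EtaleGlutos

variable {C : Type v} [Category.{w} C] {τ : Precoverage C}

namespace IsGluingPresite

variable (h : IsGluingPresite.{u} τ)

include h

theorem etale_coproductDesc {I : Type u} {U : I → C} {X : C} (f : ∀ i, U i ⟶ X)
    (hf : ∀ i, etale τ (f i)) (c : Cofan U) (hc : IsColimit c) :
    etale τ (hc.desc (Cofan.mk X f)) := by
  obtain ⟨Q, π, hπ, hQ, hd⟩ := h.exists_coproduct U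
  have hQ' := (h.isUniversalColimit_cofan hπ hQ hd).isColimit
  have hfac : ∀ i, π i ≫ hQ'.desc (Cofan.mk X f) = f i := fun i => hQ'.fac (Cofan.mk X f) ⟨i⟩
  have hdesc : etale τ (hQ'.desc (Cofan.mk X f)) := by
    refine h.etale_of_cover (S := Presieve.ofArrows U π) ?_ hQ ?_
    · rintro _ _ ⟨i⟩
      exact hπ i
    · rintro _ _ ⟨i⟩
      rw [hfac]
      exact hf i
  have : hc.desc (Cofan.mk X f) =
      (hc.coconePointUniqueUpToIso hQ').hom ≫ hQ'.desc (Cofan.mk X f) :=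
    hc.hom_ext fun j => by simp
  rw [this]
  exact h.etale_comp (h.etale_of_clopens (h.clopens_of_isIso _)) hdesc

theorem isUGlutos_etale : IsUGlutos.{u} C (etale τ) where
  toIsClopos := h.isClopos_etale
  isUCategory := h.isUCategory
  of_postcomp _ _ _ _ _ := h.etale_of_postcomp
  isUTopos := h.isUTopos
  inverseImage _ _ f := ⟨preservesFiniteLimits_overPullback h.isClopos_etale
    (fun _ _ _ _ _ => h.etale_of_postcomp) f, h.isLeftAdjoint_overPullback f⟩
  coproducts I U := by
    obtain ⟨Q, π, hπ, hQ, hd⟩ := h.exists_coproduct U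
    have := h.subcanonical
    exact ⟨Cofan.mk Q π, h.isUniversalColimit_cofan hπ hQ hd,
      fun i => ⟨h.etale_of_clopens (hπ i), h.mono_of_clopens (hπ i)⟩,
      fun i j hij Z p q H => nonempty_isInitial_of_bot_mem (hd i j Z p q hij H.w)⟩
  coproductDesc _ _ _ f hf c hc := h.etale_coproductDesc f hf c hc
  effectiveEpi _ _ _ hf _ := h.effectiveEpi_of_etale hf
  of_precomp _ _ _ _ _ hpf hp _ := h.etale_of_precomp hpf hp
  quotients _ _ _ _ hE hu _ hl := h.exists_quotient hE hu hl
  localPullbacks _ _ _ _ _ _ _ hr _ _ := h.hasPullback_of_epi hr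

end IsGluingPresite

end EtaleGlutos

end Glutos

namespace Glutos

/-! ### Consequences of universality of colimits -/

section UniversalColimits

variable {C : Type v} [Category.{w} C]

/-- The cocone obtained from a universal colimit by base change is a colimit. -/
theorem existsUnique_desc_of_isUniversalColimit {K : Type*} [Category* K] {F : K ⥤ C}
    {c : Cocone F} (hc : IsUniversalColimit c) {Y : C} (f : Y ⟶ c.pt) {P : K → C}
    (p : ∀ k, P k ⟶ Y) (q : ∀ k, P k ⟶ F.obj k)
    (H : ∀ k, IsPullback (p k) (q k) f (c.ι.app k)) {T : C} (e : ∀ k, P k ⟶ T)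
    (he : ∀ (k l : K) (m : k ⟶ l) (t : P k ⟶ P l), t ≫ p l = p k → t ≫ q l = q k ≫ F.map m →
      t ≫ e l = e k) :
    ∃! d : Y ⟶ T, ∀ k, p k ≫ d = e k := by
  -- The diagram of pullbacks; its transition arrows are forced, and pasting makes the
  -- transformation to `F` cartesian.
  let F' : K ⥤ C :=
    { obj := P
      map := fun {k l} m => (H l).lift (p k) (q k ≫ F.map m) (by simp [(H k).w])
      map_id := fun k => (H k).hom_ext (by simp) (by simp)
      map_comp := fun m n => (H _).hom_ext (by simp) (by simp) }
  have h₁ : ∀ {k l} (m : k ⟶ l), F'.map m ≫ p l = p k := fun m => (H _).lift_fst ..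
  have h₂ : ∀ {k l} (m : k ⟶ l), F'.map m ≫ q l = q k ≫ F.map m := fun m => (H _).lift_snd ..
  let c' : Cocone F' := ⟨Y, { app := p, naturality := fun k l m => by simp [h₁] }⟩
  let α : F' ⟶ F := { app := q, naturality := fun k l m => h₂ m }
  obtain ⟨hc'⟩ := hc c' α f (by ext k; exact (H k).w.symm) (fun k l m => by
    refine IsPullback.of_right (h₁₁ := F'.map m) (h₁₂ := p l) (v₁₁ := q k) (v₁₂ := q l) (v₁₃ := f)
      (h₂₁ := F.map m) (h₂₂ := c.ι.app l) ?_ (h₂ m) (H l)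
    rw [h₁, c.w]
    exact H k) H
  let s : Cocone F' := ⟨T, { app := e, naturality := fun k l m =>
    (he k l m _ (h₁ m) (h₂ m)).trans (Category.comp_id _).symm }⟩
  exact ⟨hc'.desc s, hc'.fac s, fun d hd => hc'.uniq s d hd⟩

theorem existsUnique_desc_of_isUniversalColimit_cofan {I : Type*} {U : I → C} {c : Cofan U}
    (hc : IsUniversalColimit c) {Y : C} (f : Y ⟶ c.pt) {P : I → C}
    (p : ∀ i, P i ⟶ Y) (q : ∀ i, P i ⟶ U i)
    (H : ∀ i, IsPullback (p i) (q i) f (c.inj i)) {T : C} (e : ∀ i, P i ⟶ T) :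
    ∃! d : Y ⟶ T, ∀ i, p i ≫ d = e i := by
  obtain ⟨d, hd, hu⟩ := existsUnique_desc_of_isUniversalColimit hc f
    (P := fun k => P k.as) (fun k => p k.as) (fun k => q k.as) (fun k => H k.as)
    (fun k => e k.as) (by
      rintro ⟨k⟩ ⟨l⟩ m t h₁ h₂
      obtain rfl : k = l := Discrete.eq_of_hom m
      have : t = 𝟙 _ := (H k).hom_ext (by rw [h₁, Category.id_comp]) (by
        rw [h₂, Category.id_comp]
        have : m = 𝟙 _ := rfl
        rw [this, CategoryTheory.Functor.map_id]
        exact Category.comp_id _)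
      rw [this]
      exact Category.id_comp _)
  exact ⟨d, fun i => hd ⟨i⟩, fun d' hd' => hu d' fun k => hd' k.as⟩

/-- The pulled back cofork is again a colimit, and its leg at `zero` factors through the leg at
`one`, so the latter alone separates arrows. -/
theorem epi_of_isUniversalColimit_cofork {R X Q : C} {u v : R ⟶ X} {q : X ⟶ Q}
    {h : u ≫ q = v ≫ q} (hc : IsUniversalColimit (Cofork.ofπ q h)) {P Y : C} {f : Y ⟶ Q}
    {p : P ⟶ Y} {x : P ⟶ X} (H : IsPullback p x f q) [HasPullback f (u ≫ q)] : Epi p := by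
  refine ⟨fun {T} g g' e => ?_⟩
  let H' : ∀ k, Σ' (P : C) (p : P ⟶ Y) (q' : P ⟶ (parallelPair u v).obj k),
      IsPullback p q' f ((Cofork.ofπ q h).ι.app k) := fun k => match k with
    | .zero => ⟨_, _, _, IsPullback.of_hasPullback f (u ≫ q)⟩
    | .one => ⟨_, _, _, H⟩
  obtain ⟨d, hd, hu⟩ := existsUnique_desc_of_isUniversalColimit hc f (fun k => (H' k).2.1)
    (fun k => (H' k).2.2.1) (fun k => (H' k).2.2.2) (fun k => (H' k).2.1 ≫ g)
    fun k l m t h₁ h₂ => by rw [reassoc_of% h₁]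
  refine (hu g fun _ => rfl).trans (hu g' ?_).symm
  have e' : (H' .one).2.1 ≫ g' = (H' .one).2.1 ≫ g := e.symm
  rintro (_ | _)
  · let t : (H' .zero).1 ⟶ (H' .one).1 := H.lift (pullback.fst f (u ≫ q))
      (pullback.snd f (u ≫ q) ≫ u) (by rw [Category.assoc, pullback.condition])
    have ht : t ≫ (H' .one).2.1 = (H' .zero).2.1 := H.lift_fst ..
    rw [← ht, Category.assoc, Category.assoc, e']
  · exact e'

end UniversalColimits

/-! ### Locality on the source in a glutos -/

section GlutosLemmas

variable {E : Type v} [Category.{w} E] {P : MorphismProperty E}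

namespace IsUGlutos

variable (h : IsUGlutos.{u} E P)

include h

theorem hasPullback {X Y Z : E} {f : X ⟶ Z} (hf : P f) (g : Y ⟶ Z) : HasPullback f g :=
  have := h.hasPullbacks
  MorphismProperty.HasPullbacks.hasPullback g hf

theorem hasPullback' {X Y Z : E} {f : X ⟶ Z} (hf : P f) (g : Y ⟶ Z) : HasPullback g f :=
  have := h.hasPullback hf g
  hasPullback_symmetry f g

theorem of_isPullback {W X Y Z : E} {p : W ⟶ X} {q : W ⟶ Y} {f : X ⟶ Z} {g : Y ⟶ Z}
    (H : IsPullback p q f g) (hf : P f) : P q :=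
  h.isStableUnderBaseChange.of_isPullback H hf

theorem comp {X Y Z : E} {f : X ⟶ Y} {g : Y ⟶ Z} (hf : P f) (hg : P g) : P (f ≫ g) :=
  h.isStableUnderComposition.comp_mem f g hf hg

/-- Epimorphisms belonging to `P` are stable under base change. -/
theorem epi_of_isPullback {X Y X' Y' : E} {f : Y' ⟶ Y} {p : X ⟶ Y} {p' : X' ⟶ Y'} {x : X' ⟶ X}
    (H : IsPullback p' x f p) (hp : P p) [Epi p] : Epi p' := by
  have := h.hasPullback hp p
  have HR := IsPullback.of_hasPullback p p
  let a := pullback.fst p p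
  let b := pullback.snd p p
  have hb : P b := h.of_isPullback HR hp
  have ha : P a := h.of_isPullback HR.flip hp
  have := h.hasPullback hb a
  -- The kernel pair of `p` has a universal coequalizer `q`. Since `p` is an effective epi, it is
  -- isomorphic to `q` and inherits universality.
  obtain ⟨Q, q, hq, hqP, hk, hc⟩ := h.quotients a b
    (IsKernelPair.equivalenceRelation p a b (pullback.isLimit b a) HR).isEquivalenceRelation ha hb
    (locallyOCoequalizable_of_eq (fun X => h.of_isIso _ inferInstance) p hp HR.w)
  have : EffectiveEpi p := h.effectiveEpi p hp inferInstance
  have hqe : Epi q := epi_of_isColimit_cofork hc.isColimit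
  let d : Q ⟶ Y := Cofork.IsColimit.desc hc.isColimit p HR.w
  have hd : q ≫ d = p := Cofork.IsColimit.π_desc' hc.isColimit p HR.w
  let d' : Y ⟶ Q := EffectiveEpi.desc p q fun {Z} g₁ g₂ e => by
    rw [← HR.lift_fst g₁ g₂ e, Category.assoc, hq, ← Category.assoc]
    exact congrArg (· ≫ q) (HR.lift_snd g₁ g₂ e)
  have hd' : p ≫ d' = q := EffectiveEpi.fac ..
  have : IsIso d' := ⟨d, by rw [← cancel_epi p, reassoc_of% hd', hd, Category.comp_id],
    by rw [← cancel_epi q, reassoc_of% hd, hd', Category.comp_id]⟩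
  have H' : IsPullback p' x (f ≫ d') q := by
    have := H.paste_horiz (IsPullback.of_horiz_isIso ⟨by simp⟩ : IsPullback (𝟙 Y') f (f ≫ d') d')
    rwa [Category.comp_id, hd'] at this
  have := h.hasPullback' (h.comp ha hqP) (f ≫ d')
  exact epi_of_isUniversalColimit_cofork hc H'

variable {I : Type u} {X : E} {U : I → E} {a : ∀ i, U i ⟶ X} (ha : ∀ i, P (a i))
  (hepi : ∀ ⦃T : E⦄ (g g' : X ⟶ T), (∀ i, a i ≫ g = a i ≫ g') → g = g')

include ha hepi

/-- Base change keeps the family jointly epi: it amounts to one epi of `P` from the coproduct, and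
both such epis and coproducts are stable under pullback. -/
theorem hom_ext_of_epiFamily {Y : E} (f : Y ⟶ X) {V : I → E} {b : ∀ i, V i ⟶ Y}
    {t : ∀ i, V i ⟶ U i} (H : ∀ i, IsPullback (b i) (t i) f (a i)) {T : E} {g g' : Y ⟶ T}
    (e : ∀ i, b i ≫ g = b i ≫ g') : g = g' := by
  obtain ⟨c, hc, hinj, -⟩ := h.coproducts I U
  let p : c.pt ⟶ X := hc.isColimit.desc (Cofan.mk X a)
  have hfac : ∀ i, c.inj i ≫ p = a i := fun i => hc.isColimit.fac (Cofan.mk X a) ⟨i⟩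
  have hp : P p := h.coproductDesc I U X a ha c hc.isColimit
  have : Epi p := ⟨fun g g' e => hepi g g' fun i => by rw [← hfac, Category.assoc, e, Category.assoc]⟩
  have := h.hasPullback' hp f
  have HZ := IsPullback.of_hasPullback f p
  have := h.epi_of_isPullback HZ hp
  have hV := fun i => h.hasPullback' (hinj i).1 (pullback.snd f p)
  rw [← cancel_epi (pullback.fst f p)]
  refine (existsUnique_desc_of_isUniversalColimit_cofan hc (pullback.snd f p) _ _
    (fun i => IsPullback.of_hasPullback (pullback.snd f p) (c.inj i))
    (fun i => pullback.fst (pullback.snd f p) (c.inj i) ≫ pullback.fst f p ≫ g)).unique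
    (fun _ => rfl) fun i => ?_
  have e₁ : (pullback.fst (pullback.snd f p) (c.inj i) ≫ pullback.fst f p) ≫ f =
      pullback.snd (pullback.snd f p) (c.inj i) ≫ a i := by
    rw [Category.assoc, HZ.w, ← hfac, pullback.condition_assoc]
  have e₂ := (H i).lift_fst _ _ e₁
  rw [← Category.assoc, ← Category.assoc, ← e₂, Category.assoc, Category.assoc, e]

theorem exists_desc_of_epiFamily {T : E} (e : ∀ i, U i ⟶ T)
    (he : ∀ (i j : I) (W : E) (s : W ⟶ U i) (t : W ⟶ U j), s ≫ a i = t ≫ a j →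
      s ≫ e i = t ≫ e j) : ∃ d : X ⟶ T, ∀ i, a i ≫ d = e i := by
  obtain ⟨c, hc, hinj, -⟩ := h.coproducts I U
  let p : c.pt ⟶ X := hc.isColimit.desc (Cofan.mk X a)
  have hfac : ∀ i, c.inj i ≫ p = a i := fun i => hc.isColimit.fac (Cofan.mk X a) ⟨i⟩
  have hp : P p := h.coproductDesc I U X a ha c hc.isColimit
  have : Epi p := ⟨fun g g' e => hepi g g' fun i => by rw [← hfac, Category.assoc, e, Category.assoc]⟩
  have := h.effectiveEpi p hp inferInstance
  let k : c.pt ⟶ T := hc.isColimit.desc (Cofan.mk T e)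
  have hk : ∀ i, c.inj i ≫ k = e i := fun i => hc.isColimit.fac (Cofan.mk T e) ⟨i⟩
  have hV := fun {Z : E} (g : Z ⟶ c.pt) i => h.hasPullback' (hinj i).1 g
  have ext : ∀ {Z T : E} (g : Z ⟶ c.pt) (x y : Z ⟶ T),
      (∀ i, pullback.fst g (c.inj i) ≫ x = pullback.fst g (c.inj i) ≫ y) → x = y :=
    fun g x y hxy => (existsUnique_desc_of_isUniversalColimit_cofan hc g _ _
      (fun i => IsPullback.of_hasPullback g (c.inj i))
      (fun i => pullback.fst g (c.inj i) ≫ x)).unique (fun _ => rfl) fun i => (hxy i).symm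
  -- To descend along the effective epi `p`, two points of the coproduct over the same point of `X`
  -- are compared after splitting their source by the summands containing each.
  refine ⟨EffectiveEpi.desc p k fun {Z} g₁ g₂ e₁₂ => ext g₁ _ _ fun i =>
    ext (pullback.fst g₁ (c.inj i) ≫ g₂) _ _ fun j => ?_, fun i => ?_⟩
  · have e₁ := pullback.condition (f := g₁) (g := c.inj i)
    have e₂ := pullback.condition (f := pullback.fst g₁ (c.inj i) ≫ g₂) (g := c.inj j)
    rw [reassoc_of% e₁, reassoc_of% e₂, hk, hk, ← Category.assoc]
    refine he _ _ _ _ _ ?_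
    rw [← hfac, ← hfac, Category.assoc, ← reassoc_of% e₁, e₁₂, reassoc_of% e₂]
  · rw [← hfac, Category.assoc, EffectiveEpi.fac, hk]

/-- A property of being in `P` can be checked on a covering of the source. -/
theorem of_epiFamily {Y : E} (f : X ⟶ Y) (hf : ∀ i, P (a i ≫ f)) : P f := by
  obtain ⟨c, hc, hinj, -⟩ := h.coproducts I U
  let p : c.pt ⟶ X := hc.isColimit.desc (Cofan.mk X a)
  have hfac : ∀ i, c.inj i ≫ p = a i := fun i => hc.isColimit.fac (Cofan.mk X a) ⟨i⟩
  have hp : P p := h.coproductDesc I U X a ha c hc.isColimit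
  have : Epi p := ⟨fun g g' e => hepi g g' fun i => by rw [← hfac, Category.assoc, e, Category.assoc]⟩
  refine h.of_precomp p f ?_ hp inferInstance
  have : p ≫ f = hc.isColimit.desc (Cofan.mk Y fun i => a i ≫ f) :=
    hc.isColimit.hom_ext fun ⟨i⟩ => by
      rw [hc.isColimit.fac]
      exact (Category.assoc _ _ _).symm.trans (congrArg (· ≫ f) (hfac i))
  rw [this]
  exact h.coproductDesc I U Y _ hf c hc.isColimit

/-- Pullback squares can be recognized locally. -/
theorem isPullback_of_epiFamily {W Y Z : E} {p : W ⟶ X} {q : W ⟶ Y} {f : X ⟶ Z} {g : Y ⟶ Z}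
    (hw : p ≫ f = q ≫ g) {V : I → E} {x : ∀ i, V i ⟶ U i} {r : ∀ i, V i ⟶ W}
    (H : ∀ i, IsPullback (x i) (r i) (a i) p)
    (H' : ∀ i, IsPullback (x i) (r i ≫ q) (a i ≫ f) g) : IsPullback p q f g := by
  have hPB := fun {T : E} (s : T ⟶ X) i => h.hasPullback' (ha i) s
  have Ha := fun {T : E} (s : T ⟶ X) i => IsPullback.of_hasPullback s (a i)
  have ext : ∀ {T : E} (s t : T ⟶ W), s ≫ p = t ≫ p → s ≫ q = t ≫ q → s = t := by
    intro T s t hp hq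
    refine h.hom_ext_of_epiFamily ha hepi (s ≫ p) (Ha (s ≫ p)) fun i => ?_
    have e₁ : pullback.snd (s ≫ p) (a i) ≫ a i = (pullback.fst (s ≫ p) (a i) ≫ s) ≫ p := by
      rw [← pullback.condition, Category.assoc]
    have e₂ : pullback.snd (s ≫ p) (a i) ≫ a i = (pullback.fst (s ≫ p) (a i) ≫ t) ≫ p := by
      rw [← pullback.condition, Category.assoc, hp]
    rw [← (H i).lift_snd _ _ e₁, ← (H i).lift_snd _ _ e₂]
    congr 1
    refine (H' i).hom_ext ?_ ?_
    · rw [(H i).lift_fst, (H i).lift_fst]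
    · rw [← Category.assoc, ← Category.assoc, (H i).lift_snd, (H i).lift_snd, Category.assoc,
        Category.assoc, hq]
  have key : ∀ {T : E} (s : T ⟶ X) (t : T ⟶ Y), s ≫ f = t ≫ g →
      ∃ l : T ⟶ W, l ≫ p = s ∧ l ≫ q = t := by
    intro T s t e
    have e₁ : ∀ i, pullback.snd s (a i) ≫ a i ≫ f = (pullback.fst s (a i) ≫ t) ≫ g := fun i => by
      rw [← pullback.condition_assoc, Category.assoc, e]
    have l₁ : ∀ i, ((H' i).lift _ _ (e₁ i) ≫ r i) ≫ p = pullback.fst s (a i) ≫ s := fun i => by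
      rw [Category.assoc, ← (H i).w, ← Category.assoc, (H' i).lift_fst, pullback.condition]
    have l₂ : ∀ i, ((H' i).lift _ _ (e₁ i) ≫ r i) ≫ q = pullback.fst s (a i) ≫ t := fun i => by
      rw [Category.assoc, (H' i).lift_snd]
    obtain ⟨l, hl⟩ := h.exists_desc_of_epiFamily (a := fun i => pullback.fst s (a i))
      (fun i => h.of_isPullback (Ha s i).flip (ha i))
      (fun T' g g' => h.hom_ext_of_epiFamily ha hepi s (Ha s))
      (fun i => (H' i).lift _ _ (e₁ i) ≫ r i) fun i j T' y z eyz => ext _ _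
        (by rw [Category.assoc y, Category.assoc z, l₁, l₁, reassoc_of% eyz])
        (by rw [Category.assoc y, Category.assoc z, l₂, l₂, reassoc_of% eyz])
    exact ⟨l, h.hom_ext_of_epiFamily ha hepi s (Ha s) fun i => by
        rw [← Category.assoc, hl, l₁],
      h.hom_ext_of_epiFamily ha hepi s (Ha s) fun i => by
        rw [← Category.assoc, hl, l₂]⟩
  choose l h₁ h₂ using @key
  exact ⟨⟨hw⟩, ⟨PullbackCone.IsLimit.mk _ (fun s => l s.fst s.snd s.condition)
    (fun s => h₁ _ _ _) (fun s => h₂ _ _ _)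
    fun s m hm hm' => ext _ _ (by rw [hm, h₁]) (by rw [hm', h₂])⟩⟩

end IsUGlutos

/-- All arrows of `P` with target `Y` form an epi sink, as the identity is among them. -/
theorem IsClopos.clopens_iff (h : IsClopos P) {X Y : E} (f : X ⟶ Y) :
    clopens (epiPretopology P) f ↔ P f := by
  refine ⟨fun ⟨S, hS, hf⟩ => hS.1 f hf, fun hf => ?_⟩
  refine ⟨fun Z g => P g, ⟨fun _ _ hg => hg, fun Z g g' H => ?_⟩, hf⟩
  simpa using H (𝟙 Y) (h.of_isIso _ inferInstance)

theorem IsClopos.clopens_monoPart_iff (h : IsClopos P) {X Y : E} (f : X ⟶ Y) :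
    clopens (monoPart (epiPretopology P)) f ↔ P f ∧ Mono f := by
  refine ⟨fun ⟨S, hS, hf⟩ => ⟨hS.1.1 f hf, hS.2 f hf⟩, fun hf => ?_⟩
  refine ⟨fun Z g => P g ∧ Mono g, ⟨⟨fun _ _ hg => hg.1, fun Z g g' H => ?_⟩,
    fun _ _ hg => hg.2⟩, hf⟩
  simpa using H (𝟙 Y) ⟨h.of_isIso _ inferInstance, inferInstance⟩

end GlutosLemmas

/-! ### Universality of the étale glutos -/

section Extension

variable {C : Type v} [Category.{w} C] {τ : Precoverage C}
  {E : Type v'} [Category.{w'} E] {P : MorphismProperty E}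

/-- Functors into a glutos that are continuous for the clopen arrows are continuous for the étale
arrows. -/
theorem IsGluingPresite.isContinuous_etale (h : IsGluingPresite.{u} τ) (hE : IsUGlutos.{u} E P)
    {F : C ⥤ E} (hF : IsContinuous τ (epiPretopology P) F) :
    IsContinuous (epiPretopology (etale τ)) (epiPretopology P) F := by
  have hmap : ∀ {X Y : C} {f : X ⟶ Y}, clopens τ f → P (F.map f) := fun hf =>
    (hE.toIsClopos.clopens_iff _).1 (hF.map_clopen _ hf)
  -- Each clopen covering contains a small family with jointly epi image, which is the input of the
  -- local criteria in the glutos.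
  have hcov : ∀ {X : C} {S : Presieve X}, SinkIn (clopens τ) S →
      Sieve.generate S ∈ τ.toGrothendieck X →
      ∃ (I : Type u) (U : I → C) (a : ∀ i, U i ⟶ X), (∀ i, S (a i)) ∧
        ∀ ⦃T : E⦄ (g g' : F.obj X ⟶ T), (∀ i, F.map (a i) ≫ g = F.map (a i) ≫ g') → g = g' := by
    intro X S hS hc
    obtain ⟨I, U, a, haS, e⟩ := h.exists_small_family S hS
    refine ⟨I, U, a, haS, fun T g g' H => ?_⟩
    rw [e] at hc
    refine (hF.map_covering _ ((h.ofArrows_mem_iff fun i => hS _ (haS i)).2 hc)).2 g g' ?_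
    rintro _ _ ⟨⟨i⟩⟩
    exact H i
  have hetale : ∀ {X Y : C} {f : X ⟶ Y}, etale τ f → P (F.map f) := by
    intro X Y f hf
    obtain ⟨I, U, a, ha, hepi⟩ := hcov (fun _ _ ha => ha.1) hf
    refine hE.of_epiFamily (fun i => hmap (ha i).1) hepi _ fun i => ?_
    rw [← F.map_comp]
    exact hmap (ha i).2
  refine ⟨fun X S hS => ⟨?_, ?_⟩, fun X Y f hf => ?_, fun W X Y Z p q f g hf H => ?_⟩
  · rintro _ _ ⟨hf⟩
    exact hetale (hS.1 _ hf)
  · intro T g g' H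
    -- The clopen arrows factoring through `S` cover `X`; arrows agreeing on the image of `S` agree
    -- on the image of these.
    let S' : Presieve X := fun W a => clopens τ a ∧ ∃ (Y : C) (f : Y ⟶ X) (b : W ⟶ Y),
      S f ∧ b ≫ f = a
    have hS' : Sieve.generate S' ∈ τ.toGrothendieck X := by
      refine transitive_generate (h.generate_mem_of_isEpiSink hS.1 hS.2) _ fun Y f hf => ?_
      refine τ.toGrothendieck.superset_covering ?_ (hS.1 f hf)
      rw [Sieve.generate_le_iff]
      intro W b hb
      exact ⟨W, 𝟙 W, b ≫ f, ⟨hb.2, Y, f, b, hf, rfl⟩, by simp⟩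
    obtain ⟨I, U, a, ha, hepi⟩ := hcov (fun _ _ ha => ha.1) hS'
    refine hepi g g' fun i => ?_
    obtain ⟨-, Y, f, b, hf, e⟩ := ha i
    rw [← e, F.map_comp, Category.assoc, Category.assoc, H _ (.of hf)]
  · rw [hE.toIsClopos.clopens_iff]
    exact hetale ((h.isClopos_etale.clopens_iff f).1 hf)
  · rw [h.isClopos_etale.clopens_iff] at hf
    obtain ⟨I, U, a, ha, hepi⟩ := hcov (fun _ _ ha => ha.1) hf
    have := fun i => h.hasPullback (ha i).1 p
    have H' := fun i => IsPullback.of_hasPullback (a i) p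
    refine hE.isPullback_of_epiFamily (fun i => hmap (ha i).1) hepi
      (by rw [← F.map_comp, H.w, F.map_comp])
      (fun i => hF.map_isPullback _ _ _ _ (ha i).1 (H' i)) fun i => ?_
    rw [← F.map_comp, ← F.map_comp]
    exact hF.map_isPullback _ _ _ _ (ha i).2 ((H' i).flip.paste_horiz H.flip).flip

theorem presieve_map_id {X : C} (S : Presieve X) : S.map (𝟭 C) = S :=
  le_antisymm (by rintro _ _ ⟨hf⟩; exact hf) fun _ _ hf => .of (F := 𝟭 C) hf

namespace IsGluingPresite

variable (h : IsGluingPresite.{u} τ)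

include h

theorem isContinuous_id_etale : IsContinuous τ (epiPretopology (etale τ)) (𝟭 C) where
  map_covering X S hS := by
    have := h.subcanonical
    rw [presieve_map_id]
    exact ⟨fun _ _ hf => h.etale_of_clopens (clopens_of_mem hS _ hf),
      isEpiSink_of_mem (Precoverage.generate_mem_toGrothendieck hS)⟩
  map_clopen X Y f hf := (h.isClopos_etale.clopens_iff _).2 (h.etale_of_clopens hf)
  map_isPullback _ _ _ _ _ _ _ _ _ H := H

theorem isUniversalArrow_id : IsUniversalArrow.{u} τ (etale τ) (𝟭 C) := by
  refine ⟨h.isContinuous_id_etale, fun E _ P hE => ?_⟩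
  let K : ContinuousFunctors τ (epiPretopology P) ⥤
      ContinuousFunctors (epiPretopology (etale τ)) (epiPretopology P) :=
    ObjectProperty.lift _ (ObjectProperty.ι _) fun F => h.isContinuous_etale hE F.property
  have hK : K ⋙ precomp (epiPretopology P) (𝟭 C) h.isContinuous_id_etale = 𝟭 _ := rfl
  have hK' : precomp (epiPretopology P) (𝟭 C) h.isContinuous_id_etale ⋙ K = 𝟭 _ := rfl
  exact ⟨(CategoryTheory.Equivalence.mk _ K (eqToIso hK'.symm) (eqToIso hK)).isEquivalence_functor,
    K, hK⟩

theorem isUPresite : IsUPresite.{u} τ where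
  toIsPresite := h.toIsPresite
  isUCategory := h.isUCategory
  localGenerators X := by
    obtain ⟨B⟩ := h.nonempty_clopenBasis X
    refine ⟨Set.range B.obj, inferInstance, fun U a ha => ?_⟩
    obtain ⟨s, e, he⟩ := B.exists_iso a ha
    refine ⟨_, h.hasIsos.mem_coverings_of_isIso e.inv, ?_⟩
    rintro _ _ ⟨⟩
    exact ⟨s, rfl⟩

theorem presiteEquivalent_monoPart :
    PresiteEquivalent τ (monoPart (epiPretopology (etale τ))) := by
  have hc : ∀ {X Y : C} (f : X ⟶ Y), clopens (monoPart (epiPretopology (etale τ))) f ↔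
      clopens τ f := fun f => by
    rw [h.isClopos_etale.clopens_monoPart_iff]
    exact ⟨fun ⟨hf, _⟩ => h.clopens_of_etale_of_mono hf,
      fun hf => ⟨h.etale_of_clopens hf, h.mono_of_clopens hf⟩⟩
  have := h.subcanonical
  refine ⟨CategoryTheory.Equivalence.refl, ⟨fun X S hS => ?_, fun X Y f hf => (hc f).2 hf,
    fun _ _ _ _ _ _ _ _ _ H => H⟩, ⟨fun X S hS => ?_, fun X Y f hf => (hc f).1 hf,
    fun _ _ _ _ _ _ _ _ _ H => H⟩⟩
  · rw [show S.map CategoryTheory.Equivalence.refl.functor = S from presieve_map_id S]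
    exact ⟨⟨fun _ _ hf => h.etale_of_clopens (clopens_of_mem hS _ hf),
      isEpiSink_of_mem (Precoverage.generate_mem_toGrothendieck hS)⟩, h.mono S hS⟩
  · rw [show S.map CategoryTheory.Equivalence.refl.inverse = S from presieve_map_id S]
    exact h.ng3 X S (fun _ _ hf => (hc _).1 ⟨S, hS, hf⟩) hS.1.2

theorem isNearlyUGlutos : IsNearlyUGlutos.{u} τ :=
  ⟨h.isUPresite, C, inferInstance, τ, C, inferInstance, etale τ, 𝟭 C, h.isUPresite,
    h.isUGlutos_etale, h.isUniversalArrow_id, h.presiteEquivalent_monoPart⟩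

end IsGluingPresite

end Extension

end Glutos

namespace Glutos

/-! ### Gluing along monos inside a glutos -/

section GlutosGluing

variable {E : Type v} [Category.{w} E] {P : MorphismProperty E}

namespace IsUGlutos

/-- The topology of a glutos generated by the small jointly epi families of arrows of `P`. -/
def topology (h : IsUGlutos.{u} E P) : GrothendieckTopology E where
  sieves X := {R | ∃ (I : Type u) (U : I → E) (a : ∀ i, U i ⟶ X), (∀ i, P (a i)) ∧
    (∀ ⦃T : E⦄ (g g' : X ⟶ T), (∀ i, a i ≫ g = a i ≫ g') → g = g') ∧ ∀ i, R (a i)}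
  top_mem' X := ⟨PUnit, fun _ => X, fun _ => 𝟙 X, fun _ => h.of_isIso _ inferInstance,
    fun _ g g' e => by simpa using e ⟨⟩, fun _ => trivial⟩
  pullback_stable' X Y R f := by
    rintro ⟨I, U, a, ha, hepi, hR⟩
    have := fun i => h.hasPullback' (ha i) f
    have H := fun i => IsPullback.of_hasPullback f (a i)
    refine ⟨I, _, fun i => pullback.fst f (a i), fun i => h.of_isPullback (H i).flip (ha i),
      fun T g g' => h.hom_ext_of_epiFamily ha hepi f H, fun i => ?_⟩
    change R (pullback.fst f (a i) ≫ f)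
    rw [(H i).w]
    exact R.downward_closed (hR i) _
  transitive' X R hR R' H := by
    obtain ⟨I, U, a, ha, hepi, hR⟩ := hR
    choose K V b hb hepi' hR' using fun i => H (hR i)
    refine ⟨Σ i, K i, fun x => V x.1 x.2, fun x => b x.1 x.2 ≫ a x.1,
      fun x => h.comp (hb _ _) (ha _), fun T g g' e => hepi g g' fun i => hepi' i _ _ fun j => ?_,
      fun x => hR' x.1 x.2⟩
    simpa using e ⟨i, j⟩

variable (h : IsUGlutos.{u} E P)

include h

theorem subcanonical_topology : h.topology.Subcanonical := by
  refine GrothendieckTopology.Subcanonical.of_isSheaf_yoneda_obj _ fun T X R hR => ?_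
  obtain ⟨I, U, a, ha, hepi, hR⟩ := hR
  intro x hx
  obtain ⟨d, hd⟩ := h.exists_desc_of_epiFamily ha hepi (T := T) (fun i => x (a i) (hR i))
    fun i j W s t e => hx s t (hR i) (hR j) e
  have := fun {Y : E} (f : Y ⟶ X) i => h.hasPullback' (ha i) f
  refine ⟨d, fun Y f hf => ?_, fun d' hd' => hepi _ _ fun i => ?_⟩
  · refine h.hom_ext_of_epiFamily ha hepi f (fun i => IsPullback.of_hasPullback f (a i))
      fun i => ?_
    have e := pullback.condition (f := f) (g := a i)
    have := hx (pullback.fst f (a i)) (pullback.snd f (a i)) hf (hR i) e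
    change pullback.fst f (a i) ≫ f ≫ d = pullback.fst f (a i) ≫ x f hf
    rw [reassoc_of% e, hd]
    exact this.symm
  · rw [hd]
    exact hd' _ (hR i)

theorem ofArrows_mem_topology {I : Type u} {X : E} {U : I → E} {a : ∀ i, U i ⟶ X}
    (ha : ∀ i, P (a i))
    (hepi : ∀ ⦃T : E⦄ (g g' : X ⟶ T), (∀ i, a i ≫ g = a i ≫ g') → g = g') :
    Sieve.ofArrows U a ∈ h.topology X :=
  ⟨I, U, a, ha, hepi, fun i => Sieve.ofArrows_mk _ _ i⟩

theorem bot_mem_topology {Z : E} (hZ : IsInitial Z) : ⊥ ∈ h.topology Z :=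
  ⟨PEmpty, PEmpty.elim, fun i => i.elim, fun i => i.elim, fun _ _ _ _ => hZ.hom_ext _ _,
    fun i => i.elim⟩

/-- Disjointness in terms of generalized elements: the overlap of two distinct summands is initial,
hence has the empty covering. -/
theorem exists_coproduct {I : Type u} (U : I → E) :
    ∃ (c : Cofan U) (_ : IsColimit c), (∀ i, P (c.inj i)) ∧ (∀ i, Mono (c.inj i)) ∧
      Sieve.ofArrows U c.inj ∈ h.topology c.pt ∧
      ∀ i j T (a : T ⟶ U i) (b : T ⟶ U j), a ≫ c.inj i = b ≫ c.inj j →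
        (∃ e : i = j, a ≫ eqToHom (congrArg U e) = b) ∨ ⊥ ∈ h.topology T := by
  classical
  obtain ⟨c, hc, hinj, hd⟩ := h.coproducts I U
  refine ⟨c, hc.isColimit, fun i => (hinj i).1, fun i => (hinj i).2,
    h.ofArrows_mem_topology (fun i => (hinj i).1) fun T g g' e =>
      hc.isColimit.hom_ext fun i => e i.as, fun i j T a b e => ?_⟩
  by_cases hij : i = j
  · subst hij
    have := (hinj i).2
    exact .inl ⟨rfl, by simpa using (cancel_mono _).1 e⟩
  · have := h.hasPullback (hinj i).1 (c.inj j)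
    obtain ⟨hZ⟩ := hd i j hij _ _ _ (IsPullback.of_hasPullback (c.inj i) (c.inj j))
    exact .inr (bot_mem_of_hom (h.bot_mem_topology hZ) (pullback.lift a b e))

/-- Objects can be glued along clopen subobjects. -/
theorem exists_glue {I : Type u} (U : I → E) (V : I → I → E) (p : ∀ i j, V i j ⟶ U i)
    (q : ∀ i j, V i j ⟶ U j) (hp : ∀ i j, P (p i j)) (hq : ∀ i j, P (q i j))
    (hmono : ∀ i j, Mono (p i j))
    (refl : ∀ i, ∃ s : U i ⟶ V i i, s ≫ p i i = 𝟙 _ ∧ s ≫ q i i = 𝟙 _)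
    (symm : ∀ i j, ∃ t : V i j ⟶ V j i, t ≫ p j i = q i j ∧ t ≫ q j i = p i j)
    (trans : ∀ i j k T (x : T ⟶ V i j) (y : T ⟶ V j k), x ≫ q i j = y ≫ p j k →
      ∃ z : T ⟶ V i k, z ≫ p i k = x ≫ p i j ∧ z ≫ q i k = y ≫ q j k) :
    ∃ (Q : E) (π : ∀ i, U i ⟶ Q), (∀ i, P (π i)) ∧ (∀ i, Mono (π i)) ∧
      (∀ ⦃T : E⦄ (g g' : Q ⟶ T), (∀ i, π i ≫ g = π i ≫ g') → g = g') ∧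
      ∀ i j, IsPullback (p i j) (q i j) (π i) (π j) := by
  have := h.subcanonical_topology
  have hbot : ∀ {T Z : E} (_ : ⊥ ∈ h.topology T) (f g : T ⟶ Z), f = g :=
    fun hT f g => hom_ext_of_mem hT fun _ _ h => h.elim
  obtain ⟨c, hc, hcP, hcm, hcov, hdis⟩ := h.exists_coproduct U
  obtain ⟨r, hr, hrP, hrm, hrcov, hrdis⟩ := h.exists_coproduct fun x : I × I => V x.1 x.2
  let ι : ∀ i j, V i j ⟶ r.pt := fun i j => r.inj (i, j)
  -- The gluing data become one equivalence relation `u, v` on the coproduct of the `U i`; its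
  -- properties are checked on summands.
  let u : r.pt ⟶ c.pt := hr.desc (Cofan.mk _ fun x => p x.1 x.2 ≫ c.inj x.1)
  let v : r.pt ⟶ c.pt := hr.desc (Cofan.mk _ fun x => q x.1 x.2 ≫ c.inj x.2)
  have hιu : ∀ i j, ι i j ≫ u = p i j ≫ c.inj i := fun i j => hr.fac _ ⟨(i, j)⟩
  have hιv : ∀ i j, ι i j ≫ v = q i j ≫ c.inj j := fun i j => hr.fac _ ⟨(i, j)⟩
  have hu : P u := h.coproductDesc _ _ _ _ (fun x => h.comp (hp _ _) (hcP _)) r hr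
  have hv : P v := h.coproductDesc _ _ _ _ (fun x => h.comp (hq _ _) (hcP _)) r hr
  have hdiag : ∀ i, p i i = q i i := fun i => by
    obtain ⟨s, s₁, s₂⟩ := refl i
    have : p i i ≫ s = 𝟙 _ := by
      rw [← cancel_mono (p i i), Category.assoc, s₁, Category.comp_id, Category.id_comp]
    rw [← Category.comp_id (p i i), ← s₂, reassoc_of% this]
  have hmem : ∀ {T : E} (s : T ⟶ r.pt), (Sieve.ofArrows _ r.inj).pullback s ∈ h.topology T :=
    fun s => h.topology.pullback_stable s hrcov
  have hj : JointlyMono₂ u v := by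
    refine ⟨fun T s t e₁ e₂ => ?_⟩
    refine hom_ext_of_mem (h.topology.intersection_covering (hmem s) (hmem t)) ?_
    rintro W k ⟨⟨_, x, _, ⟨i, j⟩, ex⟩, ⟨_, y, _, ⟨i', j'⟩, ey⟩⟩
    change x ≫ ι i j = k ≫ s at ex
    change y ≫ ι i' j' = k ≫ t at ey
    have e₁' : (x ≫ p i j) ≫ c.inj i = (y ≫ p i' j') ≫ c.inj i' := by
      rw [Category.assoc, Category.assoc, ← hιu, ← hιu, reassoc_of% ex, reassoc_of% ey, e₁]
    have e₂' : (x ≫ q i j) ≫ c.inj j = (y ≫ q i' j') ≫ c.inj j' := by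
      rw [Category.assoc, Category.assoc, ← hιv, ← hιv, reassoc_of% ex, reassoc_of% ey, e₂]
    obtain ⟨rfl, e₃⟩ | hW := hdis _ _ _ _ _ e₁'
    · obtain ⟨rfl, e₄⟩ | hW := hdis _ _ _ _ _ e₂'
      · have : x = y := by
          rw [← cancel_mono (p i j)]
          simpa using e₃
        rw [← ex, ← ey, this]
      · exact hbot hW _ _
    · exact hbot hW _ _
  have hE : IsEquivalenceRelation u v := by
    choose s s₁ s₂ using refl
    choose t t₁ t₂ using symm
    let ρ : c.pt ⟶ r.pt := hc.desc (Cofan.mk _ fun i => s i ≫ ι i i)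
    have hρ : ∀ i, c.inj i ≫ ρ = s i ≫ ι i i := fun i => hc.fac _ ⟨i⟩
    let σ : r.pt ⟶ r.pt := hr.desc (Cofan.mk _ fun x => t x.1 x.2 ≫ ι x.2 x.1)
    have hσ : ∀ i j, ι i j ≫ σ = t i j ≫ ι j i := fun i j => hr.fac _ ⟨(i, j)⟩
    have := h.hasPullback hv u
    obtain ⟨θ, θ₁, θ₂⟩ := exists_jointLift_of_mem u v hj (pullback.fst v u ≫ u)
      (pullback.snd v u ≫ v) (h.topology.intersection_covering (hmem (pullback.fst v u))
        (hmem (pullback.snd v u))) (by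
      rintro W k ⟨⟨_, x, _, ⟨i, j⟩, ex⟩, ⟨_, y, _, ⟨i', j'⟩, ey⟩⟩
      change x ≫ ι i j = k ≫ pullback.fst v u at ex
      change y ≫ ι i' j' = k ≫ pullback.snd v u at ey
      have e : (x ≫ q i j) ≫ c.inj j = (y ≫ p i' j') ≫ c.inj i' := by
        rw [Category.assoc, Category.assoc, ← hιu, ← hιv, reassoc_of% ex, reassoc_of% ey,
          pullback.condition]
      obtain ⟨rfl, e⟩ | hW := hdis _ _ _ _ _ e
      · obtain ⟨z, z₁, z₂⟩ := trans i j j' W x y (by simpa using e)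
        refine ⟨z ≫ ι i j', ?_, ?_⟩
        · rw [Category.assoc, hιu, reassoc_of% z₁, ← reassoc_of% ex, hιu]
        · rw [Category.assoc, hιv, reassoc_of% z₂, ← reassoc_of% ey, hιv]
      · exact ⟨(nonempty_isInitial_of_bot_mem hW).some.to _, hbot hW _ _, hbot hW _ _⟩)
    refine EquivalenceRelation.isEquivalenceRelation
      { toJointlyMono₂ := hj
        r := ρ
        reflexivity₁ := hom_ext_of_family hcov fun i => by
          rw [reassoc_of% hρ, hιu, reassoc_of% s₁, Category.comp_id]
        reflexivity₂ := hom_ext_of_family hcov fun i => by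
          rw [reassoc_of% hρ, hιv, reassoc_of% s₂, Category.comp_id]
        s := σ
        symmetry₁ := hom_ext_of_family hrcov fun ⟨i, j⟩ => by
          change ι i j ≫ _ = ι i j ≫ _
          rw [reassoc_of% hσ, hιu, reassoc_of% t₁, hιv]
        symmetry₂ := hom_ext_of_family hrcov fun ⟨i, j⟩ => by
          change ι i j ≫ _ = ι i j ≫ _
          rw [reassoc_of% hσ, hιv, reassoc_of% t₂, hιu]
        c := _
        isLimit := pullback.isLimit v u
        t := θ
        transitivity₁ := θ₁
        transitivity₂ := θ₂ }
  -- On the summand `U i` the relation induced is that of `V i i`, which is diagonal by `hdiag`, so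
  -- the identity coequalizes it.
  have hl : LocallyOCoequalizable P u v := by
    refine ⟨Presieve.ofArrows U c.inj, fun _ _ ⟨i⟩ => hcP i, isEpiSink_of_mem hcov, ?_⟩
    rintro _ _ ⟨i⟩
    have := h.hasPullback' hu (c.inj i)
    have := h.hasPullback hv (c.inj i)
    have H₀ := IsPullback.of_hasPullback (c.inj i) u
    have H₁ := IsPullback.of_hasPullback v (c.inj i)
    have hb : P (pullback.snd (c.inj i) u) := h.of_isPullback H₀ (hcP i)
    have := h.hasPullback hb (pullback.fst v (c.inj i))
    have H₂ := IsPullback.of_hasPullback (pullback.snd (c.inj i) u) (pullback.fst v (c.inj i))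
    refine ⟨_, _, _, ⟨_, _, _, _, _, _, _, _, H₀, H₁, H₂, rfl, rfl⟩, _, 𝟙 _,
      h.of_isIso _ inferInstance, ?_⟩
    rw [Category.comp_id, Category.comp_id]
    refine hom_ext_of_mem (hmem (pullback.fst (pullback.snd (c.inj i) u)
      (pullback.fst v (c.inj i)) ≫ pullback.snd (c.inj i) u)) ?_
    rintro W k ⟨_, x, _, ⟨j, l⟩, ex⟩
    change x ≫ ι j l = k ≫ _ ≫ _ at ex
    have e₁ : (x ≫ p j l) ≫ c.inj j = (k ≫ pullback.fst (pullback.snd (c.inj i) u)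
        (pullback.fst v (c.inj i)) ≫ pullback.fst (c.inj i) u) ≫ c.inj i := by
      rw [Category.assoc, ← hιu, reassoc_of% ex, Category.assoc, Category.assoc, H₀.w]
    have e₂ : (x ≫ q j l) ≫ c.inj l = (k ≫ pullback.snd (pullback.snd (c.inj i) u)
        (pullback.fst v (c.inj i)) ≫ pullback.snd v (c.inj i)) ≫ c.inj i := by
      rw [Category.assoc, ← hιv, reassoc_of% ex, reassoc_of% H₂.w, Category.assoc,
        Category.assoc, H₁.w]
    obtain ⟨e₃, e₃'⟩ | hW := hdis _ _ _ _ _ e₁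
    · obtain ⟨e₄, e₄'⟩ | hW := hdis _ _ _ _ _ e₂
      · subst e₃ e₄
        have e₃'' := (Category.comp_id _).symm.trans e₃'
        have e₄'' := (Category.comp_id _).symm.trans e₄'
        rw [← e₃'', ← e₄'', hdiag]
      · exact hbot hW _ _
    · exact hbot hW _ _
  obtain ⟨Q, π, hπ, hπP, hk, hQ⟩ := h.quotients u v hE hu hv hl
  have hepi : Epi π := epi_of_isColimit_cofork hQ.isColimit
  -- Equal points of the quotient are related; locally the witness lies in some `V i' j'`, and
  -- disjointness forces `i' = i`, `j' = j` or an empty source.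
  have hlift : ∀ i j T (a : T ⟶ U i) (b : T ⟶ U j), a ≫ c.inj i ≫ π = b ≫ c.inj j ≫ π →
      ∃ l : T ⟶ V i j, l ≫ p i j = a ∧ l ≫ q i j = b := by
    intro i j T a b e
    have e' : (a ≫ c.inj i) ≫ π = (b ≫ c.inj j) ≫ π := by simpa using e
    have l₁ := hk.lift_fst _ _ e'
    have l₂ := hk.lift_snd _ _ e'
    generalize hk.lift _ _ e' = l at l₁ l₂
    refine exists_jointLift_of_mem (p i j) (q i j) ⟨fun T s t e _ => (cancel_mono _).1 e⟩ a b
      (hmem l) ?_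
    rintro W k ⟨_, x, _, ⟨i', j'⟩, ex⟩
    change x ≫ ι i' j' = k ≫ l at ex
    have e₁ : (x ≫ p i' j') ≫ c.inj i' = (k ≫ a) ≫ c.inj i := by
      rw [Category.assoc, Category.assoc, ← hιu, reassoc_of% ex, l₁]
    have e₂ : (x ≫ q i' j') ≫ c.inj j' = (k ≫ b) ≫ c.inj j := by
      rw [Category.assoc, Category.assoc, ← hιv, reassoc_of% ex, l₂]
    obtain ⟨rfl, e₃⟩ | hW := hdis _ _ _ _ _ e₁
    · obtain ⟨rfl, e₄⟩ | hW := hdis _ _ _ _ _ e₂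
      · exact ⟨x, by simpa using e₃, by simpa using e₄⟩
      · exact ⟨(nonempty_isInitial_of_bot_mem hW).some.to _, hbot hW _ _, hbot hW _ _⟩
    · exact ⟨(nonempty_isInitial_of_bot_mem hW).some.to _, hbot hW _ _, hbot hW _ _⟩
  refine ⟨Q, fun i => c.inj i ≫ π, fun i => h.comp (hcP i) hπP, fun i => ⟨fun {T} a b e => ?_⟩,
    fun T g g' e => ?_, fun i j => ?_⟩
  · obtain ⟨l, rfl, rfl⟩ := hlift i i T a b e
    rw [hdiag]
  · rw [← cancel_epi π]
    exact hom_ext_of_family hcov fun i => by simpa using e i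
  · choose l l₁ l₂ using hlift i j
    refine ⟨⟨by rw [← reassoc_of% hιu, hπ, reassoc_of% hιv]⟩, ⟨PullbackCone.IsLimit.mk _
      (fun s => l _ s.fst s.snd s.condition) (fun s => l₁ _ _ _ _) (fun s => l₂ _ _ _ _)
      fun s m hm _ => by rw [← cancel_mono (p i j), hm, l₁]⟩⟩

end IsUGlutos

end GlutosGluing

end Glutos

namespace Glutos

/-! ### The conditions hold in a nearly glutos -/

section NearlyGlutos

variable {C : Type v} [Category.{w} C] {τ : Precoverage C}

/-- Small sets of topological generators bound the number of clopen subobjects. -/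
theorem ng1_of_isUPresite (hsub : τ.toGrothendieck.Subcanonical)
    (hU : IsUPresite.{u} τ) : NG1.{u} τ := by
  intro X
  have := hU.isUCategory.locallySmall
  obtain ⟨G, hG, hcov⟩ := hU.localGenerators X
  -- A clopen subobject is determined by the arrows from generators that factor through it, since it
  -- is covered by such arrows.
  refine small_of_injective (β := Set (Σ V : G, (V.1 ⟶ X)))
    (f := fun A => {k | A.1.Factors k.2}) fun A B h => Subtype.ext ?_
  have key : ∀ A B : {A : Subobject X // clopens τ A.arrow},
      ({k : Σ V : G, (V.1 ⟶ X) | A.1.Factors k.2} = {k | B.1.Factors k.2}) → A.1 ≤ B.1 := by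
    intro A B h
    obtain ⟨S, hS, hSG⟩ := hcov _ A.2
    obtain ⟨l, hl⟩ := exists_lift_of_mem B.1.arrow A.1.arrow
      (Precoverage.generate_mem_toGrothendieck hS) (by
        rintro W _ ⟨V, b, s, hs, rfl⟩
        have hA : A.1.Factors (s ≫ A.1.arrow) := Subobject.factors_of_factors_right _
          ((Subobject.factors_iff _ _).2 ⟨𝟙 _, Category.id_comp _⟩)
        have hB : B.1.Factors (s ≫ A.1.arrow) := (Set.ext_iff.1 h ⟨⟨V, hSG s hs⟩, _⟩).1 hA
        exact ⟨b ≫ B.1.factorThru _ hB, by simp⟩)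
    exact Subobject.le_of_comm l hl
  exact le_antisymm (key A B h) (key B A h.symm)

section Transport

variable {D : Type v'} [Category.{w'} D] {O : MorphismProperty D} (hM : IsMPresite τ)
  (hD : IsUGlutos.{u} D O) (e : C ≌ D)
  (hF : IsContinuous τ (monoPart (epiPretopology O)) e.functor)
  (hG : IsContinuous (monoPart (epiPretopology O)) τ e.inverse)

include hM hD hF hG

theorem clopens_iff_of_presiteEquivalence {X Y : C} (f : X ⟶ Y) :
    clopens τ f ↔ O (e.functor.map f) ∧ Mono (e.functor.map f) := by
  rw [← hD.toIsClopos.clopens_monoPart_iff]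
  refine ⟨hF.map_clopen f, fun hf => ?_⟩
  have : f = e.unit.app X ≫ e.inverse.map (e.functor.map f) ≫ e.unitInv.app Y := by simp
  rw [this]
  exact hM.clopens_comp (hM.clopens_of_isIso _)
    (hM.clopens_comp (hG.map_clopen _ hf) (hM.clopens_of_isIso _))

theorem ng3_of_presiteEquivalence : NG3 τ := by
  intro X S hS he
  have hFS : S.map e.functor ∈ monoPart (epiPretopology O) (e.functor.obj X) := by
    refine ⟨⟨?_, fun Z g g' H => ?_⟩, ?_⟩
    · rintro _ _ ⟨hf⟩
      exact ((clopens_iff_of_presiteEquivalence hM hD e hF hG _).1 (hS _ hf)).1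
    · apply e.inverse.map_injective
      rw [← cancel_epi (e.unit.app X)]
      refine he _ _ fun Y f hf => ?_
      have := congrArg e.inverse.map (H _ (.of hf))
      simpa using congrArg (e.unit.app Y ≫ ·) this
    · rintro _ _ ⟨hf⟩
      exact ((clopens_iff_of_presiteEquivalence hM hD e hF hG _).1 (hS _ hf)).2
  -- The image sink is a covering in the glutos; its transport back along the inverse, pulled back
  -- along the unit, refines `S`.
  rw [hM.mem_iff_generate_mem hS]
  refine τ.toGrothendieck.superset_covering ?_ (τ.toGrothendieck.pullback_stable (e.unit.app X)
    (Precoverage.generate_mem_toGrothendieck (hG.map_covering _ hFS)))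
  rintro T k ⟨_, b, _, ⟨⟨hf⟩⟩, hk⟩
  rename_i Y f
  refine ⟨Y, b ≫ e.unitInv.app Y, f, hf, ?_⟩
  have := e.unitInv.naturality f
  simp only [Functor.comp_map, Functor.id_map] at hk this
  rw [Category.assoc, ← this, reassoc_of% hk]
  simp

theorem exists_glue_of_presiteEquivalence {I : Type u} (U : I → C) (V : I → I → C)
    (p : ∀ i j, V i j ⟶ U i) (q : ∀ i j, V i j ⟶ U j) (hp : ∀ i j, clopens τ (p i j))
    (hq : ∀ i j, clopens τ (q i j))
    (refl : ∀ i, ∃ s : U i ⟶ V i i, s ≫ p i i = 𝟙 _ ∧ s ≫ q i i = 𝟙 _)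
    (symm : ∀ i j, ∃ t : V i j ⟶ V j i, t ≫ p j i = q i j ∧ t ≫ q j i = p i j)
    (cocycle : ∀ i j k, ∃ (T : C) (p₀ : T ⟶ V i j) (p₂ : T ⟶ V i k) (p₁ : T ⟶ V j k),
      p₀ ≫ p i j = p₂ ≫ p i k ∧ IsPullback p₀ p₁ (q i j) (p j k) ∧
        p₂ ≫ q i k = p₁ ≫ q j k) :
    ∃ (Q : C) (π : ∀ i, U i ⟶ Q), (∀ i, clopens τ (π i)) ∧
      (∀ ⦃T : C⦄ (g g' : Q ⟶ T), (∀ i, π i ≫ g = π i ≫ g') → g = g') ∧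
      ∀ i j, IsPullback (p i j) (q i j) (π i) (π j) := by
  have hcl := fun {X Y : C} (f : X ⟶ Y) => clopens_iff_of_presiteEquivalence hM hD e hF hG f
  obtain ⟨Q, π, hπ, hπm, hepi, hpb⟩ := hD.exists_glue (fun i => e.functor.obj (U i))
    (fun i j => e.functor.obj (V i j)) (fun i j => e.functor.map (p i j))
    (fun i j => e.functor.map (q i j)) (fun i j => ((hcl _).1 (hp i j)).1)
    (fun i j => ((hcl _).1 (hq i j)).1) (fun i j => ((hcl _).1 (hp i j)).2)
    (fun i => by
      obtain ⟨s, s₁, s₂⟩ := refl i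
      exact ⟨e.functor.map s, by rw [← Functor.map_comp, s₁, e.functor.map_id],
        by rw [← Functor.map_comp, s₂, e.functor.map_id]⟩)
    (fun i j => by
      obtain ⟨t, t₁, t₂⟩ := symm i j
      exact ⟨e.functor.map t, by rw [← Functor.map_comp, t₁], by rw [← Functor.map_comp, t₂]⟩)
    -- Transitivity comes from the middle cocycle square, whose pullback property the equivalence
    -- preserves; from the other two only commutativity is needed.
    (fun i j k T x y exy => by
      obtain ⟨W, p₀, p₂, p₁, h₁, H₂, h₃⟩ := cocycle i j k
      have H := H₂.map e.functor
      refine ⟨H.lift x y exy ≫ e.functor.map p₂, ?_, ?_⟩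
      · rw [Category.assoc, ← Functor.map_comp, ← h₁, Functor.map_comp, H.lift_fst_assoc]
      · rw [Category.assoc, ← Functor.map_comp, h₃, Functor.map_comp, H.lift_snd_assoc])
  refine ⟨e.inverse.obj Q, fun i => e.unit.app (U i) ≫ e.inverse.map (π i), fun i =>
    hM.clopens_comp (hM.clopens_of_isIso _)
      (hG.map_clopen _ ((hD.toIsClopos.clopens_monoPart_iff _).2 ⟨hπ i, hπm i⟩)),
    fun T g g' h => ?_, fun i j => ?_⟩
  · apply e.functor.map_injective
    rw [← cancel_epi (e.counitInv.app Q)]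
    refine hepi _ _ fun i => ?_
    have := congrArg e.functor.map (h i)
    simpa using this
  · have hκ : ∀ i, e.inverse.map (π i) ≫ (Iso.refl _).hom =
        (e.unitIso.app (U i)).symm.hom ≫ e.unit.app (U i) ≫ e.inverse.map (π i) := fun i => by
      simp
    exact ((hpb i j).map e.inverse).of_iso (e.unitIso.app _).symm (e.unitIso.app _).symm
      (e.unitIso.app _).symm (Iso.refl _) (e.unitInv.naturality _) (e.unitInv.naturality _)
      (hκ i) (hκ j)

theorem gluingCondition_of_presiteEquivalence (hsub : τ.toGrothendieck.Subcanonical) :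
    GluingCondition.{u} (clopens τ) := by
  intro I d hd hO _
  have h3 := ng3_of_presiteEquivalence hM hD e hF hG
  obtain ⟨Q, π, hπ, hepi, hpb⟩ := exists_glue_of_presiteEquivalence hM hD e hF hG d.right
    (fun i j => d.left (i, j)) (fun i j => d.fst (i, j)) (fun i j => d.snd (i, j))
    (fun i j => (hO _).1) (fun i j => (hO _).2) hd.refl hd.symm fun i j k => by
      obtain ⟨W, p₀, p₂, p₁, H₁, H₂, H₃⟩ := hd.cocycle i j k
      exact ⟨W, p₀, p₂, p₁, H₁.w, H₂, H₃.w⟩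
  refine ⟨Multicofork.ofπ d Q π fun a => (hpb a.1 a.2).w, ?_, hpb, hπ⟩
  refine isUniversalColimit_of_cover (J := τ.toGrothendieck) _
    (fun i : I => (WalkingMultispan.right i : WalkingMultispan (MultispanShape.prod I)))
    (hM.ofArrows_mem_of_epi h3 hπ hepi) (fun i j T a b h => .inr
      ⟨.left (i, j), WalkingMultispan.Hom.fst (J := MultispanShape.prod I) (i, j),
        WalkingMultispan.Hom.snd (J := MultispanShape.prod I) (i, j),
        (hpb i j).lift a b h, (hpb i j).lift_fst .., (hpb i j).lift_snd ..⟩) ?_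
  rintro (⟨i, j⟩ | i)
  · exact ⟨i, ⟨WalkingMultispan.Hom.fst (J := MultispanShape.prod I) (i, j)⟩⟩
  · exact ⟨i, ⟨𝟙 _⟩⟩

/-- The union of a small subfamily generating the same sieve, glued along its intersections in `X`.
The glued object maps monically to `X`, since the gluing identifies points exactly when their images
agree. -/
theorem ng2_of_presiteEquivalence (hsub : τ.toGrothendieck.Subcanonical) (h1 : NG1.{u} τ) :
    NG2 τ := by
  intro X K U' a' ha'
  have h3 := ng3_of_presiteEquivalence hM hD e hF hG
  have hg := gluingCondition_of_presiteEquivalence hM hD e hF hG hsub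
  have hS : SinkIn (clopens τ) (Presieve.ofArrows U' a') := fun _ _ ⟨i⟩ => ha' i
  obtain ⟨I, U, a, ha, hgen⟩ := hM.exists_small_family h1 _ hS
  replace ha := fun i => hS _ (ha i)
  obtain ⟨Q, π, hπ, hcov, hker⟩ := hM.exists_glue hg h3 U (fun i j T s t => s ≫ a i = t ≫ a j)
    (fun _ _ _ => rfl) (fun _ _ _ _ _ h => h.symm) (fun _ _ _ _ _ _ _ h h' => h.trans h')
    (fun _ _ _ _ _ _ t h => by rw [Category.assoc, h, Category.assoc]) fun i j => by
      have := hM.hasPullback (ha i) (a j)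
      have H := IsPullback.of_hasPullback (a i) (a j)
      exact ⟨_, pullback.fst _ _, pullback.snd _ _, hM.clopens_of_isPullback' H (ha j), H.w,
        fun T s t h => ⟨H.lift s t h, H.lift_fst .., H.lift_snd ..⟩⟩
  obtain ⟨m, hm⟩ := exists_desc_of_family hcov a fun i j W s t h => (hker i j W s t).1 h
  have hmono : Mono m := by
    refine ⟨fun {T} s t h => ?_⟩
    refine hom_ext_of_mem (τ.toGrothendieck.intersection_covering
      (τ.toGrothendieck.pullback_stable s hcov) (τ.toGrothendieck.pullback_stable t hcov)) ?_
    rintro W k ⟨⟨_, x, _, ⟨i⟩, ex⟩, ⟨_, y, _, ⟨j⟩, ey⟩⟩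
    rw [← ex, ← ey, hker, ← hm, ← hm, reassoc_of% ex, reassoc_of% ey, h]
  have hcl := fun {X Y : C} (f : X ⟶ Y) => clopens_iff_of_presiteEquivalence hM hD e hF hG f
  have hmcl : clopens τ m := by
    -- Clopenness of `m` is checked in the glutos, where membership in `O` is local on the source.
    refine (hcl m).2 ⟨hD.of_epiFamily (fun i => ((hcl _).1 (hπ i)).1) (fun T g g' h => ?_) _
      fun i => ?_, inferInstance⟩
    · apply e.inverse.map_injective
      rw [← cancel_epi (e.unit.app Q)]
      refine hom_ext_of_family hcov fun i => ?_
      have := congrArg e.inverse.map (h i)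
      simpa using congrArg (e.unit.app _ ≫ ·) this
    · rw [← Functor.map_comp, hm]
      exact ((hcl _).1 (ha i)).1
  have hl : ∀ k, ∃ l : U' k ⟶ Q, l ≫ m = a' k := fun k => by
    have : Sieve.ofArrows U a (a' k) := by
      rw [← hgen]
      exact Sieve.ofArrows_mk U' a' k
    obtain ⟨_, b, _, ⟨i⟩, h⟩ := this
    exact ⟨b ≫ π i, by rw [Category.assoc, hm, h]⟩
  choose l hl using hl
  refine ⟨Q, m, l, (hM.ofArrows_mem_iff fun k => hM.clopens_of_comp_mono (f := m) ?_).2 ?_,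
    hmcl, hl⟩
  · rw [hl]
    exact ha' k
  · refine τ.toGrothendieck.superset_covering ?_ hcov
    rw [Sieve.generate_le_iff]
    rintro _ _ ⟨i⟩
    have : Sieve.ofArrows U' a' (a i) := by
      rw [Sieve.ofArrows, hgen]
      exact Sieve.ofArrows_mk U a i
    obtain ⟨_, b, _, ⟨k⟩, h⟩ := this
    exact ⟨_, b, _, .mk k, by rw [← cancel_mono m, Category.assoc, hl, h, hm]⟩

end Transport

theorem IsNearlyUGlutos.isGluingPresite (hM : IsMPresite τ)
    (hsub : τ.toGrothendieck.Subcanonical) (hN : IsNearlyUGlutos.{u} τ) :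
    IsGluingPresite.{u} τ := by
  obtain ⟨hU, B, _, ρ, D, _, O, Y, -, hD, -, e, hF, hG⟩ := hN
  have h1 := ng1_of_isUPresite hsub hU
  exact ⟨hM, hU.isUCategory, hsub, gluingCondition_of_presiteEquivalence hM hD e hF hG hsub, h1,
    ng2_of_presiteEquivalence hM hD e hF hG hsub h1, ng3_of_presiteEquivalence hM hD e hF hG⟩

end NearlyGlutos

end Glutos

theorem mainTheorem9 {C : Type v} [Category.{w} C] (τ : Precoverage C)
    (hM : Glutos.IsMPresite τ) (hU : Glutos.IsUCategory.{u} C)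
    (hsub : τ.toGrothendieck.Subcanonical) :
    (Glutos.IsNearlyUGlutos.{u} τ ↔
      Glutos.GluingCondition.{u} (Glutos.clopens τ) ∧
        Glutos.NG1.{u} τ ∧ Glutos.NG2 τ ∧ Glutos.NG3 τ) ∧
    (Glutos.NG2 τ → ∀ (X : C) (A : Set (Subobject X)), (∀ a ∈ A, Glutos.clopens τ a.arrow) →
      ∃ b : Subobject X, IsLUB A b ∧ Glutos.clopens τ b.arrow) ∧
    (Glutos.NG3 τ → ∀ (X : C) (S : Presieve X), Glutos.SinkIn (Glutos.clopens τ) S →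
      Glutos.IsEpiSink S → Glutos.IsUniversalEffectiveEpiSink S) := by
  refine ⟨⟨fun hN => ?_, fun ⟨hg, h1, h2, h3⟩ =>
    Glutos.IsGluingPresite.isNearlyUGlutos ⟨hM, hU, hsub, hg, h1, h2, h3⟩⟩,
    Glutos.exists_isLUB_of_ng2 hM hsub, fun h3 X S hS he =>
      Glutos.isUniversalEffectiveEpiSink_of_mem (h3 X S hS he) hsub⟩
  have h := hN.isGluingPresite hM hsub
  exact ⟨h.gluing, h.ng1, h.ng2, h.ng3⟩
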